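/- **Setting.** Let $D=\{(\lambda_1,\lambda_2,\lambda_3)\in\mathbb R_{\ge0}^2\times\mathbb R: |\lambda_3|\le 2\sqrt{\lambda_1\lambda_2}\}$, $\mu:\mathbb R\to\mathbb R$ and $\kappa:D\to\mathbb R$. For $N\ge 1$, a Gaussian random function $\mathbf f_N:\mathbb R^N\to\mathbb R$ is written $\mathbf f_N\sim\mathcal N(\mu,\kappa)$ if $$\mathbb E[\mathbf f_N(x)]=\mu\bigl(\tfrac{\|x\|^2}2\bigr),\qquad \mathrm{Cov}(\mathbf f_N(x),\mathbf f_N(y))=\tfrac1N\,\kappa\bigl(\tfrac{\|x\|^2}2,\tfrac{\|y\|^2}2,\langle x,y\rangle\bigr)\qquad(x,y\in\mathbb R^N).$$ Assume that such a random function exists in every dimension $N\ge1$ ($\kappa$ is valid in all dimensions), that $\mu$ is continuously differentiable, and that the partial derivatives $\kappa_{12},\kappa_{13},\kappa_{23},\kappa_{33}$ exist and are continuous on $D$ (they exist in the interior of $D$ and extend continuously to $D$). A *general gradient span algorithm* $\mathfrak G$ is given by prefactors $h_n=(h^{(x)}_n,h^{(g)}_{n,0},\dots,h^{(g)}_{n,n-1})$,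 $n\ge1$, which do not depend on $N$. It selects, for a function $f:\mathbb R^N\to\mathbb R$ and a start $x_0\in\mathbb R^N$, the points $$x_n=h^{(x)}_n(I_{n-1})\,x_0+\sum_{k=0}^{n-1}h^{(g)}_{n,k}(I_{n-1})\,\nabla f(x_k),\qquad I_n=\bigl(f(x_k):k\le n\bigr)\cup\bigl(\langle v,w\rangle: v,w\in\{x_0,\nabla f(x_0),\dots,\nabla f(x_n)\}\bigr).$$ For every $N\ge1$ let $\mathbf f_N\sim\mathcal N(\mu,\kappa)$ have almost surely continuously differentiable sample paths, and let $(\mathbf f_N,\nabla\mathbf f_N)$ be strictly positive definite: for distinct $x_1,\dots,x_n\in\mathbb R^N$ and $w_k\in\mathbb R^{N+1}$, $\mathbb V[\sum_k w_k^T(\mathbf f_N,\nabla\mathbf f_N)(x_k)]=0$ implies $w_k=0$ for all $k$. Let $X_0\in\mathbb R^N$ be a random vector, independent of $\mathbf f_N$, with $\|X_0\|=\lambda$ almost surely, where $\lambda$ does not depend on $N$. Let $X_n$ be the points that $\mathfrak G$ selects for $\mathbf f_N$ from $X_0$, and let $\mathbf I_n$ be the corresponding information vectors. **Theorem (predictable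 progress).** There are deterministic vectors $\mathscr I_n$, depending only on $\mathfrak G,\mu,\kappa,\lambda$, for which the following holds. If all prefactors $h_n$ are continuous and $h^{(g)}_{n,n-1}$ vanishes nowhere for every $n\ge1$, then for every $n\ge0$ $$\mathbf I_n\longrightarrow\mathscr I_n\quad\text{in probability as }N\to\infty .$$ **Extension.** Set $\delta=1$ if $\lambda\ne0$ and $\delta=0$ if $\lambda=0$. Let $V_n=\mathrm{span}\{X_0,\nabla\mathbf f_N(X_0),\dots,\nabla\mathbf f_N(X_{n-1})\}$ and $d_n=\dim V_n$. Let $\mathbf v_0,\mathbf v_1,\dots$ be the orthonormal vectors obtained by the Gram–Schmidt procedure from $X_0,\nabla\mathbf f_N(X_0),\nabla\mathbf f_N(X_1),\dots$, where vectors that depend linearly on their predecessors are skipped, so that $\mathbf v_0,\dots,\mathbf v_{d_n-1}$ is a basis of $V_n$. Let $\tilde{\mathbf v}_n=\nabla\mathbf f_N(X_n)-P_{V_n}\nabla\mathbf f_N(X_n)$, where $P_{V_n}$ is the orthogonal projection onto $V_n$. When statements refer to the basis of $V_n$, set $\mathbf v_i:=0$ for $i\ge d_n$. There are moreover real numbers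 $\mathfrak f_k$, $\gamma_k^{(i)}$, $y_k^{(i)}$, depending only on $\mathfrak G,\mu,\kappa,\lambda$, for which the following holds. Suppose that the prefactors are only measurable, and call $h_m$ *regular* if it is continuous at the point $\mathscr I_{m-1}$ and $h^{(g)}_{m,m-1}(\mathscr I_{m-1})\neq0$. Then, for every $n\ge0$, if $h_1,\dots,h_n$ are regular: 1. (Information convergence) In probability, $\mathbf I_n\to\mathscr I_n$, and the vector of all $\mathbf f_N(X_k)$ and $\langle\nabla\mathbf f_N(X_k),\mathbf v_i\rangle$ with $k\le n$, $i<n+1+\delta$ (basis of $V_{n+1}$) converges to the vector of all $\mathfrak f_k$ and $\gamma^{(i)}_k$. 2. (Full rank) If $h^{(g)}_{j,j-1}$ vanishes nowhere for every $j\ge1$, then almost surely $d_m=m+\delta$ for all $m\le n+1$ and all $N\ge \max(1,m+\delta)$. In any case $\mathbb P(d_m=m+\delta)\to1$ for $m\le n+1$, and for all $k\le n$, in probability, $$\langle\nabla\mathbf f_N(X_k),\mathbf v_{d_k}\rangle\to\gamma_k^{(k+\delta)},\qquad \|\tilde{\mathbf v}_k\|\to\gamma_k^{(k+\delta)}\ne0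 ,$$ where $\mathbf v_{d_k}$ is taken from the basis of $V_{k+1}$. If also $h_{n+1}$ is regular: 3. (Representation) For all $k,l\le m\le n+1$, with the basis of $V_m$ and all limits in probability, $$\langle X_k,\mathbf v_i\rangle\to y_k^{(i)}\ (i<m+\delta),\qquad \|X_k\|^2=\sum_{i<d_m}\langle X_k,\mathbf v_i\rangle^2\to\sum_{i<m+\delta}(y_k^{(i)})^2,$$ $$\|X_k-X_l\|^2=\sum_{i<d_m}\langle X_k-X_l,\mathbf v_i\rangle^2\to\sum_{i<m+\delta}(y_k^{(i)}-y_l^{(i)})^2 .$$ 4. (Asymptotically different points) For all $k\ne l$ with $k,l\le n+1$: $\ \sum_{i<n+1+\delta}(y^{(i)}_k-y^{(i)}_l)^2>0$. -/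

import Mathlib

open MeasureTheory ProbabilityTheory Filter Topology

noncomputable section

/-- `ℝ^N` with the Euclidean norm. -/
abbrev Eucl (N : ℕ) : Type := EuclideanSpace ℝ (Fin N)

/-! ### Gradient span algorithms -/

/-- The dimensionless information available at time `n`: the function values `f(x_k)`, `k ≤ n`,
and the inner products of all pairs of the `n + 2` vectors `x_0, ∇f(x_0), …, ∇f(x_n)`. -/
abbrev Info (n : ℕ) : Type := (Fin (n + 1) → ℝ) × (Fin (n + 2) → Fin (n + 2) → ℝ)

/-- The tuple `(x_0, ∇f(x_0), …, ∇f(x_n))`. -/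
def spanVectors {N n : ℕ} (f : Eucl N → ℝ) (x₀ : Eucl N) (x : Fin (n + 1) → Eucl N) :
    Fin (n + 2) → Eucl N :=
  Fin.cons x₀ (fun k => gradient f (x k))

/-- The information vector `I_n` generated by a function `f`, the start `x₀` and the evaluation
points `x_0, …, x_n`. -/
def information {N n : ℕ} (f : Eucl N → ℝ) (x₀ : Eucl N) (x : Fin (n + 1) → Eucl N) : Info n :=
  (fun k => f (x k), fun i j => inner ℝ (spanVectors f x₀ x i) (spanVectors f x₀ x j))

/-- A general gradient span algorithm, given by its prefactors: `hx n I` is `h^{(x)}_{n+1}(I)` and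
`hg n I k` is `h^{(g)}_{n+1,k}(I)` for `k ≤ n`, as functions of the information `I = I_n`. -/
structure GSA where
  hx : (n : ℕ) → Info n → ℝ
  hg : (n : ℕ) → Info n → Fin (n + 1) → ℝ

namespace GSA

/-- The evaluation points `x_n = 𝔊(f, x₀, n)`. -/
def point {N : ℕ} (G : GSA) (f : Eucl N → ℝ) (x₀ : Eucl N) : ℕ → Eucl N
  | 0 => x₀
  | n + 1 =>
    let I : Info n := information f x₀ (fun k : Fin (n + 1) => G.point f x₀ k.val)
    G.hx n I • x₀ + ∑ k : Fin (n + 1), G.hg n I k • gradient f (G.point f x₀ k.val)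
  termination_by n => n
  decreasing_by all_goals exact k.isLt

/-- The information vector `I_n` of the algorithm run on `f` from `x₀`. -/
def info {N : ℕ} (G : GSA) (f : Eucl N → ℝ) (x₀ : Eucl N) (n : ℕ) : Info n :=
  information f x₀ (fun k : Fin (n + 1) => G.point f x₀ k.val)

/-- All prefactors are continuous. -/
def ContinuousPrefactors (G : GSA) : Prop :=
  ∀ n, Continuous (G.hx n) ∧ Continuous (G.hg n)

/-- All prefactors are measurable. -/
def MeasurablePrefactors (G : GSA) : Prop :=
  ∀ n, Measurable (G.hx n) ∧ Measurable (G.hg n)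

/-- The most recent gradient is always used: `h^{(g)}_{n+1,n}` vanishes nowhere. -/
def UsesRecentGradient (G : GSA) : Prop :=
  ∀ n (I : Info n), G.hg n I (Fin.last n) ≠ 0

/-- The prefactors `h_{n+1}` are continuous at the point `I` and use the most recent gradient
there: `h^{(g)}_{n+1,n}(I) ≠ 0`. -/
def RegularAt (G : GSA) (n : ℕ) (I : Info n) : Prop :=
  ContinuousAt (G.hx n) I ∧ ContinuousAt (G.hg n) I ∧ G.hg n I (Fin.last n) ≠ 0

/-- The vector space of evaluation points `V_n = span {x₀, ∇f(x_0), …, ∇f(x_{n-1})}`. -/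
def evalSpace {N : ℕ} (G : GSA) (f : Eucl N → ℝ) (x₀ : Eucl N) (n : ℕ) :
    Submodule ℝ (Eucl N) :=
  Submodule.span ℝ ({x₀} ∪ {v | ∃ k < n, v = gradient f (G.point f x₀ k)})

/-- `d_n = dim V_n`. -/
def dim {N : ℕ} (G : GSA) (f : Eucl N → ℝ) (x₀ : Eucl N) (n : ℕ) : ℕ :=
  Module.finrank ℝ (G.evalSpace f x₀ n)

/-- The Gram-Schmidt candidate `∇f(x_n) - P_{V_n} ∇f(x_n)`. -/
def candidate {N : ℕ} (G : GSA) (f : Eucl N → ℝ) (x₀ : Eucl N) (n : ℕ) : Eucl N :=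
  gradient f (G.point f x₀ n) - (G.evalSpace f x₀ n).starProjection (gradient f (G.point f x₀ n))

open Classical in
/-- The orthonormal basis `v_0, …, v_{d_n - 1}` of `V_n`, as a list: it starts with `x₀ / ‖x₀‖` if
`x₀ ≠ 0`, and in every step the normalized candidate is appended if it is not zero. -/
def basisList {N : ℕ} (G : GSA) (f : Eucl N → ℝ) (x₀ : Eucl N) : ℕ → List (Eucl N)
  | 0 => if x₀ = 0 then [] else [‖x₀‖⁻¹ • x₀]
  | n + 1 =>
    G.basisList f x₀ n ++
      (if G.candidate f x₀ n = 0 then [] else [‖G.candidate f x₀ n‖⁻¹ • G.candidate f x₀ n])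

/-- The `i`-th vector `v_i` of the orthonormal basis of `V_n`; it is `0` if `i ≥ d_n`. -/
def basisVec {N : ℕ} (G : GSA) (f : Eucl N → ℝ) (x₀ : Eucl N) (n i : ℕ) : Eucl N :=
  (G.basisList f x₀ n).getD i 0

/-- The modified information: the values `f(x_k)`, `k ≤ n`, and the inner products
`⟨∇f(x_k), v_i⟩` for `k ≤ n` and `i < d`, with `v_i` from the basis of `V_{n+1}`. -/
def coordInfo {N : ℕ} (G : GSA) (f : Eucl N → ℝ) (x₀ : Eucl N) (n d : ℕ) :
    (Fin (n + 1) → ℝ) × (Fin (n + 1) → Fin d → ℝ) :=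
  (fun k => f (G.point f x₀ k.val),
    fun k i => inner ℝ (gradient f (G.point f x₀ k.val)) (G.basisVec f x₀ (n + 1) i.val))

end GSA

/-! ### Random functions -/

/-- `f` is a Gaussian random function on `ℝ^N` with mean `μ(‖x‖²/2)` and covariance
`κ(‖x‖²/2, ‖y‖²/2, ⟨x, y⟩) / N`. -/
structure IsIsotropicGRF (μ : ℝ → ℝ) (κ : ℝ → ℝ → ℝ → ℝ) {N : ℕ} {Ω : Type*} [MeasurableSpace Ω]
    (P : Measure Ω) (f : Ω → Eucl N → ℝ) : Prop where
  measurable : ∀ x, Measurable (fun ω => f ω x)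
  gaussian : IsGaussianProcess (fun (x : Eucl N) (ω : Ω) => f ω x) P
  mean : ∀ x, ∫ ω, f ω x ∂P = μ (‖x‖ ^ 2 / 2)
  cov : ∀ x y, cov[fun ω => f ω x, fun ω => f ω y; P]
    = 1 / (N : ℝ) * κ (‖x‖ ^ 2 / 2) (‖y‖ ^ 2 / 2) (inner ℝ x y)

/-- In every dimension `N ≥ 1` there is an isotropic Gaussian random function with mean `μ` and
covariance kernel `κ`. -/
def ValidInAllDimensions (μ : ℝ → ℝ) (κ : ℝ → ℝ → ℝ → ℝ) : Prop :=
  ∀ N : ℕ, 1 ≤ N → ∃ (Ω : Type) (_ : MeasurableSpace Ω) (P : Measure Ω)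
    (f : Ω → Eucl N → ℝ), IsProbabilityMeasure P ∧ IsIsotropicGRF μ κ P f

/-- The domain `D` of the covariance kernels. It is a closed convex cone. -/
def kernelDomain : Set (ℝ × ℝ × ℝ) :=
  {p | 0 ≤ p.1 ∧ 0 ≤ p.2.1 ∧ |p.2.2| ≤ 2 * √(p.1 * p.2.1)}

/-- The mean is continuously differentiable, and the partial derivatives `κ₁₂`, `κ₁₃`, `κ₂₃`, `κ₃₃`
of the kernel exist and are continuous on `D`. As usual for a function on a closed set with
non-empty interior this means: they exist in the interior of `D` and have continuous extensions
to `D`. -/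
structure SufficientlySmooth (μ : ℝ → ℝ) (κ : ℝ → ℝ → ℝ → ℝ) : Prop where
  mean : ContDiff ℝ 1 μ
  kernel : ∃ κ₁ κ₂ κ₃ κ₁₂ κ₁₃ κ₂₃ κ₃₃ : ℝ → ℝ → ℝ → ℝ,
    (∀ a b c : ℝ, (a, b, c) ∈ interior kernelDomain →
      HasDerivAt (fun t => κ t b c) (κ₁ a b c) a ∧
      HasDerivAt (fun t => κ a t c) (κ₂ a b c) b ∧
      HasDerivAt (fun t => κ a b t) (κ₃ a b c) c ∧
      HasDerivAt (fun t => κ₁ a t c) (κ₁₂ a b c) b ∧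
      HasDerivAt (fun t => κ₁ a b t) (κ₁₃ a b c) c ∧
      HasDerivAt (fun t => κ₂ a b t) (κ₂₃ a b c) c ∧
      HasDerivAt (fun t => κ₃ a b t) (κ₃₃ a b c) c) ∧
    ContinuousOn (fun p : ℝ × ℝ × ℝ => κ₁₂ p.1 p.2.1 p.2.2) kernelDomain ∧
    ContinuousOn (fun p : ℝ × ℝ × ℝ => κ₁₃ p.1 p.2.1 p.2.2) kernelDomain ∧
    ContinuousOn (fun p : ℝ × ℝ × ℝ => κ₂₃ p.1 p.2.1 p.2.2) kernelDomain ∧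
    ContinuousOn (fun p : ℝ × ℝ × ℝ => κ₃₃ p.1 p.2.1 p.2.2) kernelDomain

/-- A random function `g` with values in a Euclidean space `F` is strictly positive definite: for
distinct points `x_k`, the variance of `∑ ⟨w_k, g(x_k)⟩` vanishes only if all `w_k` are zero. -/
def IsStrictlyPosDef {E F Ω : Type*} [NormedAddCommGroup F] [InnerProductSpace ℝ F]
    [MeasurableSpace Ω] (P : Measure Ω) (g : Ω → E → F) : Prop :=
  ∀ (n : ℕ) (x : Fin n → E), Function.Injective x → ∀ w : Fin n → F,
    Var[fun ω => ∑ k, inner ℝ (w k) (g ω (x k)); P] = 0 → ∀ k, w k = 0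

/-- The function `(f, ∇f)` with values in `ℝ × ℝ^N` (Euclidean norm). -/
def withGradient {N : ℕ} (f : Eucl N → ℝ) (x : Eucl N) : WithLp 2 (ℝ × Eucl N) :=
  WithLp.toLp 2 (f x, gradient f x)

/-- Convergence in probability, as `N → ∞`, of random elements `Z N` of a metric space (which may
live on different probability spaces) to the deterministic limit `z`. -/
def TendstoInProb {Ω : ℕ → Type*} [∀ N, MeasurableSpace (Ω N)] (P : ∀ N, Measure (Ω N))
    {A : Type*} [PseudoMetricSpace A] (Z : ∀ N, Ω N → A) (z : A) : Prop :=
  ∀ ε : ℝ, 0 < ε → Tendsto (fun N => P N {ω | ε < dist (Z N ω) z}) atTop (𝓝 0)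

end

/-! Values and derivatives at fixed points are Gaussian with covariances of order `1/N`, and these
covariances see the points only through norms and inner products. Take an orthonormal basis of
`V_n`. The finitely many coordinates of the next observation, namely the function value and the
derivatives along the basis, equal their regression on the earlier observations up to an error of
variance `O(1/N)`. The part of the new gradient orthogonal to `V_n` is not changed by subtracting
multiples of earlier gradients, since these vanish under the projection. After the right subtraction
it behaves like a centred Gaussian vector with independent components of variance `normalVar / N` in
`N - dim V_n` directions, so its squared length concentrates at `normalVar`. Both `prediction` and
`normalVar` are computed in a dimension that does not grow with `N`, from the coordinates of the
points and of the past observations. Hence everything follows, in the limit, the deterministic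
recursion `GSA.obsLimit`.

The obstacle is that the evaluation points are themselves selected from the random function. It is
removed by `lintegral_queryFunctional`: a linear functional of the path that, for every frozen
admissible history, is uncorrelated with the observations in that history may be integrated as if
the history belonged to an independent copy. The proof is an induction that splits off the first
observation, whose location is not random, by Gaussian regression; the conditioned path is again a
Gaussian path. The coefficients of the functional may depend on the history, so the Gram-Schmidt
basis of the run can be used.

The uncorrelatedness comes from symmetry. The covariance of jets is a limit of covariances of
difference quotients, hence invariant under linear isometries (`jetKernel_map`). A reflection shows
that derivatives normal to all points and directions involved are uncorrelated with the rest
(`IsSmoothKernel.orthogonal`). This reduces all covariances to the two fixed dimensional kernels in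
`jetKernel_frameJet` and `jetKernel_normal`.

Strict positive definiteness makes the Gram matrices invertible and `normalVar` positive at distinct
points, so the regressions are continuous at the limiting configuration once the limiting points are
known to be distinct. They are distinct because each new point uses the newest gradient with a
nonzero factor, hence has a nonzero coordinate in a direction that all earlier points lack
(`exists_pointLimit_ne`). The induction alternates `IsRunLimit.observe` and `IsRunLimit.move`.
Almost sure full rank in a fixed dimension uses the same freezing argument: a nondegenerate Gaussian
residual is almost surely nonzero.

Convergence in probability is convergence along the filter `inProb`, so continuity arguments and
passage to events of asymptotically full probability are ordinary filter manipulations. Derivatives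
are handled as almost sure limits of difference quotients, for which `hasGaussianLaw_of_tendsto`
preserves Gaussianity and gives convergence of the variances. -/

set_option linter.unusedSectionVars false

/-! ### Convergence in probability as convergence along a filter -/

/-- The filter of the events whose probability tends to one. -/
def inProb {Ω : ℕ → Type*} [∀ N, MeasurableSpace (Ω N)] (P : ∀ N, Measure (Ω N)) :
    Filter (Σ N, Ω N) where
  sets := {S | Tendsto (fun N => P N {ω | (⟨N, ω⟩ : Σ N, Ω N) ∉ S}) atTop (𝓝 0)}
  univ_sets := by simp
  sets_of_superset {S T} hS hST := tendsto_of_tendsto_of_tendsto_of_le_of_le tendsto_const_nhds hS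
    (fun _ => zero_le) (fun N => measure_mono fun ω hω h => hω (hST h))
  inter_sets {S T} hS hT := by
    have h := hS.add hT
    rw [add_zero] at h
    refine tendsto_of_tendsto_of_tendsto_of_le_of_le tendsto_const_nhds h (fun _ => zero_le)
      fun N => (measure_mono ?_).trans (measure_union_le _ _)
    intro ω hω
    by_contra hc
    simp only [Set.mem_union, Set.mem_ofPred_eq, not_or, not_not] at hc
    exact hω hc

section InProb

variable {Ω : ℕ → Type*} [∀ N, MeasurableSpace (Ω N)] {P : ∀ N, Measure (Ω N)}

lemma eventually_inProb {p : (Σ N, Ω N) → Prop} :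
    (∀ᶠ z in inProb P, p z) ↔ Tendsto (fun N => P N {ω | ¬ p ⟨N, ω⟩}) atTop (𝓝 0) := Iff.rfl

lemma tendstoInProb_iff {A : Type*} [PseudoMetricSpace A] {Z : ∀ N, Ω N → A} {z : A} :
    TendstoInProb P Z z ↔
      Tendsto (fun p : Σ N, Ω N => Z p.1 p.2) (inProb P) (𝓝 z) := by
  constructor
  · intro h
    rw [Metric.tendsto_nhds]
    intro ε hε
    rw [eventually_inProb]
    -- The definition controls distances strictly larger than a bound, whereas the complement of a
    -- ball contains the boundary; halving `ε` absorbs the difference.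
    refine tendsto_of_tendsto_of_tendsto_of_le_of_le tendsto_const_nhds (h (ε / 2) (half_pos hε))
      (fun _ => zero_le) fun N => measure_mono fun ω hω => ?_
    simp only [Set.mem_ofPred_eq, not_lt] at hω ⊢
    linarith
  · intro h ε hε
    rw [Metric.tendsto_nhds] at h
    refine tendsto_of_tendsto_of_tendsto_of_le_of_le tendsto_const_nhds
      (eventually_inProb.1 (h ε hε))
      (fun _ => zero_le) fun N => measure_mono fun ω hω => ?_
    simp only [Set.mem_ofPred_eq, not_lt] at hω ⊢
    exact hω.le

lemma eventually_inProb_of_ae {p : (Σ N, Ω N) → Prop}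
    (h : ∀ᶠ N in atTop, ∀ᵐ ω ∂P N, p ⟨N, ω⟩) : ∀ᶠ z in inProb P, p z := by
  rw [eventually_inProb]
  refine tendsto_const_nhds.congr' ?_
  filter_upwards [h] with N hN
  exact (ae_iff.1 hN).symm

/-- Subadditivity gives `1 - P(¬p) ≤ P(p)` for outer measures as well, so the event need not be
measurable. -/
lemma tendsto_measure_one [∀ N, IsProbabilityMeasure (P N)] {p : (Σ N, Ω N) → Prop}
    (h : ∀ᶠ z in inProb P, p z) : Tendsto (fun N => P N {ω | p ⟨N, ω⟩}) atTop (𝓝 1) := by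
  have h1 : Tendsto (fun N => 1 - P N {ω | ¬ p ⟨N, ω⟩}) atTop (𝓝 (1 - 0)) :=
    ENNReal.Tendsto.sub tendsto_const_nhds (eventually_inProb.1 h) (by simp)
  rw [tsub_zero] at h1
  refine tendsto_of_tendsto_of_tendsto_of_le_of_le h1 tendsto_const_nhds (fun N => ?_)
    (fun N => prob_le_one)
  rw [tsub_le_iff_right, ← measure_univ (μ := P N)]
  refine (measure_mono fun ω _ => ?_).trans (measure_union_le _ _)
  exact em (p ⟨N, ω⟩)

/-- Chebyshev's inequality on events of asymptotically full probability. -/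
lemma tendsto_inProb_zero_of_lintegral_le {Z : ∀ N, Ω N → ℝ} {B : (Σ N, Ω N) → Prop}
    (hB : ∀ᶠ z in inProb P, B z) {C : ℕ → ENNReal} (hC : Tendsto C atTop (𝓝 0))
    (h : ∀ᶠ N in atTop, ∀ ε : ℝ, 0 < ε →
      P N {ω | B ⟨N, ω⟩ ∧ ε ≤ |Z N ω|} ≤ C N / ENNReal.ofReal (ε ^ 2)) :
    Tendsto (fun p : Σ N, Ω N => Z p.1 p.2) (inProb P) (𝓝 0) := by
  rw [Metric.tendsto_nhds]
  intro ε hε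
  have h1 : ∀ᶠ z in inProb P, B z → |Z z.1 z.2| < ε := by
    rw [eventually_inProb]
    have h0 : Tendsto (fun N => C N / ENNReal.ofReal (ε ^ 2)) atTop (𝓝 0) := by
      have := ENNReal.Tendsto.div_const (b := ENNReal.ofReal (ε ^ 2)) hC
        (Or.inr (by simpa using by positivity))
      simpa using this
    refine tendsto_of_tendsto_of_tendsto_of_le_of_le' tendsto_const_nhds h0
      (Eventually.of_forall fun _ => zero_le) ?_
    filter_upwards [h] with N hN
    refine (measure_mono fun ω hω => ?_).trans (hN ε hε)
    simpa using hω
  filter_upwards [hB, h1] with z hz1 hz2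
  simpa using hz2 hz1

end InProb

/-! ### Almost sure limits of Gaussian random variables -/

/-- If Gaussian random variables converge almost surely and their means converge, then the limit is
Gaussian and the variances converge. -/
lemma hasGaussianLaw_of_tendsto {Ω : Type*} [MeasurableSpace Ω] {P : Measure Ω}
    [IsProbabilityMeasure P] {Z : ℕ → Ω → ℝ} {Y : Ω → ℝ} {m : ℝ}
    (hZ : ∀ n, HasGaussianLaw (Z n) P) (hY : AEMeasurable Y P)
    (hlim : ∀ᵐ ω ∂P, Tendsto (fun n => Z n ω) atTop (𝓝 (Y ω)))
    (hm : Tendsto (fun n => ∫ ω, Z n ω ∂P) atTop (𝓝 m)) :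
    HasGaussianLaw Y P ∧ ∫ ω, Y ω ∂P = m ∧
      Tendsto (fun n => Var[Z n; P]) atTop (𝓝 Var[Y; P]) := by
  have hprob : IsProbabilityMeasure (P.map Y) := Measure.isProbabilityMeasure_map hY
  have hφ : ∀ t : ℝ, Tendsto (fun n => charFun (P.map (Z n)) t) atTop
      (𝓝 (charFun (P.map Y) t)) := by
    intro t
    have he : ∀ W : Ω → ℝ, AEMeasurable W P →
        charFun (P.map W) t = ∫ ω, Complex.exp (t * W ω * Complex.I) ∂P := by
      intro W hW
      rw [charFun_apply_real, integral_map hW]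
      exact (by fun_prop : Continuous fun x : ℝ =>
        Complex.exp (t * x * Complex.I)).aestronglyMeasurable
    simp_rw [he _ (hZ _).aemeasurable, he _ hY]
    refine tendsto_integral_of_dominated_convergence (fun _ => 1) (fun n => ?_)
      (integrable_const 1) (fun n => ae_of_all _ fun ω => ?_) ?_
    · have := (hZ n).aemeasurable
      exact (AEMeasurable.cexp (by fun_prop)).aestronglyMeasurable
    · rw [← Complex.ofReal_mul, Complex.norm_exp_ofReal_mul_I]
    · filter_upwards [hlim] with ω hω
      have hc : Continuous fun x : ℝ => Complex.exp (t * x * Complex.I) := by fun_prop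
      exact (hc.tendsto _).comp hω
  have hφn : ∀ n (t : ℝ), charFun (P.map (Z n)) t =
      Complex.exp (t * (∫ ω, Z n ω ∂P : ℝ) * Complex.I - (Var[Z n; P] : ℝ) * t ^ 2 / 2) := by
    intro n t
    rw [(hZ n).map_eq_gaussianReal, charFun_gaussianReal,
      Real.coe_toNNReal _ (variance_nonneg _ _)]
  have hnorm : ∀ t : ℝ, Tendsto (fun n => Real.exp (-(Var[Z n; P] * t ^ 2 / 2))) atTop
      (𝓝 ‖charFun (P.map Y) t‖) := by
    intro t
    refine (hφ t).norm.congr fun n => ?_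
    rw [hφn, Complex.norm_exp]
    congr 1
    rw [Complex.sub_re]
    have h1 : ((t : ℂ) * ((∫ ω, Z n ω ∂P : ℝ) : ℂ) * Complex.I).re = 0 := by
      rw [← Complex.ofReal_mul]; simp
    have h2 : ((Var[Z n; P] : ℝ) * (t : ℂ) ^ 2 / 2) = ((Var[Z n; P] * t ^ 2 / 2 : ℝ) : ℂ) := by
      push_cast; ring
    rw [h1, h2, Complex.ofReal_re]
    ring
  -- The limiting characteristic function is continuous with value one at the origin, so it is
  -- nonzero at some `t ≠ 0`. There the logarithm of `exp (-Var t² / 2)` can be taken in the limit,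
  -- which forces the variances to converge.
  obtain ⟨t, ht0, ht⟩ : ∃ t : ℝ, t ≠ 0 ∧ 0 < ‖charFun (P.map Y) t‖ := by
    have hc : ContinuousAt (fun t : ℝ => ‖charFun (P.map Y) t‖) 0 :=
      (continuous_charFun.norm).continuousAt
    have h0 : (0 : ℝ) < ‖charFun (P.map Y) 0‖ := by simp
    have h1 := (hc.eventually (lt_mem_nhds h0))
    obtain ⟨t, h2, h3⟩ := ((h1.filter_mono nhdsWithin_le_nhds).and
      (self_mem_nhdsWithin : {(0 : ℝ)}ᶜ ∈ 𝓝[≠] 0)).exists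
    exact ⟨t, h3, h2⟩
  obtain ⟨v, hv⟩ : ∃ v, Tendsto (fun n => Var[Z n; P]) atTop (𝓝 v) := by
    have h1 := (hnorm t).log ht.ne'
    simp_rw [Real.log_exp] at h1
    refine ⟨_, (h1.mul_const (-(2 / t ^ 2))).congr fun n => ?_⟩
    field_simp
  have hv0 : 0 ≤ v := ge_of_tendsto' hv fun n => variance_nonneg _ _
  have hmap : P.map Y = gaussianReal m v.toNNReal := by
    refine Measure.ext_of_charFun ?_
    ext t
    refine tendsto_nhds_unique (hφ t) ?_
    rw [charFun_gaussianReal, Real.coe_toNNReal _ hv0]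
    simp_rw [hφn]
    have h1 : Tendsto (fun n => ((∫ ω, Z n ω ∂P : ℝ) : ℂ)) atTop (𝓝 (m : ℂ)) :=
      (Complex.continuous_ofReal.tendsto _).comp hm
    have h2 : Tendsto (fun n => ((Var[Z n; P] : ℝ) : ℂ)) atTop (𝓝 (v : ℂ)) :=
      (Complex.continuous_ofReal.tendsto _).comp hv
    exact (Complex.continuous_exp.tendsto _).comp
      (((h1.const_mul (t : ℂ)).mul_const Complex.I).sub ((h2.mul_const _).div_const 2))
  have hlaw : HasGaussianLaw Y P := ⟨by rw [hmap]; infer_instance⟩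
  have hi : ∫ ω, Y ω ∂P = m := by
    have := integral_map (μ := P) hY (f := fun x : ℝ => x) (by fun_prop)
    rw [← this, hmap, integral_id_gaussianReal]
  have hvar : Var[Y; P] = v := by
    have := variance_map (μ := P) (X := fun x : ℝ => x) (Y := Y) (by fun_prop) hY
    rw [hmap, variance_fun_id_gaussianReal, Real.coe_toNNReal _ hv0] at this
    rw [this]; rfl
  exact ⟨hlaw, hi, hvar ▸ hv⟩

/-- The finite linear combinations of the variables of a Gaussian process form a Gaussian
process. -/
lemma isGaussianProcess_finsupp {Ω T : Type*} [MeasurableSpace Ω] {P : Measure Ω}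
    {X : T → Ω → ℝ} (hX : IsGaussianProcess X P) :
    IsGaussianProcess (fun (φ : T →₀ ℝ) ω => φ.sum fun t a => a * X t ω) P := by
  refine hX.of_isGaussianProcess fun φ => ⟨φ.support, ?_⟩
  refine ⟨∑ t : φ.support, φ t • ContinuousLinearMap.proj t, fun ω => ?_⟩
  rw [_root_.sum_apply, Finsupp.sum, ← Finset.sum_coe_sort]
  rfl

/-! ### Gaussian processes: linear combinations and constants -/

section GaussianProcess

variable {Ω S T : Type*} [MeasurableSpace Ω] {P : Measure Ω}

lemma isGaussianProcess_of_mem_span {X : T → Ω → ℝ} (hX : IsGaussianProcess X P) {Y : S → Ω → ℝ}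
    (h : ∀ s, Y s ∈ Submodule.span ℝ (Set.range X)) : IsGaussianProcess Y P := by
  simp_rw [Finsupp.mem_span_range_iff_exists_finsupp] at h
  choose φ hφ using h
  have hY : Y = (fun (φ : T →₀ ℝ) (ω : Ω) => φ.sum fun t a => a * X t ω) ∘ φ := by
    funext s ω
    rw [← hφ s]
    simp [Finsupp.sum, Finset.sum_apply]
  rw [hY]
  exact (isGaussianProcess_finsupp hX).comp_right φ

/-- A constant vector is a degenerate Gaussian vector and independent of everything, so the sum is
Gaussian. -/
lemma isGaussianProcess_add_const {X : T → Ω → ℝ} (hX : IsGaussianProcess X P) (c : T → ℝ) :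
    IsGaussianProcess (fun t ω => X t ω + c t) P where
  hasGaussianLaw I := by
    have := hX.isProbabilityMeasure
    have hc : HasGaussianLaw (fun _ : Ω => fun t : I => c t) P :=
      ⟨by rw [Measure.map_const, measure_univ, one_smul]; infer_instance⟩
    exact (IndepFun.hasGaussianLaw (hX.hasGaussianLaw I) hc (indepFun_const_right _ _)).add

lemma memLp_two_of_mem_span {X : T → Ω → ℝ} (hX : IsGaussianProcess X P) {Y : Ω → ℝ}
    (h : Y ∈ Submodule.span ℝ (Set.range X)) : MemLp Y 2 P :=
  ((isGaussianProcess_of_mem_span hX (Y := fun _ : Unit => Y) fun _ => h).hasGaussianLaw_eval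
    ()).memLp_two

lemma covariance_eq_zero_of_variance_eq_zero [IsProbabilityMeasure P] {X Y : Ω → ℝ}
    (hX : MemLp X 2 P) (h : Var[X; P] = 0) : cov[X, Y; P] = 0 := by
  have h1 := ae_eq_integral_of_variance_eq_zero hX h
  rw [covariance]
  refine integral_eq_zero_of_ae ?_
  filter_upwards [h1] with ω hω
  simp [hω]

lemma covariance_add_fun_left [IsProbabilityMeasure P] {X Y Z : Ω → ℝ} (hX : MemLp X 2 P)
    (hY : MemLp Y 2 P) (hZ : MemLp Z 2 P) :
    cov[fun ω => X ω + Y ω, Z; P] = cov[X, Z; P] + cov[Y, Z; P] :=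
  covariance_add_left hX hY hZ

end GaussianProcess

/-! ### Independence and iterated integrals -/

/-- By independence the joint law is a product, and Tonelli applies. This is the only form of
conditioning used: the second variable is replaced by an independent copy. -/
lemma lintegral_comp_of_indepFun {Ω A B : Type*} [MeasurableSpace Ω] [MeasurableSpace A]
    [MeasurableSpace B] {P : Measure Ω} [IsProbabilityMeasure P] {X : Ω → A} {Y : Ω → B}
    (hX : Measurable X) (hY : Measurable Y) (h : IndepFun X Y P) {Ψ : A → B → ENNReal}
    (hΨ : Measurable (Function.uncurry Ψ)) :
    ∫⁻ ω, Ψ (X ω) (Y ω) ∂P = ∫⁻ ω, ∫⁻ ω', Ψ (X ω) (Y ω') ∂P ∂P := by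
  have h1 := (indepFun_iff_map_prod_eq_prod_map_map hX.aemeasurable hY.aemeasurable).1 h
  have h2 : ∫⁻ ω, Ψ (X ω) (Y ω) ∂P =
      ∫⁻ z, Function.uncurry Ψ z ∂(P.map (fun ω => (X ω, Y ω))) := by
    rw [lintegral_map hΨ (hX.prodMk hY)]; rfl
  rw [h2, h1]
  have := Measure.isProbabilityMeasure_map (μ := P) hY.aemeasurable
  rw [lintegral_prod _ hΨ.aemeasurable, lintegral_map hΨ.lintegral_prod_right' hX]
  refine lintegral_congr fun ω => ?_
  exact lintegral_map (hΨ.comp measurable_prodMk_left) hY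

/-! ### Continuous paths and adaptive observations -/

/-- The continuous functions with the σ-algebra generated by the evaluations. -/
abbrev ContPath (E ι : Type*) [TopologicalSpace E] : Type _ := {g : E → ι → ℝ // Continuous g}

/-- The observations `g(x_k)` where `x_k` is selected by `ξ k` from the previous observations. -/
def adaptiveObs {E V : Type*} (ξ : (k : ℕ) → (Fin k → V) → E) (g : E → V) : ℕ → V
  | k => g (ξ k fun i : Fin k => adaptiveObs ξ g i)
  termination_by k => k
  decreasing_by exact i.isLt

/-- The `k`-th query of the selection rule `ξ` if the observations are `d`. -/
def queryAt {E V : Type*} (ξ : (k : ℕ) → (Fin k → V) → E) {n : ℕ} (d : Fin n → V)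
    (k : Fin (n + 1)) : E :=
  ξ k fun i : Fin k => d ⟨i, i.isLt.trans_le (Nat.lt_succ_iff.1 k.isLt)⟩

/-- The selection rule that remains after the first observation. -/
def tailRule {E V : Type*} (ξ : (k : ℕ) → (Fin k → V) → E) (v : V) :
    (k : ℕ) → (Fin k → V) → E := fun k d => ξ (k + 1) (Fin.cons v d)

section Adaptive

variable {E V : Type*} (ξ : (k : ℕ) → (Fin k → V) → E) (g : E → V)

lemma adaptiveObs_eq (k : ℕ) :
    adaptiveObs ξ g k = g (ξ k fun i : Fin k => adaptiveObs ξ g i) := by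
  rw [adaptiveObs]

lemma adaptiveObs_zero : adaptiveObs ξ g 0 = g (ξ 0 Fin.elim0) := by
  rw [adaptiveObs_eq]
  congr 2
  exact Subsingleton.elim _ _

lemma queryAt_zero {n : ℕ} (d : Fin n → V) : queryAt ξ d 0 = ξ 0 Fin.elim0 := by
  unfold queryAt
  congr 1
  exact Subsingleton.elim (α := Fin 0 → V) _ _

lemma queryAt_cons_succ {n : ℕ} (v : V) (d : Fin n → V) (k : Fin (n + 1)) :
    queryAt ξ (Fin.cons v d : Fin (n + 1) → V) k.succ = queryAt (tailRule ξ v) d k := by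
  unfold queryAt tailRule
  simp only [Fin.val_succ]
  congr 1
  ext i
  refine Fin.cases ?_ (fun j => ?_) i
  · rfl
  · rfl

/-- What follows the first observation is again an adaptive run, with the rule that has this
observation built in. The induction over the number of observations rests on this. -/
lemma adaptiveObs_succ (k : ℕ) :
    adaptiveObs ξ g (k + 1) = adaptiveObs (tailRule ξ (adaptiveObs ξ g 0)) g k := by
  induction k using Nat.strong_induction_on with
  | _ k ih =>
    rw [adaptiveObs_eq, adaptiveObs_eq (tailRule _ _)]
    unfold tailRule
    congr 2
    ext i
    refine Fin.cases ?_ (fun j => ?_) i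
    · rfl
    · exact ih j j.isLt

lemma cons_adaptiveObs (n : ℕ) :
    (Fin.cons (adaptiveObs ξ g 0)
      (fun i : Fin n => adaptiveObs (tailRule ξ (adaptiveObs ξ g 0)) g i) : Fin (n + 1) → V) =
      fun i : Fin (n + 1) => adaptiveObs ξ g i := by
  ext i
  refine Fin.cases ?_ (fun j => ?_) i
  · rfl
  · exact (adaptiveObs_succ ξ g j).symm

end Adaptive

section Measurability

variable {E ι : Type*} [TopologicalSpace E] [MeasurableSpace E] [BorelSpace E]
  [SecondCountableTopology E] [TopologicalSpace.MetrizableSpace E] [Fintype ι]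

/-- The evaluation is measurable in the path and continuous in the point, a Carathéodory function,
hence jointly measurable. Working with continuous paths is what makes observations at random points
measurable. -/
lemma measurable_contPath_eval :
    Measurable fun p : ContPath E ι × E => p.1.1 p.2 := by
  have h := measurable_uncurry_of_continuous_of_measurable
    (u := fun (x : E) (g : ContPath E ι) => g.1 x) (fun g => g.2)
    (fun x => (measurable_pi_apply x).comp measurable_subtype_coe)
  exact h.comp measurable_swap

lemma Measurable.contPath_eval {A : Type*} [MeasurableSpace A] {g : A → ContPath E ι} {x : A → E}
    (hg : Measurable g) (hx : Measurable x) : Measurable fun a => (g a).1 (x a) :=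
  measurable_contPath_eval.comp (hg.prodMk hx)

lemma measurable_adaptiveObs {A : Type*} [MeasurableSpace A]
    {ξ : A → (k : ℕ) → (Fin k → ι → ℝ) → E} {g : A → ContPath E ι} (hg : Measurable g)
    (hξ : ∀ k, Measurable fun p : A × (Fin k → ι → ℝ) => ξ p.1 k p.2) (k : ℕ) :
    Measurable fun a => adaptiveObs (ξ a) (g a).1 k := by
  induction k using Nat.strong_induction_on with
  | _ k ih =>
    simp_rw [adaptiveObs_eq (k := k)]
    refine hg.contPath_eval ?_
    have h : Measurable fun a => fun i : Fin k => adaptiveObs (ξ a) (g a).1 i :=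
      measurable_pi_lambda _ fun i => ih i i.isLt
    exact (hξ k).comp (measurable_id.prodMk h)

omit [TopologicalSpace E] [BorelSpace E] [SecondCountableTopology E]
  [TopologicalSpace.MetrizableSpace E] [Fintype ι] in
lemma measurable_queryAt {A : Type*} [MeasurableSpace A]
    {ξ : A → (k : ℕ) → (Fin k → ι → ℝ) → E} {n : ℕ} {d : A → Fin n → ι → ℝ} (hd : Measurable d)
    (hξ : ∀ k, Measurable fun p : A × (Fin k → ι → ℝ) => ξ p.1 k p.2) (k : Fin (n + 1)) :
    Measurable fun a => queryAt (ξ a) (d a) k := by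
  unfold queryAt
  refine (hξ k).comp (measurable_id.prodMk (measurable_pi_lambda _ fun i => ?_))
  exact (measurable_pi_apply _).comp hd

end Measurability

/-! ### Regression of a Gaussian path on its value at a point -/

section Regression

variable {Ω E ι : Type*} [MeasurableSpace Ω] {P : Measure Ω} [TopologicalSpace E] [Fintype ι]

/-- A random continuous path that is a Gaussian process with continuous covariances. -/
structure IsGaussianPath (P : Measure Ω) (G : Ω → ContPath E ι) : Prop where
  measurable : Measurable G
  gaussian : IsGaussianProcess (fun (p : E × ι) ω => (G ω).1 p.1 p.2) P
  cov : ∀ (p : E × ι) (j : ι),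
    Continuous fun x => cov[fun ω => (G ω).1 p.1 p.2, fun ω => (G ω).1 x j; P]

/-- The variables `G(x)_j` span this space. -/
def pathSpan (G : Ω → ContPath E ι) : Submodule ℝ (Ω → ℝ) :=
  Submodule.span ℝ (Set.range fun (p : E × ι) ω => (G ω).1 p.1 p.2)

lemma eval_mem_pathSpan (G : Ω → ContPath E ι) (x : E) (j : ι) :
    (fun ω => (G ω).1 x j) ∈ pathSpan G :=
  Submodule.subset_span ⟨(x, j), rfl⟩

lemma sum_mem_fun {A Ω : Type*} {S : Submodule ℝ (Ω → ℝ)} (s : Finset A) {f : A → Ω → ℝ}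
    (h : ∀ i ∈ s, f i ∈ S) : (fun ω => ∑ i ∈ s, f i ω) ∈ S := by
  have h1 : (fun ω => ∑ i ∈ s, f i ω) = ∑ i ∈ s, f i := by ext; simp
  rw [h1]
  exact S.sum_mem h

lemma mul_mem_fun {Ω : Type*} {S : Submodule ℝ (Ω → ℝ)} {f : Ω → ℝ} (c : ℝ)
    (h : f ∈ S) : (fun ω => c * f ω) ∈ S := S.smul_mem c h

lemma sub_mem_fun {Ω : Type*} {S : Submodule ℝ (Ω → ℝ)} {f g : Ω → ℝ} (hf : f ∈ S)
    (hg : g ∈ S) : (fun ω => f ω - g ω) ∈ S := S.sub_mem hf hg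

lemma IsGaussianPath.memLp {G : Ω → ContPath E ι} (hG : IsGaussianPath P G) {Y : Ω → ℝ}
    (hY : Y ∈ pathSpan G) : MemLp Y 2 P := memLp_two_of_mem_span hG.gaussian hY

/-- The component of `G(x₀)` in the direction `u`. -/
def evalDir (G : Ω → ContPath E ι) (x₀ : E) (u : ι → ℝ) (ω : Ω) : ℝ := ∑ j, u j * (G ω).1 x₀ j

lemma evalDir_mem (G : Ω → ContPath E ι) (x₀ : E) (u : ι → ℝ) :
    evalDir G x₀ u ∈ pathSpan G :=
  sum_mem_fun _ fun j _ => mul_mem_fun _ (eval_mem_pathSpan G x₀ j)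

/-- The covariance of `G(x₀)` is a symmetric bilinear form on the coefficient vectors and has an
orthogonal basis. Degenerate directions are allowed, so the regression needs no invertible
covariance matrix. -/
lemma exists_uncorrelated_basis {G : Ω → ContPath E ι} (hG : IsGaussianPath P G) (x₀ : E) :
    ∃ (m : ℕ) (v : Module.Basis (Fin m) ℝ (ι → ℝ)),
      ∀ i l, i ≠ l → cov[evalDir G x₀ (v i), evalDir G x₀ (v l); P] = 0 := by
  classical
  have := hG.gaussian.isProbabilityMeasure
  let B : LinearMap.BilinForm ℝ (ι → ℝ) :=
    Matrix.toBilin' (Matrix.of fun j l => cov[fun ω => (G ω).1 x₀ j, fun ω => (G ω).1 x₀ l; P])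
  have hB : ∀ u w, B u w = cov[evalDir G x₀ u, evalDir G x₀ w; P] := by
    intro u w
    have hmem : ∀ (u : ι → ℝ) (j : ι), MemLp (fun ω => u j * (G ω).1 x₀ j) 2 P := fun u j =>
      (hG.memLp (eval_mem_pathSpan G x₀ j)).const_mul _
    unfold evalDir
    rw [covariance_fun_sum_fun_sum (fun j => hmem u j) (fun j => hmem w j)]
    rw [Matrix.toBilin'_apply]
    refine Finset.sum_congr rfl fun j _ => Finset.sum_congr rfl fun l _ => ?_
    rw [covariance_const_mul_left, covariance_const_mul_right, Matrix.of_apply]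
    ring
  have hs : LinearMap.IsSymm B := ⟨fun u w => by
    rw [RingHom.id_apply, hB, hB, covariance_comm]⟩
  obtain ⟨v, hv⟩ := LinearMap.BilinForm.exists_orthogonal_basis hs
  refine ⟨_, v, fun i l hil => ?_⟩
  rw [← hB]
  exact hv hil

/-- Add a linear combination of fixed paths to a path. -/
def shiftPath {m : ℕ} (c : Fin m → ContPath E ι) (g : ContPath E ι) (w : Fin m → ℝ) :
    ContPath E ι :=
  ⟨fun y j => g.1 y j + ∑ i, w i * (c i).1 y j, by
    refine continuous_pi fun j => ?_
    have h : ∀ g : ContPath E ι, Continuous fun y => g.1 y j :=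
      fun g => (continuous_apply j).comp g.2
    exact (h g).add (continuous_finsetSum _ fun i _ => continuous_const.mul (h (c i)))⟩

lemma shiftPath_apply {m : ℕ} (c : Fin m → ContPath E ι) (g : ContPath E ι) (w : Fin m → ℝ)
    (y : E) (j : ι) : (shiftPath c g w).1 y j = g.1 y j + ∑ i, w i * (c i).1 y j := rfl

lemma shiftPath_shiftPath {m : ℕ} (c : Fin m → ContPath E ι) (g : ContPath E ι)
    (w w' : Fin m → ℝ) : shiftPath c (shiftPath c g w) w' = shiftPath c g (w + w') := by
  apply Subtype.ext
  funext y j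
  simp only [shiftPath_apply, Pi.add_apply, add_mul, Finset.sum_add_distrib]
  ring

lemma shiftPath_zero {m : ℕ} (c : Fin m → ContPath E ι) (g : ContPath E ι) :
    shiftPath c g 0 = g := by
  apply Subtype.ext
  funext y j
  simp [shiftPath_apply]

lemma measurable_shiftPath {m : ℕ} (c : Fin m → ContPath E ι) :
    Measurable fun p : ContPath E ι × (Fin m → ℝ) => shiftPath c p.1 p.2 := by
  refine Measurable.subtype_mk (measurable_pi_lambda _ fun y => measurable_pi_lambda _ fun j => ?_)
  refine Measurable.add ?_ (Finset.measurable_sum _ fun i _ => ?_)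
  · exact (measurable_pi_apply j).comp ((measurable_pi_apply y).comp
      (measurable_subtype_coe.comp measurable_fst))
  · exact ((measurable_pi_apply i).comp measurable_snd).mul_const _

/-- The regression coefficients on the components of `G(x₀)` in the directions `v i`. -/
noncomputable def regCoef {m : ℕ} {G : Ω → ContPath E ι} (hG : IsGaussianPath P G) (x₀ : E)
    (v : Fin m → ι → ℝ) (i : Fin m) : ContPath E ι :=
  -- For a direction of variance zero the inverse is zero by convention; the covariance vanishes
  -- there too, so nothing is lost.
  ⟨fun y j => (Var[evalDir G x₀ (v i); P])⁻¹ * cov[evalDir G x₀ (v i), fun ω => (G ω).1 y j; P], by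
    have := hG.gaussian.isProbabilityMeasure
    refine continuous_pi fun j => continuous_const.mul ?_
    have h : ∀ y, cov[evalDir G x₀ (v i), fun ω => (G ω).1 y j; P] =
        ∑ l, v i l * cov[fun ω => (G ω).1 x₀ l, fun ω => (G ω).1 y j; P] := by
      intro y
      unfold evalDir
      rw [covariance_fun_sum_left (fun l => (hG.memLp (eval_mem_pathSpan G x₀ l)).const_mul _)
        (hG.memLp (eval_mem_pathSpan G y j))]
      simp_rw [covariance_const_mul_left]
    simp_rw [h]
    exact continuous_finsetSum _ fun l _ => continuous_const.mul (hG.cov (x₀, l) j)⟩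

/-- The part of the path that is uncorrelated with the value at `x₀`. -/
noncomputable def residualPath {m : ℕ} {G : Ω → ContPath E ι} (hG : IsGaussianPath P G) (x₀ : E)
    (v : Fin m → ι → ℝ) (ω : Ω) : ContPath E ι :=
  shiftPath (regCoef hG x₀ v) (G ω) (fun i => -evalDir G x₀ (v i) ω)

variable {m : ℕ} {G : Ω → ContPath E ι} (hG : IsGaussianPath P G) (x₀ : E)
  (v : Module.Basis (Fin m) ℝ (ι → ℝ))

lemma residualPath_eval (y : E) (j : ι) : (fun ω => (residualPath hG x₀ v ω).1 y j) =
    fun ω => (G ω).1 y j - ∑ i, (regCoef hG x₀ v i).1 y j * evalDir G x₀ (v i) ω := by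
  ext ω
  simp only [residualPath, shiftPath_apply, neg_mul, Finset.sum_neg_distrib, sub_eq_add_neg]
  simp only [mul_comm]

lemma residualPath_mem (y : E) (j : ι) :
    (fun ω => (residualPath hG x₀ v ω).1 y j) ∈ pathSpan G := by
  rw [residualPath_eval]
  exact sub_mem_fun (eval_mem_pathSpan G y j)
    (sum_mem_fun _ fun i _ => mul_mem_fun _ (evalDir_mem G x₀ _))

variable {v} in
-- Of the regression only the term in the direction `v l` is correlated with that direction, and its
-- coefficient is chosen to cancel the covariance. If the direction has no variance, both terms
-- vanish.
lemma cov_residualPath_evalDir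
    (hv : ∀ i l, i ≠ l → cov[evalDir G x₀ (v i), evalDir G x₀ (v l); P] = 0)
    (y : E) (j : ι) (l : Fin m) :
    cov[fun ω => (residualPath hG x₀ v ω).1 y j, evalDir G x₀ (v l); P] = 0 := by
  have := hG.gaussian.isProbabilityMeasure
  have hm : ∀ i, MemLp (evalDir G x₀ (v i)) 2 P := fun i => hG.memLp (evalDir_mem G x₀ _)
  rw [residualPath_eval, covariance_fun_sub_left (hG.memLp (eval_mem_pathSpan G y j))
    (hG.memLp (sum_mem_fun _ fun i _ => mul_mem_fun _ (evalDir_mem G x₀ _))) (hm l),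
    covariance_fun_sum_left (fun i => (hm i).const_mul _) (hm l)]
  simp_rw [covariance_const_mul_left]
  rw [Finset.sum_eq_single l (fun i _ hil => by rw [hv i l hil, mul_zero]) (by simp),
    covariance_self (hm l).aemeasurable, covariance_comm]
  by_cases h0 : Var[evalDir G x₀ (v l); P] = 0
  · rw [h0, covariance_eq_zero_of_variance_eq_zero (hm l) h0]; simp
  · simp only [regCoef]
    field_simp
    ring

lemma evalDir_basis_sum (u : ι → ℝ) (ω : Ω) :
    evalDir G x₀ u ω = ∑ i, v.repr u i * evalDir G x₀ (v i) ω := by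
  conv_lhs => rw [← v.sum_repr u]
  simp only [evalDir, Finset.sum_apply, Pi.smul_apply, smul_eq_mul, Finset.sum_mul, Finset.mul_sum]
  rw [Finset.sum_comm]
  simp only [mul_assoc]

variable {v} in
-- The value at `x₀` and the residual are jointly Gaussian, as linear images of one Gaussian
-- process, and uncorrelated; hence they are independent.
lemma indepFun_residualPath
    (hv : ∀ i l, i ≠ l → cov[evalDir G x₀ (v i), evalDir G x₀ (v l); P] = 0) :
    IndepFun (fun ω => (G ω).1 x₀) (residualPath hG x₀ v) P := by
  classical
  have := hG.gaussian.isProbabilityMeasure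
  have h1 : IndepFun (fun ω (j : ι) => (G ω).1 x₀ j)
      (fun ω (p : E × ι) => (residualPath hG x₀ v ω).1 p.1 p.2) P := by
    refine IsGaussianProcess.indepFun_of_covariance_eq_zero (X := fun j ω => (G ω).1 x₀ j)
      (Y := fun (p : E × ι) ω => (residualPath hG x₀ v ω).1 p.1 p.2)
      (isGaussianProcess_of_mem_span hG.gaussian ?_) ?_ ?_ ?_
    · rintro (j | p)
      · exact eval_mem_pathSpan G x₀ j
      · exact residualPath_mem hG x₀ v p.1 p.2
    · exact fun j => (hG.memLp (eval_mem_pathSpan G x₀ j)).aemeasurable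
    · exact fun p => (hG.memLp (residualPath_mem hG x₀ v p.1 p.2)).aemeasurable
    · intro j p
      have hj : (fun ω => (G ω).1 x₀ j) =
          fun ω => ∑ i, v.repr (Pi.single j 1) i * evalDir G x₀ (v i) ω := by
        ext ω
        rw [← evalDir_basis_sum]
        simp [evalDir, Pi.single_apply]
      rw [hj, covariance_fun_sum_left
        (fun i => (hG.memLp (evalDir_mem G x₀ (v i))).const_mul _)
        (hG.memLp (residualPath_mem hG x₀ v p.1 p.2))]
      refine Finset.sum_eq_zero fun i _ => ?_
      rw [covariance_const_mul_left, covariance_comm,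
        cov_residualPath_evalDir hG x₀ hv, mul_zero]
  -- The σ-algebra on paths is generated by the evaluations, so independence of the family of all
  -- components is independence of the path.
  rw [IndepFun_iff_Indep] at h1 ⊢
  convert h1 using 1
  change MeasurableSpace.comap (residualPath hG x₀ v) (MeasurableSpace.comap _ _) = _
  simp only [MeasurableSpace.pi, MeasurableSpace.comap_iSup, MeasurableSpace.comap_comp]
  rw [iSup_prod]
  rfl

include hG in
lemma measurable_evalDir (u : ι → ℝ) : Measurable (evalDir G x₀ u) := by
  refine Finset.measurable_sum _ fun j _ => Measurable.const_mul ?_ _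
  exact (measurable_pi_apply j).comp ((measurable_pi_apply x₀).comp
      (measurable_subtype_coe.comp hG.measurable))

lemma measurable_residualPath : Measurable (residualPath hG x₀ v) :=
  (measurable_shiftPath _).comp (hG.measurable.prodMk
    (measurable_pi_lambda _ fun i => (measurable_evalDir hG x₀ (v i)).neg))

lemma shiftPath_residualPath (ω : Ω) :
    shiftPath (regCoef hG x₀ v) (residualPath hG x₀ v ω) (fun i => evalDir G x₀ (v i) ω) = G ω := by
  rw [residualPath, shiftPath_shiftPath]
  have h : ((fun i => -evalDir G x₀ (v i) ω) + fun i => evalDir G x₀ (v i) ω) = 0 := by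
    ext i
    simp
  rw [h, shiftPath_zero]

/-- The path that is conditioned to have components `w i` in the directions `v i` at `x₀`. -/
lemma isGaussianPath_shiftPath_residualPath (w : Fin m → ℝ) :
    IsGaussianPath P fun ω => shiftPath (regCoef hG x₀ v) (residualPath hG x₀ v ω) w where
  measurable := (measurable_shiftPath _).comp
    ((measurable_residualPath hG x₀ v).prodMk measurable_const)
  gaussian := isGaussianProcess_add_const
    (isGaussianProcess_of_mem_span hG.gaussian
      (Y := fun (p : E × ι) ω => (residualPath hG x₀ v ω).1 p.1 p.2)
      fun p => residualPath_mem hG x₀ v p.1 p.2) _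
  -- Continuity of the covariances has to survive the conditioning, since it makes the coefficients
  -- of the next regression continuous paths. It is expressed through covariances with `G` itself
  -- and the continuous regression coefficients.
  cov p j := by
    have := hG.gaussian.isProbabilityMeasure
    have hr : ∀ y j, MemLp (fun ω => (residualPath hG x₀ v ω).1 y j) 2 P :=
      fun y j => hG.memLp (residualPath_mem hG x₀ v y j)
    have hm : ∀ i, MemLp (evalDir G x₀ (v i)) 2 P := fun i => hG.memLp (evalDir_mem G x₀ _)
    simp only [shiftPath_apply]
    have h : ∀ y, cov[fun ω => (residualPath hG x₀ v ω).1 p.1 p.2 +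
          ∑ i, w i * (regCoef hG x₀ v i).1 p.1 p.2,
        fun ω => (residualPath hG x₀ v ω).1 y j + ∑ i, w i * (regCoef hG x₀ v i).1 y j; P] =
        cov[fun ω => (residualPath hG x₀ v ω).1 p.1 p.2, fun ω => (G ω).1 y j; P] -
        ∑ i, (regCoef hG x₀ v i).1 y j *
          cov[fun ω => (residualPath hG x₀ v ω).1 p.1 p.2, evalDir G x₀ (v i); P] := by
      intro y
      rw [covariance_add_const_left ((hr _ _).integrable (by norm_num)),
        covariance_add_const_right ((hr _ _).integrable (by norm_num)), residualPath_eval hG x₀ v y,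
        covariance_fun_sub_right (hr _ _) (hG.memLp (eval_mem_pathSpan G y j))
        (hG.memLp (sum_mem_fun _ fun i _ => mul_mem_fun _ (evalDir_mem G x₀ _))),
        covariance_fun_sum_right (fun i => (hm i).const_mul _) (hr _ _)]
      simp_rw [covariance_const_mul_right]
    simp_rw [h]
    have hc : ∀ q : E × ι, Continuous fun y => cov[fun ω => (G ω).1 q.1 q.2,
      fun ω => (G ω).1 y j; P] := fun q => hG.cov q j
    refine Continuous.sub ?_ (continuous_finsetSum _ fun i _ => Continuous.mul
      ((continuous_apply j).comp (regCoef hG x₀ v i).2) continuous_const)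
    have h2 : ∀ y, cov[fun ω => (residualPath hG x₀ v ω).1 p.1 p.2, fun ω => (G ω).1 y j; P] =
        cov[fun ω => (G ω).1 p.1 p.2, fun ω => (G ω).1 y j; P] -
        ∑ i, (regCoef hG x₀ v i).1 p.1 p.2 *
          ∑ l, v i l * cov[fun ω => (G ω).1 x₀ l, fun ω => (G ω).1 y j; P] := by
      intro y
      rw [residualPath_eval hG x₀ v p.1, covariance_fun_sub_left
        (hG.memLp (eval_mem_pathSpan G p.1 p.2))
        (hG.memLp (sum_mem_fun _ fun i _ => mul_mem_fun _ (evalDir_mem G x₀ _)))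
        (hG.memLp (eval_mem_pathSpan G y j)),
        covariance_fun_sum_left (fun i => (hm i).const_mul _) (hG.memLp (eval_mem_pathSpan G y j))]
      congr 1
      refine Finset.sum_congr rfl fun i _ => ?_
      rw [covariance_const_mul_left]
      congr 1
      unfold evalDir
      rw [covariance_fun_sum_left (fun l => (hG.memLp (eval_mem_pathSpan G x₀ l)).const_mul _)
        (hG.memLp (eval_mem_pathSpan G y j))]
      simp_rw [covariance_const_mul_left]
    simp_rw [h2]
    exact (hc p).sub (continuous_finsetSum _ fun i _ => continuous_const.mul
      (continuous_finsetSum _ fun l _ => continuous_const.mul (hc (x₀, l))))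

end Regression

/-! ### Gaussian paths at adaptively selected points -/

section Freezing

variable {Ω E ι τ : Type*} [MeasurableSpace Ω] {P : Measure Ω} [IsProbabilityMeasure P]
  [TopologicalSpace E] [MeasurableSpace E] [BorelSpace E] [SecondCountableTopology E]
  [TopologicalSpace.MetrizableSpace E] [Fintype ι] [Fintype τ]

/-- The linear functional with coefficients `a` of the values of `g` at the queries. -/
def queryFunctional (ξ : (k : ℕ) → (Fin k → ι → ℝ) → E) {n : ℕ}
    (a : (Fin n → ι → ℝ) → τ → Fin (n + 1) → ι → ℝ) (d : Fin n → ι → ℝ) (g : E → ι → ℝ) (t : τ) :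
    ℝ := ∑ k, ∑ j, a d t k j * g (queryAt ξ d k) j

lemma measurable_queryFunctional {A : Type*} [MeasurableSpace A]
    {ξ : A → (k : ℕ) → (Fin k → ι → ℝ) → E}
    (hξ : ∀ k, Measurable fun p : A × (Fin k → ι → ℝ) => ξ p.1 k p.2) {n : ℕ}
    {a : A → (Fin n → ι → ℝ) → τ → Fin (n + 1) → ι → ℝ}
    (ha : Measurable fun p : A × (Fin n → ι → ℝ) => a p.1 p.2)
    {d : A → Fin n → ι → ℝ} (hd : Measurable d) {g : A → ContPath E ι} (hg : Measurable g) :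
    Measurable fun x => queryFunctional (ξ x) (a x) (d x) (g x).1 := by
  refine measurable_pi_lambda _ fun t => Finset.measurable_sum _ fun k _ =>
    Finset.measurable_sum _ fun j _ => Measurable.mul ?_ ?_
  · have h := ha.comp (measurable_id.prodMk hd)
    exact (measurable_pi_apply j).comp ((measurable_pi_apply k).comp
      ((measurable_pi_apply t).comp h))
  · exact (measurable_pi_apply j).comp (hg.contPath_eval (measurable_queryAt hd hξ k))

lemma queryFunctional_cons (ξ : (k : ℕ) → (Fin k → ι → ℝ) → E) {n : ℕ}
    (a : (Fin (n + 1) → ι → ℝ) → τ → Fin (n + 2) → ι → ℝ) (v : ι → ℝ) (d : Fin n → ι → ℝ)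
    (g : E → ι → ℝ) (t : τ) :
    queryFunctional ξ a (Fin.cons v d) g t = ∑ j, a (Fin.cons v d) t 0 j * g (ξ 0 Fin.elim0) j +
      queryFunctional (tailRule ξ v) (fun d t k => a (Fin.cons v d) t k.succ) d g t := by
  unfold queryFunctional
  rw [Fin.sum_univ_succ, queryAt_zero]
  simp_rw [queryAt_cons_succ]

lemma measurable_tailRule {A : Type*} [MeasurableSpace A]
    {ξ : A → (k : ℕ) → (Fin k → ι → ℝ) → E}
    (hξ : ∀ k, Measurable fun p : A × (Fin k → ι → ℝ) => ξ p.1 k p.2)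
    {v : A → ι → ℝ} (hv : Measurable v) (k : ℕ) :
    Measurable fun p : A × (Fin k → ι → ℝ) => tailRule (ξ p.1) (v p.1) k p.2 := by
  unfold tailRule
  refine (hξ (k + 1)).comp (measurable_fst.prodMk (measurable_pi_lambda _ fun i => ?_))
  refine Fin.cases ?_ (fun i => ?_) i
  · exact hv.comp measurable_fst
  · exact (measurable_pi_apply i).comp measurable_snd

lemma measurable_finCons {A : Type*} [MeasurableSpace A] {n : ℕ} {v : A → ι → ℝ}
    (hv : Measurable v) {d : A → Fin n → ι → ℝ} (hd : Measurable d) :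
    Measurable fun x => (Fin.cons (v x) (d x) : Fin (n + 1) → ι → ℝ) := by
  refine measurable_pi_lambda _ fun i => ?_
  refine Fin.cases ?_ (fun i => ?_) i
  · exact hv
  · exact (measurable_pi_apply i).comp hd

/-- Conditionally on the observations `D` of a Gaussian path at adaptively selected points, linear
functionals of the path at the queries that would be uncorrelated with the observations for fixed
queries are distributed as if the queries were fixed. -/
theorem lintegral_queryFunctional (n : ℕ) : ∀ {G : Ω → ContPath E ι}, IsGaussianPath P G →
    ∀ {ξ : (k : ℕ) → (Fin k → ι → ℝ) → E}, (∀ k, Measurable (ξ k)) →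
    ∀ {a : (Fin n → ι → ℝ) → τ → Fin (n + 1) → ι → ℝ}, Measurable a →
    ∀ {B : Set (Fin n → ι → ℝ)},
    (∀ d ∈ B, ∀ t (k : Fin n) j, cov[fun ω => queryFunctional ξ a d (G ω).1 t,
      fun ω => (G ω).1 (queryAt ξ d k.castSucc) j; P] = 0) →
    ∀ {Φ : (Fin n → ι → ℝ) → (τ → ℝ) → ENNReal}, Measurable (Function.uncurry Φ) →
    (∀ d ∉ B, ∀ r, Φ d r = 0) →
    ∫⁻ ω, Φ (fun i => adaptiveObs ξ (G ω).1 i)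
      (queryFunctional ξ a (fun i => adaptiveObs ξ (G ω).1 i) (G ω).1) ∂P =
    ∫⁻ ω, ∫⁻ ω', Φ (fun i => adaptiveObs ξ (G ω).1 i)
      (queryFunctional ξ a (fun i => adaptiveObs ξ (G ω).1 i) (G ω').1) ∂P ∂P := by
  induction n with
  | zero =>
    intro G hG ξ hξ a ha B hB Φ hΦ hΦB
    have h : ∀ ω, (fun i : Fin 0 => adaptiveObs ξ (G ω).1 i) = Fin.elim0 :=
      fun ω => Subsingleton.elim _ _
    simp_rw [h]
    rw [lintegral_const, measure_univ, mul_one]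
  | succ n ih =>
    intro G hG ξ hξ a ha B hB Φ hΦ hΦB
    -- The first query depends on no observation, so it is a fixed point at which ordinary
    -- regression applies.
    set x₀ : E := ξ 0 Fin.elim0 with hx₀
    obtain ⟨m, v, hv⟩ := exists_uncorrelated_basis hG x₀
    set c := regCoef hG x₀ v with hc
    set R := residualPath hG x₀ v with hR
    -- the components of a vector in the directions of the basis
    set W : (ι → ℝ) → Fin m → ℝ := fun u i => ∑ j, v i j * u j with hW
    have hWm : Measurable W := measurable_pi_lambda _ fun i =>
      Finset.measurable_sum _ fun j _ => (measurable_pi_apply j).const_mul _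
    have hWG : ∀ ω i, W ((G ω).1 x₀) i = evalDir G x₀ (v i) ω := fun ω i => rfl
    have hWa : ∀ b u : ι → ℝ, ∑ j, b j * u j = ∑ i, v.repr b i * W u i := by
      intro b u
      conv_lhs => rw [← v.sum_repr b]
      simp only [hW, Finset.sum_apply, Pi.smul_apply, smul_eq_mul, Finset.sum_mul, Finset.mul_sum]
      rw [Finset.sum_comm]
      simp only [mul_assoc]
    -- the conditioned path
    set H : (ι → ℝ) → ContPath E ι → ContPath E ι := fun u g => shiftPath c g (W u) with hH
    have hHG : ∀ ω, H ((G ω).1 x₀) (R ω) = G ω := fun ω => shiftPath_residualPath hG x₀ v ω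
    have hHm : Measurable fun p : (ι → ℝ) × ContPath E ι => H p.1 p.2 :=
      (measurable_shiftPath c).comp (measurable_snd.prodMk (hWm.comp measurable_fst))
    have hGx : Measurable fun ω => (G ω).1 x₀ := hG.measurable.contPath_eval measurable_const
    have hRm : Measurable R := measurable_residualPath hG x₀ v
    have hind : IndepFun (fun ω => (G ω).1 x₀) R P := indepFun_residualPath hG x₀ hv
    set D : (ι → ℝ) → ContPath E ι → Fin n → ι → ℝ :=
      fun u g i => adaptiveObs (tailRule ξ u) (H u g).1 i with hD
    have hξ' : ∀ k, Measurable fun p : ((ι → ℝ) × ContPath E ι) × (Fin k → ι → ℝ) =>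
        tailRule ξ p.1.1 k p.2 := fun k =>
      measurable_tailRule (ξ := fun _ => ξ) (fun k => (hξ k).comp measurable_snd) measurable_fst k
    have hDm : Measurable fun p : (ι → ℝ) × ContPath E ι => D p.1 p.2 :=
      measurable_pi_lambda _ fun i => measurable_adaptiveObs (ξ := fun p => tailRule ξ p.1)
        hHm hξ' i
    set a' : (ι → ℝ) → (Fin n → ι → ℝ) → τ → Fin (n + 1) → ι → ℝ :=
      fun u d t k => a (Fin.cons u d) t k.succ with ha'
    have ham : Measurable fun p : ((ι → ℝ) × ContPath E ι) × (Fin n → ι → ℝ) =>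
        a' p.1.1 p.2 := by
      refine measurable_pi_lambda _ fun t => measurable_pi_lambda _ fun k => ?_
      have h1 := ha.comp (measurable_finCons
        (measurable_fst.comp measurable_fst : Measurable fun p : ((ι → ℝ) × ContPath E ι) ×
          (Fin n → ι → ℝ) => p.1.1) measurable_snd)
      exact (measurable_pi_apply k.succ).comp ((measurable_pi_apply t).comp h1)
    have hDG : ∀ ω, (Fin.cons ((G ω).1 x₀) (D ((G ω).1 x₀) (R ω)) : Fin (n + 1) → ι → ℝ) =
        fun i : Fin (n + 1) => adaptiveObs ξ (G ω).1 i := by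
      intro ω
      rw [← cons_adaptiveObs, adaptiveObs_zero]
      simp only [hD, hHG, ← hx₀]
    -- first step: separate the first observation
    set Ψ : (ι → ℝ) → ContPath E ι → ENNReal := fun u g =>
      Φ (Fin.cons u (D u g)) fun t => ∑ j, a (Fin.cons u (D u g)) t 0 j * u j +
        queryFunctional (tailRule ξ u) (a' u) (D u g) (H u g).1 t with hΨ
    have hcons : Measurable fun p : (ι → ℝ) × ContPath E ι =>
        (Fin.cons p.1 (D p.1 p.2) : Fin (n + 1) → ι → ℝ) := measurable_finCons measurable_fst hDm
    have hΨm : Measurable (Function.uncurry Ψ) := by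
      refine hΦ.comp (hcons.prodMk (measurable_pi_lambda _ fun t => Measurable.add ?_ ?_))
      · refine Finset.measurable_sum _ fun j _ => Measurable.mul ?_
          ((measurable_pi_apply j).comp measurable_fst)
        exact (measurable_pi_apply j).comp ((measurable_pi_apply 0).comp
          ((measurable_pi_apply t).comp (ha.comp hcons)))
      · exact (measurable_pi_apply t).comp
          (measurable_queryFunctional (ξ := fun p : (ι → ℝ) × ContPath E ι => tailRule ξ p.1)
            (a := fun p => a' p.1) hξ' ham hDm hHm)
    have hL : ∫⁻ ω, Φ (fun i => adaptiveObs ξ (G ω).1 i)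
        (queryFunctional ξ a (fun i => adaptiveObs ξ (G ω).1 i) (G ω).1) ∂P =
        ∫⁻ ω, ∫⁻ ω', Ψ ((G ω).1 x₀) (R ω') ∂P ∂P := by
      rw [← lintegral_comp_of_indepFun hGx hRm hind hΨm]
      refine lintegral_congr fun ω => ?_
      rw [← hDG]
      simp only [hΨ]
      congr 1
      ext t
      rw [queryFunctional_cons, hHG]
    -- The frozen side, with the history expressed through the first observation and the residual
    -- path. The inner variable is an independent copy of the unconditioned path.
    set Ξ : (ι → ℝ) → ContPath E ι → ENNReal := fun u g => ∫⁻ ω', Φ (Fin.cons u (D u g))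
      (queryFunctional ξ a (Fin.cons u (D u g)) (G ω').1) ∂P with hΞ
    have hΞm : Measurable (Function.uncurry Ξ) := by
      refine Measurable.lintegral_prod_right' (f := fun q : ((ι → ℝ) × ContPath E ι) × Ω =>
        Φ (Fin.cons q.1.1 (D q.1.1 q.1.2))
          (queryFunctional ξ a (Fin.cons q.1.1 (D q.1.1 q.1.2)) (G q.2).1)) ?_
      refine hΦ.comp ((hcons.comp measurable_fst).prodMk ?_)
      exact measurable_queryFunctional (ξ := fun _ => ξ) (a := fun _ => a)
        (fun k => (hξ k).comp measurable_snd) (ha.comp measurable_snd)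
        (hcons.comp measurable_fst) (hG.measurable.comp measurable_snd)
    have hRt : ∫⁻ ω, ∫⁻ ω', Φ (fun i => adaptiveObs ξ (G ω).1 i)
        (queryFunctional ξ a (fun i => adaptiveObs ξ (G ω).1 i) (G ω').1) ∂P ∂P =
        ∫⁻ ω, ∫⁻ ω', Ξ ((G ω).1 x₀) (R ω') ∂P ∂P := by
      rw [← lintegral_comp_of_indepFun hGx hRm hind hΞm]
      refine lintegral_congr fun ω => ?_
      simp only [hΞ, hDG]
    rw [hL, hRt]
    -- the directions without variance are almost surely constant
    have hm : ∀ i, MemLp (evalDir G x₀ (v i)) 2 P := fun i => hG.memLp (evalDir_mem G x₀ _)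
    have hdeg : ∀ᵐ ω ∂P, ∀ i, Var[evalDir G x₀ (v i); P] = 0 →
        W ((G ω).1 x₀) i = ∫ ω, evalDir G x₀ (v i) ω ∂P := by
      rw [ae_all_iff]
      intro i
      by_cases h0 : Var[evalDir G x₀ (v i); P] = 0
      · filter_upwards [ae_eq_integral_of_variance_eq_zero (hm i) h0] with ω hω _
        rw [hWG, hω]
      · exact ae_of_all _ fun ω h => absurd h h0
    refine lintegral_congr_ae ?_
    filter_upwards [hdeg] with ω₀ hω₀
    set u := (G ω₀).1 x₀ with hu
    have hGH : IsGaussianPath P fun ω => H u (R ω) :=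
      isGaussianPath_shiftPath_residualPath hG x₀ v (W u)
    -- decomposition of the functional
    set S : (Fin n → ι → ℝ) → τ → Ω → ℝ := fun d t ω =>
      queryFunctional (tailRule ξ u) (a' u) d (R ω).1 t with hS
    -- The total weight of the `i`-th direction of the first observation: its direct coefficient,
    -- and the contribution through the regression of all later values.
    set e : (Fin n → ι → ℝ) → τ → Fin m → ℝ := fun d t i =>
      v.repr (a (Fin.cons u d) t 0) i +
        queryFunctional (tailRule ξ u) (a' u) d (c i).1 t with he
    have hshift : ∀ d t (g : ContPath E ι) (w : Fin m → ℝ),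
        queryFunctional (tailRule ξ u) (a' u) d (shiftPath c g w).1 t =
        queryFunctional (tailRule ξ u) (a' u) d g.1 t +
          ∑ i, w i * queryFunctional (tailRule ξ u) (a' u) d (c i).1 t := by
      intro d t g w
      unfold queryFunctional
      simp only [shiftPath_apply, mul_add, Finset.sum_add_distrib]
      congr 1
      simp only [Finset.mul_sum]
      rw [Finset.sum_comm]
      conv_lhs => enter [2, j]; rw [Finset.sum_comm]
      rw [Finset.sum_comm]
      conv_rhs => enter [2, i]; rw [Finset.sum_comm]
      refine Finset.sum_congr rfl fun i _ => Finset.sum_congr rfl fun j _ =>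
        Finset.sum_congr rfl fun k _ => ?_
      ring
    have hcond : ∀ d t ω, ∑ j, a (Fin.cons u d) t 0 j * u j +
        queryFunctional (tailRule ξ u) (a' u) d (H u (R ω)).1 t =
        S d t ω + ∑ i, e d t i * W u i := by
      intro d t ω
      rw [hWa, hH, hshift]
      simp only [he, add_mul, Finset.sum_add_distrib, hS]
      simp only [mul_comm (W u _)]
      ring
    -- The conditioned and the free functional share the residual part `S`; they differ only in
    -- whether `e` multiplies the observed components `W u` or fresh ones.
    have hfree : ∀ d t ω, queryFunctional ξ a (Fin.cons u d) (G ω).1 t =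
        S d t ω + ∑ i, e d t i * evalDir G x₀ (v i) ω := by
      intro d t ω
      rw [queryFunctional_cons, ← hx₀, hWa]
      have h4 := hshift d t (R ω) (W ((G ω).1 x₀))
      rw [show shiftPath c (R ω) (W ((G ω).1 x₀)) = G ω from hHG ω] at h4
      rw [h4]
      simp only [← hWG]
      simp only [he, add_mul, Finset.sum_add_distrib, hS]
      simp only [mul_comm (W _ _)]
      ring
    have hSmem : ∀ d t, S d t ∈ pathSpan G := fun d t =>
      sum_mem_fun _ fun k _ => sum_mem_fun _ fun j _ => mul_mem_fun _ (residualPath_mem hG x₀ v _ j)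
    have hSR : ∀ d t i, cov[S d t, evalDir G x₀ (v i); P] = 0 := by
      intro d t i
      have hr : ∀ y j, MemLp (fun ω => (R ω).1 y j) 2 P := fun y j =>
        hG.memLp (residualPath_mem hG x₀ v y j)
      simp only [hS, queryFunctional]
      rw [covariance_fun_sum_left (fun k => memLp_finsetSum _ fun j _ => (hr _ j).const_mul _)
        (hm i)]
      refine Finset.sum_eq_zero fun k _ => ?_
      rw [covariance_fun_sum_left (fun j => (hr _ j).const_mul _) (hm i)]
      refine Finset.sum_eq_zero fun j _ => ?_
      rw [covariance_const_mul_left, cov_residualPath_evalDir hG x₀ hv, mul_zero]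
    have hTmem : ∀ d t, (fun ω => ∑ i, e d t i * evalDir G x₀ (v i) ω) ∈ pathSpan G := fun d t =>
      sum_mem_fun _ fun i _ => mul_mem_fun _ (evalDir_mem G x₀ _)
    -- the coefficients vanish in the directions with positive variance
    have hevar : ∀ d, (Fin.cons u d : Fin (n + 1) → ι → ℝ) ∈ B → ∀ t i,
        e d t i * Var[evalDir G x₀ (v i); P] = 0 := by
      intro d hd t i
      have h1 : cov[fun ω => queryFunctional ξ a (Fin.cons u d) (G ω).1 t,
          evalDir G x₀ (v i); P] = 0 := by
        change cov[_, fun ω => ∑ j, v i j * (G ω).1 x₀ j; P] = 0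
        have hq : MemLp (fun ω => queryFunctional ξ a (Fin.cons u d) (G ω).1 t) 2 P :=
          hG.memLp (sum_mem_fun _ fun k _ => sum_mem_fun _ fun j _ =>
            mul_mem_fun _ (eval_mem_pathSpan G _ j))
        rw [covariance_fun_sum_right
          (fun j => (hG.memLp (eval_mem_pathSpan G x₀ j)).const_mul _) hq]
        refine Finset.sum_eq_zero fun j _ => ?_
        have h2 := hB _ hd t 0 j
        rw [Fin.castSucc_zero, queryAt_zero] at h2
        rw [covariance_const_mul_right, h2, mul_zero]
      simp_rw [hfree] at h1
      rw [covariance_add_fun_left (hG.memLp (hSmem d t)) (hG.memLp (hTmem d t)) (hm i), hSR,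
        zero_add, covariance_fun_sum_left (fun i => (hm i).const_mul _) (hm i)] at h1
      simp_rw [covariance_const_mul_left] at h1
      rwa [Finset.sum_eq_single i (fun l _ hl => by rw [hv l i hl, mul_zero]) (by simp),
        covariance_self (hm i).aemeasurable] at h1
    have hTcov : ∀ d, (Fin.cons u d : Fin (n + 1) → ι → ℝ) ∈ B → ∀ t (Y : Ω → ℝ), MemLp Y 2 P →
        cov[fun ω => ∑ i, e d t i * evalDir G x₀ (v i) ω, Y; P] = 0 := by
      intro d hd t Y hY
      rw [covariance_fun_sum_left (fun i => (hm i).const_mul _) hY]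
      refine Finset.sum_eq_zero fun i _ => ?_
      rw [covariance_const_mul_left]
      rcases mul_eq_zero.1 (hevar d hd t i) with h | h
      · rw [h, zero_mul]
      · rw [covariance_eq_zero_of_variance_eq_zero (hm i) h, mul_zero]
    -- the induction hypothesis for the conditioned path
    have hih := ih hGH (ξ := tailRule ξ u) (a := a' u)
      (B := {d | (Fin.cons u d : Fin (n + 1) → ι → ℝ) ∈ B})
      (Φ := fun d r => Φ (Fin.cons u d) fun t => ∑ j, a (Fin.cons u d) t 0 j * u j + r t)
      (fun k => (hξ' k).comp ((measurable_const (a := (u, R ω₀))).prodMk measurable_id))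
      (ham.comp ((measurable_const (a := (u, R ω₀))).prodMk measurable_id)) ?_ ?_ ?_
    · change ∫⁻ ω', Ψ u (R ω') ∂P = ∫⁻ ω', Ξ u (R ω') ∂P
      refine hih.trans (lintegral_congr fun ω => ?_)
      change _ = ∫⁻ ω', _ ∂P
      by_cases hd : (Fin.cons u (D u (R ω)) : Fin (n + 1) → ι → ℝ) ∈ B
      swap
      · refine lintegral_congr fun ω' => ?_
        exact (hΦB _ hd _).trans (hΦB _ hd _).symm
      refine lintegral_congr_ae ?_
      filter_upwards [hdeg] with ω' hω'
      change Φ (Fin.cons u (D u (R ω))) _ = _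
      congr 1
      ext t
      rw [hfree]
      refine (hcond (D u (R ω)) t ω').trans ?_
      congr 1
      refine Finset.sum_congr rfl fun i _ => ?_
      -- Either the weight is zero, or the direction has no variance and its component is the same
      -- constant in the observed and in the fresh sample.
      rcases mul_eq_zero.1 (hevar _ hd t i) with h | h
      · rw [h, zero_mul, zero_mul]
      · rw [hω₀ i h, ← hω' i h, hWG]
    -- The hypothesis of uncorrelatedness passes to the conditioned path: constants do not matter,
    -- the `e` part has covariance zero with everything, and `S` is uncorrelated with the first
    -- observation, hence with the regression part of later values.
    · intro d hd t k j
      have h1 := hB _ hd t k.succ j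
      rw [show k.succ.castSucc = (k.castSucc).succ from rfl, queryAt_cons_succ] at h1
      simp_rw [hfree] at h1
      have hGmem := hG.memLp (eval_mem_pathSpan G (queryAt (tailRule ξ u) d k.castSucc) j)
      rw [covariance_add_fun_left (hG.memLp (hSmem d t)) (hG.memLp (hTmem d t)) hGmem,
        hTcov d hd t _ hGmem, add_zero] at h1
      have h2 : ∀ ω, queryFunctional (tailRule ξ u) (a' u) d (H u (R ω)).1 t = S d t ω +
          ∑ i, W u i * queryFunctional (tailRule ξ u) (a' u) d (c i).1 t :=
        fun ω => hshift d t (R ω) (W u)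
      simp_rw [h2]
      rw [covariance_add_const_left ((hG.memLp (hSmem d t)).integrable (by norm_num))]
      have h3 : ∀ ω, (H u (R ω)).1 (queryAt (tailRule ξ u) d k.castSucc) j =
          (R ω).1 (queryAt (tailRule ξ u) d k.castSucc) j +
          ∑ i, W u i * (c i).1 (queryAt (tailRule ξ u) d k.castSucc) j := fun ω => rfl
      simp_rw [h3]
      rw [covariance_add_const_right
        ((hG.memLp (residualPath_mem hG x₀ v _ j)).integrable (by norm_num)),
        residualPath_eval hG x₀ v, covariance_fun_sub_right (hG.memLp (hSmem d t)) hGmem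
        (hG.memLp (sum_mem_fun _ fun i _ => mul_mem_fun _ (evalDir_mem G x₀ _))), h1,
        covariance_fun_sum_right (fun i => (hm i).const_mul _) (hG.memLp (hSmem d t)), zero_sub,
        neg_eq_zero]
      refine Finset.sum_eq_zero fun i _ => ?_
      rw [covariance_const_mul_right, hSR, mul_zero]
    · have hc1 : Measurable fun p : (Fin n → ι → ℝ) × (τ → ℝ) =>
          (Fin.cons u p.1 : Fin (n + 1) → ι → ℝ) :=
        measurable_finCons measurable_const measurable_fst
      refine hΦ.comp (hc1.prodMk (measurable_pi_lambda _ fun t => Measurable.add ?_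
        ((measurable_pi_apply t).comp measurable_snd)))
      refine Finset.measurable_sum _ fun j _ => Measurable.mul_const ?_ _
      exact (measurable_pi_apply j).comp ((measurable_pi_apply 0).comp
          ((measurable_pi_apply t).comp (ha.comp hc1)))
    · exact fun d hd r => hΦB _ hd _

/-- The version of `lintegral_queryFunctional` with an independent random parameter. -/
theorem lintegral_queryFunctional_of_indepFun {A : Type*} [MeasurableSpace A] {n : ℕ}
    {G : Ω → ContPath E ι} (hG : IsGaussianPath P G) {X : Ω → A} (hX : Measurable X)
    (hXG : IndepFun X G P) {ξ : A → (k : ℕ) → (Fin k → ι → ℝ) → E}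
    (hξ : ∀ k, Measurable fun p : A × (Fin k → ι → ℝ) => ξ p.1 k p.2)
    {a : A → (Fin n → ι → ℝ) → τ → Fin (n + 1) → ι → ℝ}
    (ha : Measurable fun p : A × (Fin n → ι → ℝ) => a p.1 p.2)
    {B : A → Set (Fin n → ι → ℝ)}
    (hB : ∀ x, ∀ d ∈ B x, ∀ t (k : Fin n) j,
      cov[fun ω => queryFunctional (ξ x) (a x) d (G ω).1 t,
        fun ω => (G ω).1 (queryAt (ξ x) d k.castSucc) j; P] = 0)
    {Φ : A → (Fin n → ι → ℝ) → (τ → ℝ) → ENNReal}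
    (hΦ : Measurable fun p : (A × (Fin n → ι → ℝ)) × (τ → ℝ) => Φ p.1.1 p.1.2 p.2)
    (hΦB : ∀ x, ∀ d ∉ B x, ∀ r, Φ x d r = 0) :
    ∫⁻ ω, Φ (X ω) (fun i => adaptiveObs (ξ (X ω)) (G ω).1 i)
      (queryFunctional (ξ (X ω)) (a (X ω))
        (fun i => adaptiveObs (ξ (X ω)) (G ω).1 i) (G ω).1) ∂P =
    ∫⁻ ω, ∫⁻ ω', Φ (X ω) (fun i => adaptiveObs (ξ (X ω)) (G ω).1 i)
      (queryFunctional (ξ (X ω)) (a (X ω))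
        (fun i => adaptiveObs (ξ (X ω)) (G ω).1 i) (G ω').1) ∂P ∂P := by
  have hξ1 : ∀ k, Measurable fun p : (A × ContPath E ι) × (Fin k → ι → ℝ) =>
      ξ p.1.1 k p.2 := fun k =>
    (hξ k).comp ((measurable_fst.comp measurable_fst).prodMk measurable_snd)
  have hD : Measurable fun p : A × ContPath E ι => fun i : Fin n =>
      adaptiveObs (ξ p.1) p.2.1 i := measurable_pi_lambda _ fun i =>
    measurable_adaptiveObs (ξ := fun p : A × ContPath E ι => ξ p.1) measurable_snd hξ1 i
  have ha1 : Measurable fun p : (A × ContPath E ι) × (Fin n → ι → ℝ) => a p.1.1 p.2 :=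
    ha.comp ((measurable_fst.comp measurable_fst).prodMk measurable_snd)
  rw [lintegral_comp_of_indepFun hX hG.measurable hXG
    (Ψ := fun x g => Φ x (fun i => adaptiveObs (ξ x) g.1 i)
      (queryFunctional (ξ x) (a x) (fun i => adaptiveObs (ξ x) g.1 i) g.1)) ?_,
    lintegral_comp_of_indepFun hX hG.measurable hXG
    (Ψ := fun x g => ∫⁻ ω', Φ x (fun i => adaptiveObs (ξ x) g.1 i)
      (queryFunctional (ξ x) (a x) (fun i => adaptiveObs (ξ x) g.1 i) (G ω').1) ∂P) ?_]
  · refine lintegral_congr fun ω => ?_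
    exact lintegral_queryFunctional n hG (fun k => (hξ k).comp measurable_prodMk_left)
      (ha.comp measurable_prodMk_left) (hB (X ω))
      (hΦ.comp ((measurable_prodMk_left.comp measurable_fst).prodMk measurable_snd)) (hΦB (X ω))
  · refine Measurable.lintegral_prod_right' (f := fun q : (A × ContPath E ι) × Ω =>
        Φ q.1.1 (fun i => adaptiveObs (ξ q.1.1) q.1.2.1 i)
          (queryFunctional (ξ q.1.1) (a q.1.1)
            (fun i => adaptiveObs (ξ q.1.1) q.1.2.1 i) (G q.2).1)) ?_
    refine hΦ.comp (((measurable_fst.comp measurable_fst).prodMk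
      (hD.comp measurable_fst)).prodMk ?_)
    exact measurable_queryFunctional (ξ := fun q : (A × ContPath E ι) × Ω => ξ q.1.1)
      (a := fun q => a q.1.1)
      (fun k => (hξ1 k).comp ((measurable_fst.comp measurable_fst).prodMk measurable_snd))
      (ha1.comp ((measurable_fst.comp measurable_fst).prodMk measurable_snd))
      (hD.comp measurable_fst) (hG.measurable.comp measurable_snd)
  · refine hΦ.comp ((measurable_fst.prodMk hD).prodMk ?_)
    exact measurable_queryFunctional (ξ := fun q : A × ContPath E ι => ξ q.1)
      (a := fun q => a q.1) hξ1 ha1 hD measurable_snd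

end Freezing

/-! ### Limits of Gaussian processes -/

section Limits

variable {Ω T : Type*} [MeasurableSpace Ω] {P : Measure Ω} [IsProbabilityMeasure P]

/-- Every linear functional of a finite marginal is an almost sure limit of Gaussian variables with
convergent means, so the one dimensional case suffices. -/
lemma isGaussianProcess_of_tendsto {Z : ℕ → T → Ω → ℝ} {Y : T → Ω → ℝ} {m : T → ℝ}
    (hZ : ∀ n, IsGaussianProcess (Z n) P) (hY : ∀ t, AEMeasurable (Y t) P)
    (hlim : ∀ t, ∀ᵐ ω ∂P, Tendsto (fun n => Z n t ω) atTop (𝓝 (Y t ω)))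
    (hm : ∀ t, Tendsto (fun n => ∫ ω, Z n t ω ∂P) atTop (𝓝 (m t))) :
    IsGaussianProcess Y P where
  hasGaussianLaw I := by
    classical
    have hYI : AEMeasurable (fun ω => I.restrict (Y · ω)) P :=
      aemeasurable_pi_lambda _ fun t => hY t
    refine ⟨isGaussian_of_isGaussian_map fun L => ?_⟩
    rw [AEMeasurable.map_map_of_aemeasurable (by fun_prop) hYI]
    have hL : ∀ x : I → ℝ, L x = ∑ t, x t * L (Pi.single t 1) := by
      intro x
      conv_lhs => rw [pi_eq_sum_univ' x, map_sum]
      refine Finset.sum_congr rfl fun t _ => ?_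
      rw [map_smul, smul_eq_mul]
    have hint : ∀ n t, Integrable (Z n t) P := fun n t =>
      ((hZ n).hasGaussianLaw_eval t).integrable
    refine (hasGaussianLaw_of_tendsto (Z := fun n ω => L (I.restrict (Z n · ω)))
      (Y := L ∘ fun ω => I.restrict (Y · ω))
      (m := ∑ t : I, m t * L (Pi.single t 1))
      (fun n => ((hZ n).hasGaussianLaw I).map L) (L.continuous.measurable.comp_aemeasurable hYI)
      ?_ ?_).1.isGaussian_map
    · have h : ∀ᵐ ω ∂P, ∀ t : I, Tendsto (fun n => Z n t ω) atTop (𝓝 (Y t ω)) := by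
        rw [ae_all_iff]; exact fun t => hlim t
      filter_upwards [h] with ω hω
      exact (L.continuous.tendsto _).comp (tendsto_pi_nhds.2 hω)
    · have h : ∀ n, ∫ ω, L (I.restrict (Z n · ω)) ∂P =
          ∑ t : I, (∫ ω, Z n t ω ∂P) * L (Pi.single t 1) := by
        intro n
        rw [integral_congr_ae (ae_of_all _ fun ω => hL _)]
        change ∫ ω, ∑ t : I, Z n t ω * L (Pi.single t 1) ∂P = _
        rw [integral_finsetSum _ fun (t : I) _ => (hint n t).mul_const _]
        simp_rw [integral_mul_const]
      simp_rw [h]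
      exact tendsto_finsetSum _ fun t _ => (hm t).mul_const _

/-- By polarization, covariances are combinations of variances of the two variables and of their
sum, and these converge. -/
lemma tendsto_covariance {Z Z' : ℕ → Ω → ℝ} {Y Y' : Ω → ℝ} {m m' : ℝ}
    (hZ : ∀ n, HasGaussianLaw (fun ω => (Z n ω, Z' n ω)) P)
    (hY : AEMeasurable Y P) (hY' : AEMeasurable Y' P)
    (hlim : ∀ᵐ ω ∂P, Tendsto (fun n => Z n ω) atTop (𝓝 (Y ω)))
    (hlim' : ∀ᵐ ω ∂P, Tendsto (fun n => Z' n ω) atTop (𝓝 (Y' ω)))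
    (hm : Tendsto (fun n => ∫ ω, Z n ω ∂P) atTop (𝓝 m))
    (hm' : Tendsto (fun n => ∫ ω, Z' n ω ∂P) atTop (𝓝 m')) :
    Tendsto (fun n => cov[Z n, Z' n; P]) atTop (𝓝 cov[Y, Y'; P]) := by
  have h1 := hasGaussianLaw_of_tendsto (fun n => (hZ n).fst) hY hlim hm
  have h2 := hasGaussianLaw_of_tendsto (fun n => (hZ n).snd) hY' hlim' hm'
  have h3 := hasGaussianLaw_of_tendsto (Z := fun n => Z n + Z' n) (Y := Y + Y') (m := m + m')
    (fun n => (hZ n).add) (hY.add hY')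
    (by filter_upwards [hlim, hlim'] with ω h h' using h.add h') (by
      refine (hm.add hm').congr fun n => ?_
      rw [← integral_add (hZ n).fst.integrable (hZ n).snd.integrable]
      rfl)
  have hc : ∀ X X' : Ω → ℝ, MemLp X 2 P → MemLp X' 2 P →
      cov[X, X'; P] = (Var[X + X'; P] - Var[X; P] - Var[X'; P]) / 2 := by
    intro X X' hX hX'
    rw [variance_add hX hX']
    ring
  rw [hc _ _ h1.1.memLp_two h2.1.memLp_two]
  refine (((h3.2.2.sub h1.2.2).sub h2.2.2).div_const 2).congr fun n => ?_
  rw [hc _ _ (hZ n).fst.memLp_two (hZ n).snd.memLp_two]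

end Limits

/-! ### Jets of functions and of kernels -/

/-- The functional `f ↦ a f(x) + ⟨∇f(x), v⟩`. -/
structure Jet (E : Type*) where
  point : E
  value : ℝ
  dir : E

section Jets

variable {E F : Type*} [NormedAddCommGroup E] [InnerProductSpace ℝ E] [NormedAddCommGroup F]
  [InnerProductSpace ℝ F]

noncomputable def Jet.eval [CompleteSpace E] (J : Jet E) (f : E → ℝ) : ℝ :=
  J.value * f J.point + inner ℝ (gradient f J.point) J.dir

def Jet.map (U : E →ₗᵢ[ℝ] F) (J : Jet E) : Jet F := ⟨U J.point, J.value, U J.dir⟩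

/-- The point of the difference quotient with the step `1 / (j + 1)`. -/
noncomputable def Jet.shifted (J : Jet E) (j : ℕ) : E := J.point + (1 / ((j : ℝ) + 1)) • J.dir

/-- The difference quotient that approximates a jet. -/
noncomputable def Jet.quot (J : Jet E) (j : ℕ) (f : E → ℝ) : ℝ :=
  (J.value - (j + 1)) * f J.point + (j + 1) * f (J.shifted j)

noncomputable def radialKernel (κ : ℝ → ℝ → ℝ → ℝ) (x y : E) : ℝ :=
  κ (‖x‖ ^ 2 / 2) (‖y‖ ^ 2 / 2) (inner ℝ x y)

/-- The covariance of difference quotients. -/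
noncomputable def quotKernel (κ : ℝ → ℝ → ℝ → ℝ) (j : ℕ) (J J' : Jet E) : ℝ :=
  (J.value - (j + 1)) * ((J'.value - (j + 1)) * radialKernel κ J.point J'.point) +
  (J.value - (j + 1)) * ((j + 1) * radialKernel κ J.point (J'.shifted j)) +
  ((j + 1) * ((J'.value - (j + 1)) * radialKernel κ (J.shifted j) J'.point) +
  (j + 1) * ((j + 1) * radialKernel κ (J.shifted j) (J'.shifted j)))

/-- The covariance of jets, up to the factor `1 / N`. -/
noncomputable def jetKernel (κ : ℝ → ℝ → ℝ → ℝ) (J J' : Jet E) : ℝ :=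
  limUnder atTop fun j => quotKernel κ j J J'

/-- The mean of jets. -/
noncomputable def jetMean (μ : ℝ → ℝ) (J : Jet E) : ℝ :=
  J.value * μ (‖J.point‖ ^ 2 / 2) + deriv μ (‖J.point‖ ^ 2 / 2) * inner ℝ J.point J.dir

lemma Jet.map_shifted (U : E →ₗᵢ[ℝ] F) (J : Jet E) (j : ℕ) :
    (J.map U).shifted j = U (J.shifted j) := by
  simp [Jet.shifted, Jet.map]

lemma radialKernel_map (κ : ℝ → ℝ → ℝ → ℝ) (U : E →ₗᵢ[ℝ] F) (x y : E) :
    radialKernel κ (U x) (U y) = radialKernel κ x y := by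
  simp [radialKernel]

/-- Every difference quotient sees `κ` only at norms and inner products, so invariance holds before
the limit and no differentiation rule for `κ` is needed. -/
lemma jetKernel_map (κ : ℝ → ℝ → ℝ → ℝ) (U : E →ₗᵢ[ℝ] F) (J J' : Jet E) :
    jetKernel κ (J.map U) (J'.map U) = jetKernel κ J J' := by
  unfold jetKernel quotKernel
  simp only [Jet.map_shifted]
  simp only [Jet.map, radialKernel_map]

lemma jetMean_map (μ : ℝ → ℝ) (U : E →ₗᵢ[ℝ] F) (J : Jet E) :
    jetMean μ (J.map U) = jetMean μ J := by
  simp [jetMean, Jet.map]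

/-- The quotient is `value * f(x)` plus the slope of `t ↦ f(x + t v)` between `0` and `1 / (j + 1)`,
and this slope tends to the directional derivative. -/
lemma tendsto_jet_quot [CompleteSpace E] {f : E → ℝ} (hf : ContDiff ℝ 1 f) (J : Jet E) :
    Tendsto (fun j => J.quot j f) atTop (𝓝 (J.eval f)) := by
  have hd : HasDerivAt (fun t : ℝ => f (J.point + t • J.dir))
      (inner ℝ (gradient f J.point) J.dir) 0 := by
    have h1 : HasFDerivAt f (fderiv ℝ f J.point) (J.point + (0 : ℝ) • J.dir) := by
      rw [zero_smul, add_zero]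
      exact (hf.differentiable one_ne_zero _).hasFDerivAt
    have h2 : HasDerivAt (fun t : ℝ => J.point + t • J.dir) J.dir 0 := by
      simpa using ((hasDerivAt_id (0 : ℝ)).smul_const J.dir).const_add J.point
    have h3 := h1.comp_hasDerivAt (0 : ℝ) h2
    rwa [← toDual_gradient, InnerProductSpace.toDual_apply_apply] at h3
  have ht : Tendsto (fun j : ℕ => 1 / ((j : ℝ) + 1)) atTop (𝓝[≠] 0) :=
    tendsto_nhdsWithin_iff.2 ⟨tendsto_one_div_add_atTop_nhds_zero_nat,
      Eventually.of_forall fun j => by simpa using Nat.cast_add_one_ne_zero j⟩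
  have h4 := ((hasDerivAt_iff_tendsto_slope.1 hd).comp ht).const_add (J.value * f J.point)
  refine h4.congr fun j => ?_
  have hj : ((j : ℝ) + 1) ≠ 0 := Nat.cast_add_one_ne_zero j
  simp only [Function.comp, slope_def_field, zero_smul, add_zero, Jet.quot, Jet.shifted]
  field_simp
  ring

end Jets

/-! ### Isotropic Gaussian random functions with continuously differentiable paths -/

section Model

variable {Ω : Type*} [MeasurableSpace Ω] {P : Measure Ω} [IsProbabilityMeasure P]
  {μ : ℝ → ℝ} {κ : ℝ → ℝ → ℝ → ℝ} {N : ℕ}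

/-- An isotropic Gaussian random function with continuously differentiable paths. -/
structure IsSmoothGRF (μ : ℝ → ℝ) (κ : ℝ → ℝ → ℝ → ℝ) (P : Measure Ω) (f : Ω → Eucl N → ℝ) :
    Prop where
  grf : IsIsotropicGRF μ κ P f
  contDiff : ∀ ω, ContDiff ℝ 1 (f ω)
  mean : ContDiff ℝ 1 μ
  pos : 1 ≤ N

variable {f : Ω → Eucl N → ℝ}

lemma measurable_jet_quot (hf : IsIsotropicGRF μ κ P f) (J : Jet (Eucl N)) (j : ℕ) :
    Measurable fun ω => J.quot j (f ω) :=
  ((hf.measurable _).const_mul _).add ((hf.measurable _).const_mul _)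

lemma measurable_jet_eval (hf : IsSmoothGRF μ κ P f) (J : Jet (Eucl N)) :
    Measurable fun ω => J.eval (f ω) :=
  measurable_of_tendsto_metrizable (fun j => measurable_jet_quot hf.grf J j)
    (tendsto_pi_nhds.2 fun ω => tendsto_jet_quot (hf.contDiff ω) J)

lemma isGaussianProcess_jet_quot (hf : IsIsotropicGRF μ κ P f) (j : ℕ) :
    IsGaussianProcess (fun (J : Jet (Eucl N)) ω => J.quot j (f ω)) P := by
  refine isGaussianProcess_of_mem_span hf.gaussian fun J => ?_
  exact Submodule.add_mem _ (Submodule.smul_mem _ _ (Submodule.subset_span ⟨_, rfl⟩))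
    (Submodule.smul_mem _ _ (Submodule.subset_span ⟨_, rfl⟩))

lemma integral_jet_quot (hf : IsIsotropicGRF μ κ P f) (J : Jet (Eucl N)) (j : ℕ) :
    ∫ ω, J.quot j (f ω) ∂P = J.quot j fun x => μ (‖x‖ ^ 2 / 2) := by
  have hi : ∀ x, Integrable (fun ω => f ω x) P := fun x =>
    (hf.gaussian.hasGaussianLaw_eval x).integrable
  unfold Jet.quot
  rw [integral_add ((hi _).const_mul _) ((hi _).const_mul _), integral_const_mul,
    integral_const_mul, hf.mean, hf.mean]

/-- The mean of a quotient is the same quotient of the mean function, which is continuously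
differentiable with gradient `μ'(‖x‖²/2) x`. -/
lemma tendsto_integral_jet_quot (hf : IsSmoothGRF μ κ P f) (J : Jet (Eucl N)) :
    Tendsto (fun j => ∫ ω, J.quot j (f ω) ∂P) atTop (𝓝 (jetMean μ J)) := by
  have hsq : ∀ x : Eucl N, HasGradientAt (fun x : Eucl N => μ (‖x‖ ^ 2 / 2))
      (deriv μ (‖x‖ ^ 2 / 2) • x) x := by
    intro x
    rw [hasGradientAt_iff_hasFDerivAt]
    have h1 : HasFDerivAt (fun x : Eucl N => ‖x‖ ^ 2 / 2) (innerSL ℝ x) x := by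
      have h := ((hasStrictFDerivAt_norm_sq x).hasFDerivAt).mul_const (2 : ℝ)⁻¹
      have he : (2 : ℝ)⁻¹ • (2 • innerSL ℝ x) = innerSL ℝ x := by
        ext y
        simp
      rw [he] at h
      simpa [div_eq_mul_inv] using h
    have h2 : HasDerivAt μ (deriv μ (‖x‖ ^ 2 / 2)) (‖x‖ ^ 2 / 2) :=
      (hf.mean.differentiable one_ne_zero _).hasDerivAt
    have h3 := h2.comp_hasFDerivAt x h1
    have h4 : (InnerProductSpace.toDual ℝ (Eucl N)) (deriv μ (‖x‖ ^ 2 / 2) • x) =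
        deriv μ (‖x‖ ^ 2 / 2) • innerSL ℝ x := by
      ext y
      simp
    rw [h4]
    exact h3
  have hc : ContDiff ℝ 1 fun x : Eucl N => μ (‖x‖ ^ 2 / 2) :=
    hf.mean.comp ((contDiff_norm_sq ℝ).div_const 2)
  have h := tendsto_jet_quot hc J
  simp_rw [integral_jet_quot hf.grf]
  convert h using 2
  rw [Jet.eval, (hsq _).gradient, inner_smul_left]
  rfl

/-- The jets of a smooth random function form a Gaussian process. -/
lemma IsSmoothGRF.isGaussianProcess (hf : IsSmoothGRF μ κ P f) :
    IsGaussianProcess (fun (J : Jet (Eucl N)) ω => J.eval (f ω)) P :=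
  isGaussianProcess_of_tendsto (isGaussianProcess_jet_quot hf.grf)
    (fun J => (measurable_jet_eval hf J).aemeasurable)
    (fun J => ae_of_all _ fun ω => tendsto_jet_quot (hf.contDiff ω) J)
    (tendsto_integral_jet_quot hf)

lemma IsSmoothGRF.integral_eval (hf : IsSmoothGRF μ κ P f) (J : Jet (Eucl N)) :
    ∫ ω, J.eval (f ω) ∂P = jetMean μ J :=
  (hasGaussianLaw_of_tendsto (fun j => (isGaussianProcess_jet_quot hf.grf j).hasGaussianLaw_eval J)
    (measurable_jet_eval hf J).aemeasurable
    (ae_of_all _ fun ω => tendsto_jet_quot (hf.contDiff ω) J)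
    (tendsto_integral_jet_quot hf J)).2.1

lemma cov_jet_quot (hf : IsSmoothGRF μ κ P f) (J J' : Jet (Eucl N)) (j : ℕ) :
    cov[fun ω => J.quot j (f ω), fun ω => J'.quot j (f ω); P] =
      1 / (N : ℝ) * quotKernel κ j J J' := by
  have hm : ∀ x, MemLp (fun ω => f ω x) 2 P := fun x =>
    (hf.grf.gaussian.hasGaussianLaw_eval x).memLp_two
  have hadd : ∀ {X Y Z : Ω → ℝ}, MemLp X 2 P → MemLp Y 2 P → MemLp Z 2 P →
      cov[Z, fun ω => X ω + Y ω; P] = cov[Z, X; P] + cov[Z, Y; P] := by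
    intro X Y Z hX hY hZ
    rw [covariance_comm, covariance_add_fun_left hX hY hZ, covariance_comm,
      covariance_comm (X := Y)]
  have hq : MemLp (fun ω => J'.quot j (f ω)) 2 P := ((hm _).const_mul _).add ((hm _).const_mul _)
  unfold Jet.quot at hq ⊢
  rw [covariance_add_fun_left ((hm _).const_mul _) ((hm _).const_mul _) hq,
    hadd ((hm _).const_mul _) ((hm _).const_mul _) ((hm _).const_mul _),
    hadd ((hm _).const_mul _) ((hm _).const_mul _) ((hm _).const_mul _)]
  simp_rw [covariance_const_mul_left, covariance_const_mul_right, hf.grf.cov]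
  unfold quotKernel radialKernel
  ring

/-- The covariances of the quotients converge because the quotients are jointly Gaussian and
converge pathwise. So the limit that defines `jetKernel` exists and is `N` times the covariance of
the jets. -/
lemma IsSmoothGRF.cov_eval (hf : IsSmoothGRF μ κ P f) (J J' : Jet (Eucl N)) :
    cov[fun ω => J.eval (f ω), fun ω => J'.eval (f ω); P] = 1 / (N : ℝ) * jetKernel κ J J' := by
  have h := tendsto_covariance
    (fun j => (isGaussianProcess_jet_quot hf.grf j).hasGaussianLaw_prodMk (s := J) (t := J'))
    (measurable_jet_eval hf J).aemeasurable (measurable_jet_eval hf J').aemeasurable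
    (ae_of_all _ fun ω => tendsto_jet_quot (hf.contDiff ω) J)
    (ae_of_all _ fun ω => tendsto_jet_quot (hf.contDiff ω) J')
    (tendsto_integral_jet_quot hf J) (tendsto_integral_jet_quot hf J')
  simp_rw [cov_jet_quot hf] at h
  have hN : (N : ℝ) ≠ 0 := Nat.cast_ne_zero.2 (Nat.one_le_iff_ne_zero.1 hf.pos)
  have h2 := (h.const_mul (N : ℝ))
  simp_rw [← mul_assoc, mul_one_div_cancel hN, one_mul] at h2
  rw [jetKernel, h2.limUnder_eq, ← mul_assoc, one_div_mul_cancel hN, one_mul]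

lemma IsSmoothGRF.jetKernel_eq (hf : IsSmoothGRF μ κ P f) (J J' : Jet (Eucl N)) :
    jetKernel κ J J' = N * cov[fun ω => J.eval (f ω), fun ω => J'.eval (f ω); P] := by
  have hN : (N : ℝ) ≠ 0 := Nat.cast_ne_zero.2 (Nat.one_le_iff_ne_zero.1 hf.pos)
  rw [hf.cov_eval, ← mul_assoc, mul_one_div_cancel hN, one_mul]

lemma continuous_gradient {g : Eucl N → ℝ} (hg : ContDiff ℝ 1 g) : Continuous (gradient g) :=
  (InnerProductSpace.toDual ℝ (Eucl N)).symm.continuous.comp (hg.continuous_fderiv one_ne_zero)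

lemma tendsto_jet_eval {g : Eucl N → ℝ} (hg : ContDiff ℝ 1 g) {A : Type*} {l : Filter A}
    {J : A → Jet (Eucl N)} {J₀ : Jet (Eucl N)}
    (h1 : Tendsto (fun a => (J a).point) l (𝓝 J₀.point))
    (h2 : Tendsto (fun a => (J a).value) l (𝓝 J₀.value))
    (h3 : Tendsto (fun a => (J a).dir) l (𝓝 J₀.dir)) :
    Tendsto (fun a => (J a).eval g) l (𝓝 (J₀.eval g)) :=
  (h2.mul ((hg.continuous.tendsto _).comp h1)).add
    ((((continuous_gradient hg).tendsto _).comp h1).inner h3)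

lemma tendsto_jetMean (hμ : ContDiff ℝ 1 μ) {A : Type*} {l : Filter A}
    {J : A → Jet (Eucl N)} {J₀ : Jet (Eucl N)}
    (h1 : Tendsto (fun a => (J a).point) l (𝓝 J₀.point))
    (h2 : Tendsto (fun a => (J a).value) l (𝓝 J₀.value))
    (h3 : Tendsto (fun a => (J a).dir) l (𝓝 J₀.dir)) :
    Tendsto (fun a => jetMean μ (J a)) l (𝓝 (jetMean μ J₀)) := by
  have h4 : Tendsto (fun a => ‖(J a).point‖ ^ 2 / 2) l (𝓝 (‖J₀.point‖ ^ 2 / 2)) :=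
    (h1.norm.pow 2).div_const 2
  exact (h2.mul ((hμ.continuous.tendsto _).comp h4)).add
    ((((hμ.continuous_deriv le_rfl).tendsto _).comp h4).mul (h1.inner h3))

/-- The kernel of the jets is continuous. -/
lemma IsSmoothGRF.continuous_jetKernel (hf : IsSmoothGRF μ κ P f) :
    Continuous fun p : (Eucl N × ℝ × Eucl N) × (Eucl N × ℝ × Eucl N) =>
      jetKernel κ (⟨p.1.1, p.1.2.1, p.1.2.2⟩ : Jet (Eucl N)) ⟨p.2.1, p.2.2.1, p.2.2.2⟩ := by
  -- Along a convergent sequence the jets converge pathwise with convergent means, and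
  -- `tendsto_covariance` applies.
  rw [continuous_iff_seqContinuous]
  intro x p hx
  simp only [Function.comp_def, hf.jetKernel_eq]
  refine Tendsto.const_mul _ ?_
  have h1 := (continuous_fst.tendsto _).comp hx
  have h2 := (continuous_snd.tendsto _).comp hx
  have k : ∀ {y : ℕ → Eucl N × ℝ × Eucl N} {q : Eucl N × ℝ × Eucl N}, Tendsto y atTop (𝓝 q) →
      Tendsto (fun n => (y n).1) atTop (𝓝 q.1) ∧ Tendsto (fun n => (y n).2.1) atTop (𝓝 q.2.1) ∧
      Tendsto (fun n => (y n).2.2) atTop (𝓝 q.2.2) := fun h =>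
    ⟨(continuous_fst.tendsto _).comp h, ((continuous_fst.comp continuous_snd).tendsto _).comp h,
      ((continuous_snd.comp continuous_snd).tendsto _).comp h⟩
  obtain ⟨a1, a2, a3⟩ := k h1
  obtain ⟨b1, b2, b3⟩ := k h2
  refine tendsto_covariance (fun n => hf.isGaussianProcess.hasGaussianLaw_prodMk)
    (measurable_jet_eval hf _).aemeasurable (measurable_jet_eval hf _).aemeasurable
    (ae_of_all _ fun ω => tendsto_jet_eval (hf.contDiff ω) a1 a2 a3)
    (ae_of_all _ fun ω => tendsto_jet_eval (hf.contDiff ω) b1 b2 b3)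
    (m := jetMean μ ⟨p.1.1, p.1.2.1, p.1.2.2⟩) (m' := jetMean μ ⟨p.2.1, p.2.2.1, p.2.2.2⟩) ?_ ?_
  · simp_rw [hf.integral_eval]
    exact tendsto_jetMean hf.mean a1 a2 a3
  · simp_rw [hf.integral_eval]
    exact tendsto_jetMean hf.mean b1 b2 b3

end Model

/-! ### The path of the function with its gradient, and smooth modifications -/

section Path

variable {Ω : Type*} [MeasurableSpace Ω] {P : Measure Ω} [IsProbabilityMeasure P]
  {μ : ℝ → ℝ} {κ : ℝ → ℝ → ℝ → ℝ} {N : ℕ} {f : Ω → Eucl N → ℝ}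

/-- The function value and the components of the gradient. -/
noncomputable def gradObs (g : Eucl N → ℝ) (x : Eucl N) : Option (Fin N) → ℝ
  | none => g x
  | some i => gradient g x i

/-- The coordinate jets at a point. -/
noncomputable def coordJet (x : Eucl N) : Option (Fin N) → Jet (Eucl N)
  | none => ⟨x, 1, 0⟩
  | some i => ⟨x, 0, EuclideanSpace.single i 1⟩

lemma coordJet_eval (x : Eucl N) (o : Option (Fin N)) (g : Eucl N → ℝ) :
    (coordJet x o).eval g = gradObs g x o := by
  cases o with
  | none => simp [coordJet, Jet.eval, gradObs]
  | some i =>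
    simp only [coordJet, Jet.eval, gradObs]
    rw [EuclideanSpace.inner_single_right]
    simp

lemma continuous_gradObs {g : Eucl N → ℝ} (hg : ContDiff ℝ 1 g) : Continuous (gradObs g) := by
  refine continuous_pi fun o => ?_
  cases o with
  | none => exact hg.continuous
  | some i => exact (EuclideanSpace.proj i : Eucl N →L[ℝ] ℝ).continuous.comp (continuous_gradient hg)

/-- The path of a smooth random function with its gradient. -/
noncomputable def IsSmoothGRF.path (hf : IsSmoothGRF μ κ P f) (ω : Ω) :
    ContPath (Eucl N) (Option (Fin N)) :=
  ⟨gradObs (f ω), continuous_gradObs (hf.contDiff ω)⟩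

/-- The σ-algebra on the sample space is left arbitrary, so that it can also be taken to be the one
generated by `f`. -/
lemma measurable_gradPath {Ω : Type*} [MeasurableSpace Ω] {f : Ω → Eucl N → ℝ}
    (h0 : ∀ x, Measurable fun ω => f ω x) (hf : ∀ ω, ContDiff ℝ 1 (f ω)) :
    Measurable fun ω =>
      (⟨gradObs (f ω), continuous_gradObs (hf ω)⟩ : ContPath (Eucl N) (Option (Fin N))) := by
  refine Measurable.subtype_mk (measurable_pi_lambda _ fun x => measurable_pi_lambda _ fun o => ?_)
  simp_rw [← coordJet_eval]
  refine measurable_of_tendsto_metrizable (f := fun j ω => (coordJet x o).quot j (f ω))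
    (fun j => ?_) (tendsto_pi_nhds.2 fun ω => tendsto_jet_quot (hf ω) _)
  exact ((h0 _).const_mul _).add ((h0 _).const_mul _)

lemma IsSmoothGRF.path_apply (hf : IsSmoothGRF μ κ P f) (ω : Ω) (x : Eucl N)
    (o : Option (Fin N)) : (hf.path ω).1 x o = (coordJet x o).eval (f ω) :=
  (coordJet_eval x o (f ω)).symm

lemma IsSmoothGRF.continuous_jetKernel_coordJet (hf : IsSmoothGRF μ κ P f) (J : Jet (Eucl N))
    (o : Option (Fin N)) : Continuous fun x => jetKernel κ J (coordJet x o) := by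
  obtain ⟨y, b, w⟩ := J
  have hc : ∀ (a : ℝ) (v : Eucl N), Continuous fun x => jetKernel κ ⟨y, b, w⟩ ⟨x, a, v⟩ := by
    intro a v
    have h : Continuous fun x : Eucl N => ((y, b, w), (x, a, v)) := by fun_prop
    have h2 := hf.continuous_jetKernel.comp h
    exact h2
  cases o
  · exact hc _ _
  · exact hc _ _

lemma IsSmoothGRF.cov_path (hf : IsSmoothGRF μ κ P f) (x y : Eucl N) (o o' : Option (Fin N)) :
    cov[fun ω => (hf.path ω).1 x o, fun ω => (hf.path ω).1 y o'; P] =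
      1 / (N : ℝ) * jetKernel κ (coordJet x o) (coordJet y o') := by
  rw [← hf.cov_eval]
  simp_rw [hf.path_apply]

lemma IsSmoothGRF.isGaussianProcess_path (hf : IsSmoothGRF μ κ P f) :
    IsGaussianProcess (fun (p : Eucl N × Option (Fin N)) ω => (hf.path ω).1 p.1 p.2) P := by
  have h : (fun (p : Eucl N × Option (Fin N)) ω => (hf.path ω).1 p.1 p.2) =
      (fun (J : Jet (Eucl N)) ω => J.eval (f ω)) ∘
        fun p : Eucl N × Option (Fin N) => coordJet p.1 p.2 := by
    funext p ω
    exact hf.path_apply ω p.1 p.2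
  rw [h]
  exact hf.isGaussianProcess.comp_right _

lemma IsSmoothGRF.isGaussianPath (hf : IsSmoothGRF μ κ P f) : IsGaussianPath P hf.path :=
  ⟨measurable_gradPath hf.grf.measurable hf.contDiff, hf.isGaussianProcess_path, fun p o => by
    simp_rw [hf.cov_path]
    exact continuous_const.mul (hf.continuous_jetKernel_coordJet _ _)⟩

/-- The path with its gradient is measurable with respect to the σ-algebra generated by `f`, because
derivatives are limits of difference quotients. -/
lemma IsSmoothGRF.indepFun_path {A : Type*} [MeasurableSpace A] {X : Ω → A}
    (hf : IsSmoothGRF μ κ P f) (h : IndepFun X f P) : IndepFun X hf.path P := by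
  rw [IndepFun_iff_Indep] at h ⊢
  refine indep_of_indep_of_le_right h ?_
  rw [← measurable_iff_comap_le]
  exact @measurable_gradPath N Ω (MeasurableSpace.comap f inferInstance) f
    (fun x => (measurable_pi_apply x).comp (comap_measurable f)) hf.contDiff

lemma covariance_congr_ae {X X' Y Y' : Ω → ℝ} (hX : X =ᵐ[P] X') (hY : Y =ᵐ[P] Y') :
    cov[X, Y; P] = cov[X', Y'; P] := by
  rw [covariance, covariance, integral_congr_ae hX, integral_congr_ae hY]
  refine integral_congr_ae ?_
  filter_upwards [hX, hY] with ω h1 h2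
  rw [h1, h2]

/-- Gaussian random functions with almost surely smooth paths have a smooth modification. -/
lemma exists_smooth_modification (hf : IsIsotropicGRF μ κ P f) (hμ : ContDiff ℝ 1 μ) (hN : 1 ≤ N)
    (hC : ∀ᵐ ω ∂P, ContDiff ℝ 1 (f ω)) :
    ∃ f' : Ω → Eucl N → ℝ, IsSmoothGRF μ κ P f' ∧ ∀ᵐ ω ∂P, f ω = f' ω := by
  classical
  -- The event of a non-smooth path need not be measurable; replacing the function on a measurable
  -- null superset keeps the modification measurable.
  obtain ⟨S, hS, hSm, hS0⟩ := exists_measurable_superset_of_null (ae_iff.1 hC)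
  let f' : Ω → Eucl N → ℝ := fun ω => if ω ∈ S then 0 else f ω
  have hff : ∀ᵐ ω ∂P, f ω = f' ω := by
    have h : ∀ᵐ ω ∂P, ω ∉ S := measure_eq_zero_iff_ae_notMem.1 hS0
    filter_upwards [h] with ω hω
    simp [f', hω]
  have hx : ∀ x, (fun ω => f ω x) =ᵐ[P] fun ω => f' ω x := fun x => by
    filter_upwards [hff] with ω hω
    rw [hω]
  refine ⟨f', ⟨⟨fun x => ?_, hf.gaussian.congr hx, fun x => ?_, fun x y => ?_⟩, fun ω => ?_, hμ, hN⟩,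
    hff⟩
  · have h : (fun ω => f' ω x) = fun ω => if ω ∈ S then 0 else f ω x := by
      ext ω
      by_cases h : ω ∈ S <;> simp [f', h]
    rw [h]
    exact Measurable.ite hSm measurable_const (hf.measurable x)
  · rw [← hf.mean, integral_congr_ae (hx x)]
  · rw [← hf.cov, covariance_congr_ae (hx x) (hx y)]
  · by_cases h : ω ∈ S
    · simp only [f', h, if_true]
      exact contDiff_const
    · simp only [f', h, if_false]
      by_contra hc
      exact h (hS hc)

end Path

/-! ### Properties of the kernel of the jets -/

/-- Bilinearity, continuity and strict positive definiteness of the kernel in dimension `N`. -/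
structure IsSmoothKernel (κ : ℝ → ℝ → ℝ → ℝ) (N : ℕ) : Prop where
  comm : ∀ J J' : Jet (Eucl N), jetKernel κ J J' = jetKernel κ J' J
  add_left : ∀ (x : Eucl N) (a a' : ℝ) (v v' : Eucl N) (J : Jet (Eucl N)),
    jetKernel κ ⟨x, a + a', v + v'⟩ J = jetKernel κ ⟨x, a, v⟩ J + jetKernel κ ⟨x, a', v'⟩ J
  smul_left : ∀ (x : Eucl N) (c a : ℝ) (v : Eucl N) (J : Jet (Eucl N)),
    jetKernel κ ⟨x, c * a, c • v⟩ J = c * jetKernel κ ⟨x, a, v⟩ J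
  continuous : Continuous fun p : (Eucl N × ℝ × Eucl N) × (Eucl N × ℝ × Eucl N) =>
    jetKernel κ (⟨p.1.1, p.1.2.1, p.1.2.2⟩ : Jet (Eucl N)) ⟨p.2.1, p.2.2.1, p.2.2.2⟩
  nonneg : ∀ (n : ℕ) (J : Fin n → Jet (Eucl N)), 0 ≤ ∑ k, ∑ l, jetKernel κ (J k) (J l)
  pos : ∀ (n : ℕ) (J : Fin n → Jet (Eucl N)), Function.Injective (fun k => (J k).point) →
    ∑ k, ∑ l, jetKernel κ (J k) (J l) = 0 → ∀ k, (J k).value = 0 ∧ (J k).dir = 0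

section Kernel

variable {Ω : Type*} [MeasurableSpace Ω] {P : Measure Ω} [IsProbabilityMeasure P]
  {μ : ℝ → ℝ} {κ : ℝ → ℝ → ℝ → ℝ} {N : ℕ} {f : Ω → Eucl N → ℝ}

lemma IsSmoothGRF.memLp_eval (hf : IsSmoothGRF μ κ P f) (J : Jet (Eucl N)) :
    MemLp (fun ω => J.eval (f ω)) 2 P := (hf.isGaussianProcess.hasGaussianLaw_eval J).memLp_two

lemma IsSmoothGRF.variance_sum (hf : IsSmoothGRF μ κ P f) {n : ℕ} (J : Fin n → Jet (Eucl N)) :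
    (N : ℝ) * Var[fun ω => ∑ k, (J k).eval (f ω); P] = ∑ k, ∑ l, jetKernel κ (J k) (J l) := by
  have hm := hf.memLp_eval
  rw [← covariance_self (memLp_finsetSum _ fun k _ => hm (J k)).aemeasurable,
    covariance_fun_sum_fun_sum (fun k => hm (J k)) (fun k => hm (J k)), Finset.mul_sum]
  refine Finset.sum_congr rfl fun k _ => ?_
  rw [Finset.mul_sum]
  exact Finset.sum_congr rfl fun l _ => (hf.jetKernel_eq _ _).symm

/-- The kernel is `N` times a covariance of jets, and jets at one point depend linearly on value and
direction. Since a jet pairs `(f, ∇f)` with a vector, a vanishing double sum is exactly the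
vanishing variance in strict positive definiteness. -/
lemma IsSmoothGRF.isSmoothKernel (hf : IsSmoothGRF μ κ P f)
    (hpd : IsStrictlyPosDef P fun ω => withGradient (f ω)) : IsSmoothKernel κ N where
  comm J J' := by rw [hf.jetKernel_eq, hf.jetKernel_eq, covariance_comm]
  add_left x a a' v v' J := by
    rw [hf.jetKernel_eq, hf.jetKernel_eq, hf.jetKernel_eq, ← mul_add,
      ← covariance_add_fun_left (hf.memLp_eval _) (hf.memLp_eval _) (hf.memLp_eval _)]
    congr 2
    ext ω
    simp only [Jet.eval, inner_add_right]
    ring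
  smul_left x c a v J := by
    rw [hf.jetKernel_eq, hf.jetKernel_eq, mul_left_comm, ← covariance_const_mul_left c]
    congr 2
    ext ω
    simp only [Jet.eval, inner_smul_right]
    ring
  continuous := hf.continuous_jetKernel
  nonneg n J := by
    rw [← hf.variance_sum]
    exact mul_nonneg (Nat.cast_nonneg _) (variance_nonneg _ _)
  pos n J hJ h k := by
    have hN : (N : ℝ) ≠ 0 := Nat.cast_ne_zero.2 (Nat.one_le_iff_ne_zero.1 hf.pos)
    rw [← hf.variance_sum] at h
    have h1 := hpd n (fun k => (J k).point) hJ (fun k => WithLp.toLp 2 ((J k).value, (J k).dir)) ?_ k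
    · have h2 := congrArg (fun z : WithLp 2 (ℝ × Eucl N) => z.fst) h1
      have h3 := congrArg (fun z : WithLp 2 (ℝ × Eucl N) => z.snd) h1
      exact ⟨h2, h3⟩
    · rw [← (mul_eq_zero.1 h).resolve_left hN]
      congr 1
      ext ω
      refine Finset.sum_congr rfl fun k _ => ?_
      simp [withGradient, Jet.eval, WithLp.prod_inner_apply, mul_comm]

lemma isStrictlyPosDef_congr {f' : Ω → Eucl N → ℝ} (h : ∀ᵐ ω ∂P, f ω = f' ω)
    (hpd : IsStrictlyPosDef P fun ω => withGradient (f ω)) :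
    IsStrictlyPosDef P fun ω => withGradient (f' ω) := by
  intro n x hx w hw
  refine hpd n x hx w ?_
  rw [← hw]
  refine variance_congr ?_
  filter_upwards [h] with ω hω
  rw [hω]

end Kernel

/-! ### Orthonormal systems -/

section Orthonormal

variable {E : Type*} [NormedAddCommGroup E] [InnerProductSpace ℝ E]

lemma inner_eq_sum_of_mem_span {ι : Type*} [Fintype ι] {v : ι → E} (hv : Orthonormal ℝ v) {x y : E}
    (hx : x ∈ Submodule.span ℝ (Set.range v)) (hy : y ∈ Submodule.span ℝ (Set.range v)) :
    inner ℝ x y = ∑ i, inner ℝ x (v i) * inner ℝ y (v i) := by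
  obtain ⟨a, rfl⟩ := (Submodule.mem_span_range_iff_exists_fun ℝ).1 hx
  obtain ⟨b, rfl⟩ := (Submodule.mem_span_range_iff_exists_fun ℝ).1 hy
  rw [hv.inner_sum]
  simp [hv.inner_left_fintype]

lemma eq_sum_of_mem_span {ι : Type*} [Fintype ι] {v : ι → E} (hv : Orthonormal ℝ v) {x : E}
    (hx : x ∈ Submodule.span ℝ (Set.range v)) : x = ∑ i, inner ℝ (v i) x • v i := by
  obtain ⟨a, rfl⟩ := (Submodule.mem_span_range_iff_exists_fun ℝ).1 hx
  simp [hv.inner_right_fintype]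

lemma norm_sq_eq_sum_of_mem_span {ι : Type*} [Fintype ι] {v : ι → E} (hv : Orthonormal ℝ v) {x : E}
    (hx : x ∈ Submodule.span ℝ (Set.range v)) : ‖x‖ ^ 2 = ∑ i, inner ℝ x (v i) ^ 2 := by
  rw [← real_inner_self_eq_norm_sq, inner_eq_sum_of_mem_span hv hx hx]
  simp [pow_two]

lemma orthonormal_snoc {d : ℕ} {u : Fin d → E} (hu : Orthonormal ℝ u) {w : E} (hw : ‖w‖ = 1)
    (h : ∀ i, inner ℝ (u i) w = 0) : Orthonormal ℝ (Fin.snoc u w : Fin (d + 1) → E) := by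
  rw [orthonormal_iff_ite] at hu ⊢
  intro i j
  refine Fin.lastCases ?_ (fun i => ?_) i <;> refine Fin.lastCases ?_ (fun j => ?_) j
  · simp [hw]
  · simp only [Fin.snoc_last, Fin.snoc_castSucc]
    rw [real_inner_comm, h, if_neg (Fin.castSucc_lt_last j).ne']
  · simp only [Fin.snoc_last, Fin.snoc_castSucc]
    rw [h, if_neg (Fin.castSucc_lt_last i).ne]
  · simp only [Fin.snoc_castSucc, hu i j, Fin.castSucc_inj]

lemma range_snoc {d : ℕ} (u : Fin d → E) (w : E) :
    Set.range (Fin.snoc u w : Fin (d + 1) → E) = insert w (Set.range u) := by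
  ext x
  simp only [Set.mem_range, Set.mem_insert_iff]
  constructor
  · rintro ⟨i, rfl⟩
    refine Fin.lastCases ?_ (fun i => ?_) i
    · simp
    · right; exact ⟨i, by simp⟩
  · rintro (rfl | ⟨i, rfl⟩)
    · exact ⟨Fin.last d, by simp⟩
    · exact ⟨i.castSucc, by simp⟩

/-- The isometry that maps the standard basis to an orthonormal system. -/
noncomputable def isometryOfSystem {q : ℕ} {w : Fin q → E} (hw : Orthonormal ℝ w) :
    Eucl q →ₗᵢ[ℝ] E :=
  LinearMap.isometryOfOrthonormal ((EuclideanSpace.basisFun (Fin q) ℝ).toBasis.constr ℝ w)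
    (v := (EuclideanSpace.basisFun (Fin q) ℝ).toBasis)
    (by rw [OrthonormalBasis.coe_toBasis]; exact (EuclideanSpace.basisFun (Fin q) ℝ).orthonormal)
    (by
      convert hw using 1
      ext i
      simp only [Function.comp, Module.Basis.constr_basis])

lemma isometryOfSystem_apply {q : ℕ} {w : Fin q → E} (hw : Orthonormal ℝ w) (x : Eucl q) :
    isometryOfSystem hw x = ∑ i, x i • w i := by
  change ((EuclideanSpace.basisFun (Fin q) ℝ).toBasis.constr ℝ w) x = _
  rw [Module.Basis.constr_apply_fintype]
  rfl

lemma isometryOfSystem_single {q : ℕ} {w : Fin q → E} (hw : Orthonormal ℝ w) (i : Fin q) :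
    isometryOfSystem hw (EuclideanSpace.single i 1) = w i := by
  rw [isometryOfSystem_apply, Finset.sum_eq_single i]
  · simp
  · intro j _ hj
    simp [hj]
  · simp

end Orthonormal

/-! ### The evaluation spaces and their bases -/

section Algorithm

variable {N : ℕ} (G : GSA) (f : Eucl N → ℝ) (x₀ : Eucl N)

lemma GSA.gradient_mem {k n : ℕ} (h : k < n) :
    gradient f (G.point f x₀ k) ∈ G.evalSpace f x₀ n :=
  Submodule.subset_span (Or.inr ⟨k, h, rfl⟩)

lemma GSA.start_mem (n : ℕ) : x₀ ∈ G.evalSpace f x₀ n := Submodule.subset_span (Or.inl rfl)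

lemma GSA.evalSpace_mono {m n : ℕ} (h : m ≤ n) : G.evalSpace f x₀ m ≤ G.evalSpace f x₀ n := by
  refine Submodule.span_mono ?_
  rintro v (hv | ⟨k, hk, rfl⟩)
  · exact Or.inl hv
  · exact Or.inr ⟨k, hk.trans_le h, rfl⟩

lemma GSA.point_zero : G.point f x₀ 0 = x₀ := by rw [GSA.point]

lemma GSA.point_succ (n : ℕ) : G.point f x₀ (n + 1) = G.hx n (G.info f x₀ n) • x₀ +
    ∑ k : Fin (n + 1), G.hg n (G.info f x₀ n) k • gradient f (G.point f x₀ k.val) := by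
  rw [GSA.point]; rfl

lemma GSA.point_mem {k n : ℕ} (h : k ≤ n) : G.point f x₀ k ∈ G.evalSpace f x₀ n := by
  cases k with
  | zero => rw [G.point_zero]; exact G.start_mem f x₀ n
  | succ k =>
    rw [G.point_succ]
    exact Submodule.add_mem _ (Submodule.smul_mem _ _ (G.start_mem f x₀ n))
      (Submodule.sum_mem _ fun i _ => Submodule.smul_mem _ _
        (G.gradient_mem f x₀ (by have := i.isLt; omega)))

lemma GSA.candidate_mem (n : ℕ) : G.candidate f x₀ n ∈ (G.evalSpace f x₀ n)ᗮ :=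
  Submodule.sub_starProjection_mem_orthogonal _

lemma GSA.evalSpace_succ (n : ℕ) : G.evalSpace f x₀ (n + 1) =
    G.evalSpace f x₀ n ⊔ Submodule.span ℝ {G.candidate f x₀ n} := by
  have hV : ((G.evalSpace f x₀ n).starProjection (gradient f (G.point f x₀ n))) ∈
    G.evalSpace f x₀ n := Submodule.starProjection_apply_mem _ _
  apply le_antisymm
  · refine Submodule.span_le.2 ?_
    rintro v (hv | ⟨k, hk, rfl⟩)
    · rw [Set.mem_singleton_iff.1 hv]
      exact Submodule.mem_sup_left (G.start_mem f x₀ n)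
    · rcases Nat.lt_succ_iff_lt_or_eq.1 hk with h | rfl
      · exact Submodule.mem_sup_left (G.gradient_mem f x₀ h)
      · have : gradient f (G.point f x₀ k) =
            (G.evalSpace f x₀ k).starProjection (gradient f (G.point f x₀ k)) +
              G.candidate f x₀ k := by
          rw [GSA.candidate]; abel
        rw [this]
        exact Submodule.add_mem_sup hV (Submodule.mem_span_singleton_self _)
  · refine sup_le (G.evalSpace_mono f x₀ n.le_succ) ?_
    rw [Submodule.span_singleton_le_iff_mem]
    exact Submodule.sub_mem _ (G.gradient_mem f x₀ n.lt_succ_self)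
      (G.evalSpace_mono f x₀ n.le_succ hV)

/-- The list `basisList n` is an orthonormal basis of `V_n`. -/
lemma GSA.basisList_eq_ofFn (n : ℕ) : ∃ (d : ℕ) (u : Fin d → Eucl N),
    G.basisList f x₀ n = List.ofFn u ∧ Orthonormal ℝ u ∧
      Submodule.span ℝ (Set.range u) = G.evalSpace f x₀ n := by
  induction n with
  | zero =>
    have h0 : G.evalSpace f x₀ 0 = Submodule.span ℝ {x₀} := by
      simp [GSA.evalSpace]
    by_cases hx : x₀ = 0
    · refine ⟨0, Fin.elim0, by simp [GSA.basisList, hx], ⟨fun i => i.elim0, fun i => i.elim0⟩, ?_⟩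
      rw [h0, hx]
      simp
    · have hn : ‖x₀‖ ≠ 0 := norm_ne_zero_iff.2 hx
      refine ⟨1, fun _ => ‖x₀‖⁻¹ • x₀, by simp [GSA.basisList, hx],
        ⟨fun _ => by rw [norm_smul, norm_inv, norm_norm, inv_mul_cancel₀ hn], fun i j hij =>
          absurd (Subsingleton.elim i j) hij⟩, ?_⟩
      rw [h0, Set.range_const,
        Submodule.span_singleton_smul_eq (IsUnit.mk0 _ (inv_ne_zero hn))]
  | succ n ih =>
    obtain ⟨d, u, hl, hu, hs⟩ := ih
    by_cases hc : G.candidate f x₀ n = 0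
    · refine ⟨d, u, by simp [GSA.basisList, hc, hl], hu, ?_⟩
      rw [G.evalSpace_succ, hc, hs]
      simp
    · have hn : ‖G.candidate f x₀ n‖ ≠ 0 := norm_ne_zero_iff.2 hc
      refine ⟨d + 1, Fin.snoc u (‖G.candidate f x₀ n‖⁻¹ • G.candidate f x₀ n), ?_,
        orthonormal_snoc hu (by rw [norm_smul, norm_inv, norm_norm, inv_mul_cancel₀ hn])
          (fun i => ?_), ?_⟩
      · rw [GSA.basisList, if_neg hc, hl, List.ofFn_succ', List.concat_eq_append]
        simp
      · rw [inner_smul_right, (Submodule.mem_orthogonal _ _).1 (G.candidate_mem f x₀ n) (u i), mul_zero]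
        rw [← hs]
        exact Submodule.subset_span ⟨i, rfl⟩
      · rw [range_snoc, Submodule.span_insert, G.evalSpace_succ, hs,
          Submodule.span_singleton_smul_eq (IsUnit.mk0 _ (inv_ne_zero hn)), sup_comm]

lemma GSA.length_basisList (n : ℕ) : (G.basisList f x₀ n).length = G.dim f x₀ n := by
  obtain ⟨d, u, hl, hu, hs⟩ := G.basisList_eq_ofFn f x₀ n
  rw [hl, List.length_ofFn, GSA.dim, ← hs, finrank_span_eq_card hu.linearIndependent,
    Fintype.card_fin]

/-- Parseval's identity for the elements of `V_n`. -/
lemma GSA.norm_sq_eq_sum {n : ℕ} {x : Eucl N} (hx : x ∈ G.evalSpace f x₀ n) :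
    ‖x‖ ^ 2 = ∑ i ∈ Finset.range (G.dim f x₀ n), (inner ℝ x (G.basisVec f x₀ n i)) ^ 2 := by
  obtain ⟨d, u, hl, hu, hs⟩ := G.basisList_eq_ofFn f x₀ n
  have hd : G.dim f x₀ n = d := by rw [← G.length_basisList, hl, List.length_ofFn]
  rw [hd, Finset.sum_range, norm_sq_eq_sum_of_mem_span hu (hs ▸ hx)]
  refine Finset.sum_congr rfl fun i _ => ?_
  have : G.basisVec f x₀ n i = u i := by
    rw [GSA.basisVec, hl]
    simp
  rw [this]

/-! ### Gram-Schmidt vectors -/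

/-- The sequence `x₀, g_0, g_1, …`, without `x₀` if `δ = 0`. -/
def gradSeq {E : Type*} (δ : ℕ) (x₀ : E) (g : ℕ → E) (i : ℕ) : E :=
  if i < δ then x₀ else g (i - δ)

/-- The normalized Gram-Schmidt vectors of `gradSeq`. -/
noncomputable def gsVec (δ : ℕ) (x₀ : Eucl N) (g : ℕ → Eucl N) (i : ℕ) : Eucl N :=
  InnerProductSpace.gramSchmidtNormed ℝ (gradSeq δ x₀ g) i

lemma gramSchmidt_congr {s t : ℕ → Eucl N} (n : ℕ) (h : ∀ i ≤ n, s i = t i) :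
    InnerProductSpace.gramSchmidt ℝ s n = InnerProductSpace.gramSchmidt ℝ t n := by
  induction n using Nat.strong_induction_on with
  | _ n ih =>
    rw [InnerProductSpace.gramSchmidt_def, InnerProductSpace.gramSchmidt_def, h n le_rfl]
    congr 1
    refine Finset.sum_congr rfl fun i hi => ?_
    rw [ih i (Finset.mem_Iio.1 hi) fun j hj => h j (hj.trans (Finset.mem_Iio.1 hi).le)]

/-- The `i`-th Gram-Schmidt vector involves only the first `i + 1` input vectors, so it can be
computed from a history that is padded with zeros. -/
lemma gsVec_congr {δ : ℕ} {g g' : ℕ → Eucl N} {m i : ℕ} (h : ∀ k < m, g k = g' k)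
    (hi : i < m + δ) : gsVec δ x₀ g i = gsVec δ x₀ g' i := by
  unfold gsVec InnerProductSpace.gramSchmidtNormed
  rw [gramSchmidt_congr i fun j hj => ?_]
  unfold gradSeq
  split_ifs with hjδ
  · rfl
  · exact h _ (by omega)

variable {δ : ℕ} (hδ : δ = if x₀ = 0 then 0 else 1)

/-- The gradients along the run of the algorithm. -/
noncomputable def GSA.grads (k : ℕ) : Eucl N := gradient f (G.point f x₀ k)

include hδ in
lemma GSA.evalSpace_eq_span (n : ℕ) : G.evalSpace f x₀ n =
    Submodule.span ℝ (gradSeq δ x₀ (G.grads f x₀) '' Set.Iio (n + δ)) := by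
  apply le_antisymm
  · refine Submodule.span_le.2 ?_
    rintro v (hv | ⟨k, hk, rfl⟩)
    · rw [Set.mem_singleton_iff.1 hv]
      by_cases hx : x₀ = 0
      · rw [hx]; exact Submodule.zero_mem _
      · refine Submodule.subset_span ⟨0, ?_, ?_⟩
        · simp [hδ, hx]
        · simp [gradSeq, hδ, hx]
    · refine Submodule.subset_span ⟨k + δ, ?_, ?_⟩
      · simp only [Set.mem_Iio]; omega
      · simp [gradSeq, GSA.grads]
  · refine Submodule.span_le.2 ?_
    rintro v ⟨i, hi, rfl⟩
    simp only [Set.mem_Iio] at hi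
    unfold gradSeq
    split_ifs with h
    · exact G.start_mem f x₀ n
    · exact G.gradient_mem f x₀ (by omega)

include hδ in
-- `V_n` is spanned by the earlier Gram-Schmidt vectors, which are orthogonal, so the projection
-- onto it is the sum of the projections onto their lines. No linear independence is needed.
lemma GSA.candidate_eq_gramSchmidt (n : ℕ) : G.candidate f x₀ n =
    InnerProductSpace.gramSchmidt ℝ (gradSeq δ x₀ (G.grads f x₀)) (n + δ) := by
  set s := gradSeq δ x₀ (G.grads f x₀) with hs
  have hsn : s (n + δ) = gradient f (G.point f x₀ n) := by simp [hs, gradSeq, GSA.grads]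
  have hV : G.evalSpace f x₀ n =
      Submodule.span ℝ (InnerProductSpace.gramSchmidt ℝ s '' Set.Iio (n + δ)) := by
    rw [G.evalSpace_eq_span f x₀ hδ, InnerProductSpace.span_gramSchmidt_Iio]
  rw [GSA.candidate, ← hsn]
  have h1 := InnerProductSpace.gramSchmidt_def' ℝ s (n + δ)
  have h2 : (G.evalSpace f x₀ n).starProjection (s (n + δ)) =
      ∑ i ∈ Finset.Iio (n + δ), (ℝ ∙ InnerProductSpace.gramSchmidt ℝ s i).starProjection
        (s (n + δ)) := by
    refine Submodule.eq_starProjection_of_mem_of_inner_eq_zero ?_ ?_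
    · refine Submodule.sum_mem _ fun i hi => ?_
      rw [hV]
      have hmem : InnerProductSpace.gramSchmidt ℝ s i ∈
          Submodule.span ℝ (InnerProductSpace.gramSchmidt ℝ s '' Set.Iio (n + δ)) :=
        Submodule.subset_span ⟨i, Finset.mem_Iio.1 hi, rfl⟩
      exact (Submodule.span_singleton_le_iff_mem _ _).2 hmem
        (Submodule.starProjection_apply_mem _ _)
    · intro w hw
      rw [← InnerProductSpace.gramSchmidt_def]
      rw [hV] at hw
      induction hw using Submodule.span_induction with
      | mem w hw =>
        obtain ⟨i, hi, rfl⟩ := hw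
        exact InnerProductSpace.gramSchmidt_orthogonal ℝ s (Set.mem_Iio.1 hi).ne'
      | zero => simp
      | add a b _ _ ha hb => rw [inner_add_right, ha, hb, add_zero]
      | smul c a _ ha => rw [inner_smul_right, ha, mul_zero]
  rw [h2, ← InnerProductSpace.gramSchmidt_def]

/-- The first `n` gradients enlarge the span. -/
def GSA.FullRank (n : ℕ) : Prop := ∀ k < n, G.candidate f x₀ k ≠ 0

variable {G f x₀}

include hδ in
-- When no vector is skipped, the list is an initial segment of one fixed sequence, so an index
-- denotes the same direction for all `m`. This is why limits are formulated with `gsVec`.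
lemma GSA.FullRank.basisList_eq {n : ℕ} (h : G.FullRank f x₀ n) {m : ℕ} (hm : m ≤ n) :
    G.basisList f x₀ m = (List.range (m + δ)).map (gsVec δ x₀ (G.grads f x₀)) := by
  induction m with
  | zero =>
    by_cases hx : x₀ = 0
    · simp [GSA.basisList, hx, hδ]
    · have hδ1 : δ = 1 := by simp [hδ, hx]
      subst hδ1
      have h0 : InnerProductSpace.gramSchmidt ℝ (gradSeq 1 x₀ (G.grads f x₀)) 0 = x₀ := by
        rw [InnerProductSpace.gramSchmidt_def]
        simp [gradSeq]
      simp [GSA.basisList, hx, gsVec, InnerProductSpace.gramSchmidtNormed, h0]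
  | succ m ih =>
    rw [GSA.basisList, if_neg (h m (by omega)), ih (by omega),
      show m + 1 + δ = m + δ + 1 by ring, List.range_succ, List.map_append]
    simp [gsVec, InnerProductSpace.gramSchmidtNormed, G.candidate_eq_gramSchmidt f x₀ hδ]

include hδ in
lemma GSA.FullRank.dim_eq {n : ℕ} (h : G.FullRank f x₀ n) {m : ℕ} (hm : m ≤ n) :
    G.dim f x₀ m = m + δ := by
  rw [← G.length_basisList, h.basisList_eq hδ hm]
  simp

include hδ in
lemma GSA.FullRank.basisVec_eq {n : ℕ} (h : G.FullRank f x₀ n) {m i : ℕ} (hm : m ≤ n)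
    (hi : i < m + δ) : G.basisVec f x₀ m i = gsVec δ x₀ (G.grads f x₀) i := by
  rw [GSA.basisVec, h.basisList_eq hδ hm]
  simp [List.getD, hi]

include hδ in
lemma GSA.FullRank.orthonormal {n : ℕ} (h : G.FullRank f x₀ n) :
    Orthonormal ℝ fun i : Fin (n + δ) => gsVec δ x₀ (G.grads f x₀) i := by
  obtain ⟨d, u, hl, hu, hs⟩ := G.basisList_eq_ofFn f x₀ n
  have hd : d = n + δ := by
    rw [← h.dim_eq hδ le_rfl, ← G.length_basisList, hl, List.length_ofFn]
  subst hd
  convert hu using 2 with i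
  rw [← h.basisVec_eq hδ le_rfl i.isLt, GSA.basisVec, hl]
  simp

include hδ in
lemma GSA.FullRank.span_eq {n : ℕ} (h : G.FullRank f x₀ n) :
    Submodule.span ℝ (Set.range fun i : Fin (n + δ) => gsVec δ x₀ (G.grads f x₀) i) =
      G.evalSpace f x₀ n := by
  obtain ⟨d, u, hl, hu, hs⟩ := G.basisList_eq_ofFn f x₀ n
  have hd : d = n + δ := by
    rw [← h.dim_eq hδ le_rfl, ← G.length_basisList, hl, List.length_ofFn]
  subst hd
  rw [← hs]
  congr 2
  ext1 i
  rw [← h.basisVec_eq hδ le_rfl i.isLt, GSA.basisVec, hl]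
  simp

include hδ in
-- This holds without a rank assumption: a zero candidate is normalized to zero on both sides.
lemma GSA.gsVec_add_delta (k : ℕ) : gsVec δ x₀ (G.grads f x₀) (k + δ) =
    ‖G.candidate f x₀ k‖⁻¹ • G.candidate f x₀ k := by
  rw [gsVec, InnerProductSpace.gramSchmidtNormed, G.candidate_eq_gramSchmidt f x₀ hδ]
  rfl

include hδ in
/-- The component of the gradient in the new direction. -/
lemma GSA.inner_grads_gsVec (k : ℕ) :
    inner ℝ (G.grads f x₀ k) (gsVec δ x₀ (G.grads f x₀) (k + δ)) = ‖G.candidate f x₀ k‖ := by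
  have h1 : G.grads f x₀ k = (G.evalSpace f x₀ k).starProjection (G.grads f x₀ k) +
      G.candidate f x₀ k := by rw [GSA.candidate, GSA.grads]; abel
  have h2 : inner ℝ (G.grads f x₀ k) (G.candidate f x₀ k) = ‖G.candidate f x₀ k‖ ^ 2 := by
    conv_lhs => rw [h1]
    rw [inner_add_left, (Submodule.mem_orthogonal _ _).1 (G.candidate_mem f x₀ k) _
      (Submodule.starProjection_apply_mem _ _), zero_add, real_inner_self_eq_norm_sq]
  rw [G.gsVec_add_delta hδ, inner_smul_right, h2]
  by_cases h0 : ‖G.candidate f x₀ k‖ = 0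
  · rw [h0]; simp
  · field_simp

include hδ in
/-- Later Gram-Schmidt vectors are orthogonal to `V_k`. -/
lemma GSA.inner_gsVec_eq_zero {k i : ℕ} {x : Eucl N}
    (hx : x ∈ G.evalSpace f x₀ k) (hk : k + δ ≤ i) :
    inner ℝ x (gsVec δ x₀ (G.grads f x₀) i) = 0 := by
  obtain ⟨j, rfl⟩ : ∃ j, i = j + δ := ⟨i - δ, by omega⟩
  rw [G.gsVec_add_delta hδ, inner_smul_right, (Submodule.mem_orthogonal _ _).1
    (G.candidate_mem f x₀ j) _ (G.evalSpace_mono f x₀ (by omega : k ≤ j) hx), mul_zero]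

include hδ in
lemma GSA.FullRank.inner_eq_sum {n : ℕ} (h : G.FullRank f x₀ n) {x y : Eucl N}
    (hx : x ∈ G.evalSpace f x₀ n) (hy : y ∈ G.evalSpace f x₀ n) :
    inner ℝ x y = ∑ i ∈ Finset.range (n + δ),
      inner ℝ x (gsVec δ x₀ (G.grads f x₀) i) * inner ℝ y (gsVec δ x₀ (G.grads f x₀) i) := by
  rw [Finset.sum_range]
  rw [← h.span_eq hδ] at hx hy
  exact inner_eq_sum_of_mem_span (h.orthonormal hδ) hx hy

end Algorithm

/-! ### Regression for jets -/

section JetRegression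

attribute [local irreducible] jetKernel jetMean

section Gram

variable {κ : ℝ → ℝ → ℝ → ℝ} {ι : Type*} [Fintype ι] [DecidableEq ι]

section Definitions

variable {E : Type*} [NormedAddCommGroup E] [InnerProductSpace ℝ E]

/-- The Gram matrix of a family of jets. -/
noncomputable def jetGram (κ : ℝ → ℝ → ℝ → ℝ) (J : ι → Jet E) : Matrix ι ι ℝ :=
  Matrix.of fun i j => jetKernel κ (J i) (J j)

/-- The coefficients of the regression of the jet `T` on the family `J`. -/
noncomputable def jetCoef (κ : ℝ → ℝ → ℝ → ℝ) (J : ι → Jet E) (T : Jet E) : ι → ℝ :=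
  (jetGram κ J)⁻¹.mulVec fun i => jetKernel κ (J i) T

/-- The normal equations. -/
lemma sum_jetCoef {J : ι → Jet E} (hJ : (jetGram κ J).det ≠ 0) (T : Jet E) (i : ι) :
    ∑ j, jetKernel κ (J i) (J j) * jetCoef κ J T j = jetKernel κ (J i) T := by
  have h : (jetGram κ J).mulVec (jetCoef κ J T) = fun i => jetKernel κ (J i) T := by
    rw [jetCoef, Matrix.mulVec_mulVec, Matrix.mul_nonsing_inv _ (isUnit_iff_ne_zero.2 hJ),
      Matrix.one_mulVec]
  exact congrFun h i

/-- The adjugate formula shows that the coefficients are measurable functions of the kernel values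
everywhere and continuous where the determinant is nonzero. -/
lemma jetCoef_apply (J : ι → Jet E) (T : Jet E) (i : ι) : jetCoef κ J T i =
    ∑ j, ((jetGram κ J).det⁻¹ * (jetGram κ J).adjugate i j) * jetKernel κ (J j) T := by
  rw [jetCoef, Matrix.inv_def, Ring.inverse_eq_inv']
  rfl

lemma tendsto_jetCoef {A : Type*} {l : Filter A} {J : A → ι → Jet E} {T : A → Jet E}
    {J₀ : ι → Jet E} {T₀ : Jet E}
    (hJ : ∀ i j, Tendsto (fun a => jetKernel κ (J a i) (J a j)) l (𝓝 (jetKernel κ (J₀ i) (J₀ j))))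
    (hT : ∀ i, Tendsto (fun a => jetKernel κ (J a i) (T a)) l (𝓝 (jetKernel κ (J₀ i) T₀)))
    (h0 : (jetGram κ J₀).det ≠ 0) (i : ι) :
    Tendsto (fun a => jetCoef κ (J a) (T a) i) l (𝓝 (jetCoef κ J₀ T₀ i)) := by
  have hM : Tendsto (fun a => jetGram κ (J a)) l (𝓝 (jetGram κ J₀)) :=
    tendsto_pi_nhds.2 fun i => tendsto_pi_nhds.2 fun j => hJ i j
  have hd := (Continuous.matrix_det (continuous_id (X := Matrix ι ι ℝ))).tendsto _ |>.comp hM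
  have ha := (Continuous.matrix_adjugate (continuous_id (X := Matrix ι ι ℝ))).tendsto _ |>.comp hM
  simp_rw [jetCoef_apply]
  refine tendsto_finsetSum _ fun j _ => ((hd.inv₀ h0).mul ?_).mul (hT j)
  exact tendsto_pi_nhds.1 (tendsto_pi_nhds.1 ha i) j

lemma measurable_jetCoef {A : Type*} [MeasurableSpace A] {J : A → ι → Jet E} {T : A → Jet E}
    (hJ : ∀ i j, Measurable fun a => jetKernel κ (J a i) (J a j))
    (hT : ∀ i, Measurable fun a => jetKernel κ (J a i) (T a)) (i : ι) :
    Measurable fun a => jetCoef κ (J a) (T a) i := by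
  have hM : Measurable fun a => (fun i j => jetKernel κ (J a i) (J a j) : ι → ι → ℝ) :=
    measurable_pi_lambda _ fun i => measurable_pi_lambda _ fun j => hJ i j
  have hdc : Continuous fun M : ι → ι → ℝ => Matrix.det (Matrix.of M) :=
    Continuous.matrix_det continuous_id
  have hac : ∀ j, Continuous fun M : ι → ι → ℝ => (Matrix.of M).adjugate i j := fun j =>
    (Continuous.matrix_adjugate continuous_id).matrix_elem i j
  have hd : Measurable fun a => (jetGram κ (J a)).det := hdc.measurable.comp hM
  have ha : ∀ j, Measurable fun a => (jetGram κ (J a)).adjugate i j := fun j =>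
    (hac j).measurable.comp hM
  simp_rw [jetCoef_apply]
  exact Finset.measurable_sum _ fun j _ => (hd.inv.mul (ha j)).mul (hT j)

end Definitions

end Gram

namespace IsSmoothKernel

variable {κ : ℝ → ℝ → ℝ → ℝ} {N p : ℕ}

lemma continuous_comp (hκ : IsSmoothKernel κ N) {A : Type*} [TopologicalSpace A]
    {x y v w : A → Eucl N} {a b : A → ℝ} (hx : Continuous x) (ha : Continuous a)
    (hv : Continuous v) (hy : Continuous y) (hb : Continuous b) (hw : Continuous w) :
    Continuous fun t => jetKernel κ (⟨x t, a t, v t⟩ : Jet (Eucl N)) ⟨y t, b t, w t⟩ := by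
  have h : Continuous fun t => ((x t, a t, v t), (y t, b t, w t)) := by fun_prop
  have h2 := hκ.continuous.comp h
  exact h2

/-- Kernels can be restricted to subspaces. -/
lemma restrict (hκ : IsSmoothKernel κ N) (U : Eucl p →ₗᵢ[ℝ] Eucl N) : IsSmoothKernel κ p where
  comm J J' := by
    rw [← jetKernel_map κ U, hκ.comm, jetKernel_map]
  add_left x a a' v v' J := by
    simp_rw [← jetKernel_map κ U]
    simpa [Jet.map] using hκ.add_left (U x) a a' (U v) (U v') (J.map U)
  smul_left x c a v J := by
    simp_rw [← jetKernel_map κ U]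
    simpa [Jet.map] using hκ.smul_left (U x) c a (U v) (J.map U)
  continuous := by
    simp_rw [← jetKernel_map κ U]
    have hU : Continuous U := U.continuous
    exact hκ.continuous_comp (by fun_prop) (by fun_prop) (by fun_prop) (by fun_prop) (by fun_prop)
      (by fun_prop)
  nonneg n J := by
    simp_rw [← jetKernel_map κ U]
    exact hκ.nonneg n fun k => (J k).map U
  pos n J hJ h k := by
    simp_rw [← jetKernel_map κ U] at h
    have h1 := hκ.pos n (fun k => (J k).map U)
      (fun a b hab => hJ (U.injective hab)) h k
    exact ⟨h1.1, U.injective (h1.2.trans (map_zero U).symm)⟩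

lemma add_right (hκ : IsSmoothKernel κ N) (x : Eucl N) (a a' : ℝ) (v v' : Eucl N)
    (J : Jet (Eucl N)) : jetKernel κ J ⟨x, a + a', v + v'⟩ =
      jetKernel κ J ⟨x, a, v⟩ + jetKernel κ J ⟨x, a', v'⟩ := by
  rw [hκ.comm, hκ.add_left, hκ.comm, hκ.comm J ⟨x, a', v'⟩]

lemma smul_right (hκ : IsSmoothKernel κ N) (x : Eucl N) (c a : ℝ) (v : Eucl N)
    (J : Jet (Eucl N)) : jetKernel κ J ⟨x, c * a, c • v⟩ = c * jetKernel κ J ⟨x, a, v⟩ := by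
  rw [hκ.comm, hκ.smul_left, hκ.comm]

lemma dir_smul_left (hκ : IsSmoothKernel κ N) (x : Eucl N) (c : ℝ) (v : Eucl N)
    (J : Jet (Eucl N)) : jetKernel κ ⟨x, 0, c • v⟩ J = c * jetKernel κ ⟨x, 0, v⟩ J := by
  rw [← hκ.smul_left, mul_zero]

lemma dir_smul_right (hκ : IsSmoothKernel κ N) (x : Eucl N) (c : ℝ) (v : Eucl N)
    (J : Jet (Eucl N)) : jetKernel κ J ⟨x, 0, c • v⟩ = c * jetKernel κ J ⟨x, 0, v⟩ := by
  rw [← hκ.smul_right, mul_zero]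

/-- Derivatives in a direction orthogonal to all other data are uncorrelated with these. -/
lemma orthogonal (hκ : IsSmoothKernel κ N) {x y v w : Eucl N} (a : ℝ) (hx : inner ℝ w x = 0)
    (hy : inner ℝ w y = 0) (hv : inner ℝ w v = 0) :
    jetKernel κ (⟨x, a, v⟩ : Jet (Eucl N)) ⟨y, 0, w⟩ = 0 := by
  -- The reflection in the hyperplane orthogonal to `w` fixes all other data and reverses `w`; by
  -- invariance and linearity the kernel equals its own negative.
  have hfix : ∀ z : Eucl N, inner ℝ w z = 0 → (ℝ ∙ w)ᗮ.reflection z = z := fun z hz =>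
    Submodule.reflection_mem_subspace_eq_self (Submodule.mem_orthogonal_singleton_iff_inner_right.2 hz)
  have h := jetKernel_map κ (ℝ ∙ w)ᗮ.reflection.toLinearIsometry
    (⟨x, a, v⟩ : Jet (Eucl N)) ⟨y, 0, w⟩
  simp only [Jet.map, LinearIsometryEquiv.coe_toLinearIsometry, hfix x hx, hfix y hy, hfix v hv,
    Submodule.reflection_orthogonalComplement_singleton_eq_neg] at h
  have h2 := hκ.dir_smul_right y (-1) w ⟨x, a, v⟩
  rw [neg_one_smul, h] at h2
  linarith

end IsSmoothKernel

/-! ### Regression on coordinate jets and on normal derivatives -/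

section Comb

variable {p : ℕ}

/-- The combination of the coordinate jets at a point. -/
noncomputable def jetComb (x : Eucl p) (A : Option (Fin p) → ℝ) : Jet (Eucl p) :=
  ⟨x, A none, WithLp.toLp 2 fun i => A (some i)⟩

variable {κ : ℝ → ℝ → ℝ → ℝ}

namespace IsSmoothKernel

lemma comb_left (hκ : IsSmoothKernel κ p) (x : Eucl p) (A : Option (Fin p) → ℝ)
    (J : Jet (Eucl p)) :
    jetKernel κ (jetComb x A) J = ∑ o, A o * jetKernel κ (coordJet x o) J := by
  let L : ℝ × Eucl p →ₗ[ℝ] ℝ :=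
    { toFun := fun q => jetKernel κ ⟨x, q.1, q.2⟩ J
      map_add' := fun q q' => hκ.add_left x _ _ _ _ J
      map_smul' := fun c q => hκ.smul_left x c _ _ J }
  have h : ((A none, WithLp.toLp 2 fun i => A (some i)) : ℝ × Eucl p) =
      A none • ((1, 0) : ℝ × Eucl p) +
        ∑ i, A (some i) • ((0, EuclideanSpace.single i 1) : ℝ × Eucl p) := by
    ext j
    · simp [Prod.fst_sum]
    · simp [Prod.snd_sum, Finset.sum_apply, Pi.single_apply]
  change L (A none, WithLp.toLp 2 fun i => A (some i)) = _
  rw [h, map_add, map_smul, map_sum, Fintype.sum_option]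
  simp only [map_smul, smul_eq_mul]
  rfl

lemma comb_comb (hκ : IsSmoothKernel κ p) (x y : Eucl p) (A B : Option (Fin p) → ℝ) :
    jetKernel κ (jetComb x A) (jetComb y B) =
      ∑ o, ∑ o', A o * B o' * jetKernel κ (coordJet x o) (coordJet y o') := by
  rw [hκ.comb_left]
  refine Finset.sum_congr rfl fun o _ => ?_
  rw [hκ.comm, hκ.comb_left, Finset.mul_sum]
  refine Finset.sum_congr rfl fun o' _ => ?_
  rw [hκ.comm]
  ring

end IsSmoothKernel

/-- The coordinate jets at several points. -/
noncomputable def coordJets {n : ℕ} (c : Fin n → Eucl p) (q : Fin n × Option (Fin p)) :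
    Jet (Eucl p) := coordJet (c q.1) q.2

/-- The embedding as a coordinate hyperplane. -/
noncomputable def hyperplaneEmbedding (p : ℕ) : Eucl p →ₗᵢ[ℝ] Eucl (p + 1) :=
  isometryOfSystem (w := fun i : Fin p => (EuclideanSpace.single i.castSucc 1 : Eucl (p + 1)))
    ((EuclideanSpace.orthonormal_single (𝕜 := ℝ) (ι := Fin (p + 1))).comp _
      (Fin.castSucc_injective p))

/-- The derivative in the direction normal to the hyperplane. -/
noncomputable def normalJet (x : Eucl p) : Jet (Eucl (p + 1)) :=
  ⟨hyperplaneEmbedding p x, 0, EuclideanSpace.single (Fin.last p) 1⟩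

/-- The coefficients of the regression of the last normal derivative on the others. -/
noncomputable def normalCoef (κ : ℝ → ℝ → ℝ → ℝ) {n : ℕ} (c : Fin (n + 1) → Eucl p) :
    Fin n → ℝ :=
  jetCoef κ (fun k : Fin n => normalJet (c k.castSucc)) (normalJet (c (Fin.last n)))

/-- The residual variance of the regression of the last normal derivative on the others. -/
noncomputable def normalVar (κ : ℝ → ℝ → ℝ → ℝ) {n : ℕ} (c : Fin (n + 1) → Eucl p) : ℝ :=
  jetKernel κ (normalJet (c (Fin.last n))) (normalJet (c (Fin.last n))) -
    ∑ k : Fin n, normalCoef κ c k *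
      jetKernel κ (normalJet (c k.castSucc)) (normalJet (c (Fin.last n)))

/-- The best prediction of the observations at the last point from the observations at the other
points. -/
noncomputable def prediction (μ : ℝ → ℝ) (κ : ℝ → ℝ → ℝ → ℝ) {n : ℕ} (c : Fin (n + 1) → Eucl p)
    (data : Fin n → Option (Fin p) → ℝ) (o : Option (Fin p)) : ℝ :=
  jetMean μ (coordJet (c (Fin.last n)) o) +
    ∑ q : Fin n × Option (Fin p),
      jetCoef κ (coordJets fun k : Fin n => c k.castSucc) (coordJet (c (Fin.last n)) o) q *
        (data q.1 q.2 - jetMean μ (coordJet (c q.1.castSucc) q.2))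

namespace IsSmoothKernel

/-- A null vector of the Gram matrix, grouped by points, gives one jet per point with total variance
zero. Strict positive definiteness at distinct points forces it to vanish. -/
lemma det_coordJets_ne_zero (hκ : IsSmoothKernel κ p) {n : ℕ} {c : Fin n → Eucl p}
    (hc : Function.Injective c) : (jetGram κ (coordJets c)).det ≠ 0 := by
  intro h0
  obtain ⟨v, hv, hMv⟩ := Matrix.exists_mulVec_eq_zero_iff.2 h0
  refine hv (funext fun q => ?_)
  have h := hκ.pos n (fun k => jetComb (c k) fun o => v (k, o)) hc ?_ q.1
  · obtain ⟨k, o⟩ := q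
    cases o with
    | none => exact h.1
    | some i => exact congrArg (fun z : Eucl p => z i) h.2
  · simp_rw [hκ.comb_comb]
    have h1 : ∑ q, v q * (jetGram κ (coordJets c)).mulVec v q = 0 := by simp [hMv]
    rw [← h1, Fintype.sum_prod_type]
    refine Finset.sum_congr rfl fun k _ => ?_
    rw [Finset.sum_comm]
    refine Finset.sum_congr rfl fun o _ => ?_
    rw [Matrix.mulVec, dotProduct, Fintype.sum_prod_type, Finset.mul_sum]
    refine Finset.sum_congr rfl fun l _ => ?_
    rw [Finset.mul_sum]
    refine Finset.sum_congr rfl fun o' _ => ?_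
    simp only [jetGram, Matrix.of_apply, coordJets]
    ring

lemma normalJet_comb (hκ : IsSmoothKernel κ (p + 1)) {n : ℕ} (c : Fin n → Eucl p) (β : Fin n → ℝ)
    (k l : Fin n) : jetKernel κ
      (⟨hyperplaneEmbedding p (c k), 0, β k • EuclideanSpace.single (Fin.last p) 1⟩ :
        Jet (Eucl (p + 1)))
      ⟨hyperplaneEmbedding p (c l), 0, β l • EuclideanSpace.single (Fin.last p) 1⟩ =
      β k * β l * jetKernel κ (normalJet (c k)) (normalJet (c l)) := by
  rw [hκ.dir_smul_left, hκ.dir_smul_right, mul_assoc]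
  rfl

/-- The embedded points stay distinct, so the jets with directions `β k` times the last basis vector
are all zero by strict positive definiteness in dimension `p + 1`. -/
lemma eq_zero_of_normalJets (hκ : IsSmoothKernel κ (p + 1)) {n : ℕ} {c : Fin n → Eucl p}
    (hc : Function.Injective c) {β : Fin n → ℝ}
    (h : ∑ k, ∑ l, β k * β l * jetKernel κ (normalJet (c k)) (normalJet (c l)) = 0) : β = 0 := by
  simp_rw [← hκ.normalJet_comb c β] at h
  ext k
  have h1 := (hκ.pos n _ (fun a b hab => hc ((hyperplaneEmbedding p).injective hab)) h k).2
  have h2 := congrArg (fun z : Eucl (p + 1) => z (Fin.last p)) h1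
  simpa using h2

lemma det_normalJets_ne_zero (hκ : IsSmoothKernel κ (p + 1)) {n : ℕ} {c : Fin n → Eucl p}
    (hc : Function.Injective c) : (jetGram κ fun k => normalJet (c k)).det ≠ 0 := by
  intro h0
  obtain ⟨v, hv, hMv⟩ := Matrix.exists_mulVec_eq_zero_iff.2 h0
  refine hv (hκ.eq_zero_of_normalJets hc ?_)
  have h1 : ∑ k, v k * (jetGram κ fun k => normalJet (c k)).mulVec v k = 0 := by simp [hMv]
  rw [← h1]
  refine Finset.sum_congr rfl fun k _ => ?_
  rw [Matrix.mulVec, dotProduct, Finset.mul_sum]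
  refine Finset.sum_congr rfl fun l _ => ?_
  simp only [jetGram, Matrix.of_apply]
  ring

/-- The coefficients of the residual. -/
noncomputable def _root_.residualCoef {n : ℕ} (b : Fin n → ℝ) : Fin (n + 1) → ℝ :=
  Fin.snoc (fun k => - b k) 1

/-- The normal equations, read as orthogonality of the residual to the earlier normal derivatives.
-/
lemma sum_residualCoef_normalJet (hκ : IsSmoothKernel κ (p + 1)) {n : ℕ}
    {c : Fin (n + 1) → Eucl p} (hc : Function.Injective c) (l : Fin n) :
    ∑ k, residualCoef (normalCoef κ c) k *
      jetKernel κ (normalJet (c k)) (normalJet (c l.castSucc)) = 0 := by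
  have h := sum_jetCoef (J := fun k : Fin n => normalJet (c k.castSucc))
    (hκ.det_normalJets_ne_zero (hc.comp (Fin.castSucc_injective n))) (normalJet (c (Fin.last n))) l
  rw [Fin.sum_univ_castSucc]
  simp only [residualCoef, Fin.snoc_castSucc, Fin.snoc_last, one_mul]
  rw [hκ.comm (normalJet (c (Fin.last n))), ← h, ← Finset.sum_add_distrib]
  refine Finset.sum_eq_zero fun k _ => ?_
  rw [hκ.comm (normalJet (c k.castSucc)), normalCoef]
  ring

lemma sum_residualCoef_last {n : ℕ} {c : Fin (n + 1) → Eucl p} :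
    ∑ k, residualCoef (normalCoef κ c) k *
      jetKernel κ (normalJet (c k)) (normalJet (c (Fin.last n))) = normalVar κ c := by
  rw [Fin.sum_univ_castSucc, normalVar]
  simp only [residualCoef, Fin.snoc_castSucc, Fin.snoc_last, one_mul, neg_mul,
    Finset.sum_neg_distrib]
  ring

/-- The residual is orthogonal to the earlier normal derivatives, so its variance is its covariance
with the last one. -/
lemma normalVar_eq (hκ : IsSmoothKernel κ (p + 1)) {n : ℕ}
    {c : Fin (n + 1) → Eucl p} (hc : Function.Injective c) :
    ∑ k, ∑ l, residualCoef (normalCoef κ c) k * residualCoef (normalCoef κ c) l *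
      jetKernel κ (normalJet (c k)) (normalJet (c l)) = normalVar κ c := by
  rw [Finset.sum_comm, Fin.sum_univ_castSucc, Finset.sum_eq_zero, zero_add,
    ← sum_residualCoef_last (κ := κ)]
  · refine Finset.sum_congr rfl fun k _ => ?_
    simp [residualCoef]
  · intro l _
    rw [← mul_zero (residualCoef (normalCoef κ c) l.castSucc),
      ← hκ.sum_residualCoef_normalJet hc l, Finset.mul_sum]
    refine Finset.sum_congr rfl fun k _ => ?_
    ring

/-- The residual variance is positive at distinct points. -/
lemma normalVar_pos (hκ : IsSmoothKernel κ (p + 1)) {n : ℕ}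
    {c : Fin (n + 1) → Eucl p} (hc : Function.Injective c) : 0 < normalVar κ c := by
  have h := hκ.normalVar_eq hc
  refine lt_of_le_of_ne ?_ fun h0 => ?_
  · rw [← h]
    simp_rw [← hκ.normalJet_comb c (residualCoef (normalCoef κ c))]
    exact hκ.nonneg _ _
  -- A residual of variance zero would have vanishing coefficients, but the last coefficient is one.
  · rw [← h0] at h
    have h1 := congrFun (hκ.eq_zero_of_normalJets hc h) (Fin.last n)
    simp [residualCoef] at h1

lemma continuous_coordJets (hκ : IsSmoothKernel κ p) {n : ℕ} (k l : Fin n)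
    (o o' : Option (Fin p)) : Continuous fun c : Fin n → Eucl p =>
      jetKernel κ (coordJet (c k) o) (coordJet (c l) o') := by
  have h : ∀ (a a' : ℝ) (v v' : Eucl p), Continuous fun c : Fin n → Eucl p =>
      jetKernel κ (⟨c k, a, v⟩ : Jet (Eucl p)) ⟨c l, a', v'⟩ := fun a a' v v' =>
    hκ.continuous_comp (continuous_apply k) continuous_const continuous_const (continuous_apply l)
      continuous_const continuous_const
  cases o <;> cases o' <;> exact h _ _ _ _

lemma continuous_normalJets (hκ : IsSmoothKernel κ (p + 1)) {n : ℕ} (k l : Fin n) :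
    Continuous fun c : Fin n → Eucl p => jetKernel κ (normalJet (c k)) (normalJet (c l)) := by
  have hU := (hyperplaneEmbedding p).continuous
  exact hκ.continuous_comp (hU.comp (continuous_apply k)) continuous_const continuous_const
    (hU.comp (continuous_apply l)) continuous_const continuous_const

lemma measurable_normalCoef (hκ : IsSmoothKernel κ (p + 1)) {n : ℕ} (k : Fin n) :
    Measurable fun c : Fin (n + 1) → Eucl p => normalCoef κ c k :=
  measurable_jetCoef (fun _ _ => (hκ.continuous_normalJets _ _).measurable)
    (fun _ => (hκ.continuous_normalJets _ _).measurable) k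

lemma measurable_normalVar (hκ : IsSmoothKernel κ (p + 1)) {n : ℕ} :
    Measurable fun c : Fin (n + 1) → Eucl p => normalVar κ c :=
  (hκ.continuous_normalJets _ _).measurable.sub (Finset.measurable_sum _ fun k _ =>
    (hκ.measurable_normalCoef k).mul (hκ.continuous_normalJets _ _).measurable)

/-- Only the limiting points have to be distinct: the Gram matrix is continuous, and its inversion
is continuous at a nonsingular limit. -/
lemma tendsto_normalVar (hκ : IsSmoothKernel κ (p + 1)) {n : ℕ} {A : Type*} {l : Filter A}
    {c : A → Fin (n + 1) → Eucl p} {c₀ : Fin (n + 1) → Eucl p} (hc : Tendsto c l (𝓝 c₀))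
    (h0 : Function.Injective c₀) :
    Tendsto (fun a => normalVar κ (c a)) l (𝓝 (normalVar κ c₀)) := by
  have hk : ∀ k l', Tendsto (fun a => jetKernel κ (normalJet (c a k)) (normalJet (c a l'))) l
      (𝓝 (jetKernel κ (normalJet (c₀ k)) (normalJet (c₀ l')))) := fun k l' =>
    ((hκ.continuous_normalJets k l').tendsto c₀).comp hc
  refine (hk _ _).sub (tendsto_finsetSum _ fun k _ => (tendsto_jetCoef (fun i j => hk _ _)
    (fun i => hk _ _) (hκ.det_normalJets_ne_zero (c := fun k : Fin n => c₀ k.castSucc)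
      (h0.comp (Fin.castSucc_injective n))) k).mul
    (hk _ _))

lemma tendsto_prediction (hκ : IsSmoothKernel κ p) {μ : ℝ → ℝ} (hμ : ContDiff ℝ 1 μ) {n : ℕ}
    {A : Type*} {l : Filter A} {c : A → Fin (n + 1) → Eucl p} {c₀ : Fin (n + 1) → Eucl p}
    (hc : Tendsto c l (𝓝 c₀)) (h0 : Function.Injective c₀)
    {data : A → Fin n → Option (Fin p) → ℝ} {data₀ : Fin n → Option (Fin p) → ℝ}
    (hdata : ∀ k o, Tendsto (fun a => data a k o) l (𝓝 (data₀ k o))) (o : Option (Fin p)) :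
    Tendsto (fun a => prediction μ κ (c a) (data a) o) l (𝓝 (prediction μ κ c₀ data₀ o)) := by
  have hk : ∀ k l' o o', Tendsto (fun a => jetKernel κ (coordJet (c a k) o) (coordJet (c a l') o'))
      l (𝓝 (jetKernel κ (coordJet (c₀ k) o) (coordJet (c₀ l') o'))) := fun k l' o o' =>
    ((hκ.continuous_coordJets k l' o o').tendsto c₀).comp hc
  have hm : ∀ k o, Tendsto (fun a => jetMean μ (coordJet (c a k) o)) l
      (𝓝 (jetMean μ (coordJet (c₀ k) o))) := fun k o => by
    have h1 := tendsto_pi_nhds.1 hc k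
    cases o
    · exact tendsto_jetMean hμ h1 tendsto_const_nhds tendsto_const_nhds
    · exact tendsto_jetMean hμ h1 tendsto_const_nhds tendsto_const_nhds
  refine (hm _ _).add (tendsto_finsetSum _ fun q _ => (tendsto_jetCoef (fun i j => hk _ _ _ _)
    (fun i => hk _ _ _ _)
    (hκ.det_coordJets_ne_zero (c := fun k : Fin n => c₀ k.castSucc)
      (h0.comp (Fin.castSucc_injective n))) q).mul
    ((hdata _ _).sub (hm _ _)))

end IsSmoothKernel

end Comb

end JetRegression

/-! ### Observations with respect to an orthonormal system -/

section Frame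

variable {N p : ℕ}

/-- The coordinates of a vector with respect to an orthonormal system. -/
noncomputable def frameCoord (v : Fin p → Eucl N) (x : Eucl N) : Eucl p :=
  WithLp.toLp 2 fun i => inner ℝ (v i) x

/-- The function value and the derivatives in the directions of the system. -/
noncomputable def frameObs (g : Eucl N → ℝ) (v : Fin p → Eucl N) (x : Eucl N) :
    Option (Fin p) → ℝ
  | none => g x
  | some i => inner ℝ (gradient g x) (v i)

/-- The jets that belong to `frameObs`. -/
def frameJet (v : Fin p → Eucl N) (x : Eucl N) : Option (Fin p) → Jet (Eucl N)
  | none => ⟨x, 1, 0⟩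
  | some i => ⟨x, 0, v i⟩

lemma frameJet_eval (v : Fin p → Eucl N) (x : Eucl N) (o : Option (Fin p)) (g : Eucl N → ℝ) :
    (frameJet v x o).eval g = frameObs g v x o := by
  cases o <;> simp [frameJet, Jet.eval, frameObs]

/-- The orthogonal projection to the complement of an orthonormal system. -/
noncomputable def frameCompl (v : Fin p → Eucl N) (x : Eucl N) : Eucl N :=
  x - ∑ i, inner ℝ (v i) x • v i

variable {v : Fin p → Eucl N}

lemma isometryOfSystem_frameCoord (hv : Orthonormal ℝ v) (x : Eucl N) :
    isometryOfSystem hv (frameCoord v x) = ∑ i, inner ℝ (v i) x • v i := by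
  rw [isometryOfSystem_apply]
  rfl

lemma isometryOfSystem_frameCoord_of_mem (hv : Orthonormal ℝ v) {x : Eucl N}
    (hx : x ∈ Submodule.span ℝ (Set.range v)) : isometryOfSystem hv (frameCoord v x) = x := by
  rw [isometryOfSystem_frameCoord, ← eq_sum_of_mem_span hv hx]

lemma inner_frameCompl (hv : Orthonormal ℝ v) (i : Fin p) (x : Eucl N) :
    inner ℝ (v i) (frameCompl v x) = 0 := by
  rw [frameCompl, inner_sub_right, hv.inner_right_fintype, sub_self]

lemma frameCompl_mem (hv : Orthonormal ℝ v) (x : Eucl N) :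
    frameCompl v x ∈ (Submodule.span ℝ (Set.range v))ᗮ := by
  rw [Submodule.mem_orthogonal]
  intro u hu
  induction hu using Submodule.span_induction with
  | mem u hu => obtain ⟨i, rfl⟩ := hu; exact inner_frameCompl hv i x
  | zero => simp
  | add a b _ _ ha hb => rw [inner_add_left, ha, hb, add_zero]
  | smul c a _ ha => rw [inner_smul_left, ha, mul_zero]

lemma frameCompl_add_sum (x : Eucl N) : x = ∑ i, inner ℝ (v i) x • v i + frameCompl v x := by
  rw [frameCompl]; abel

lemma frameCompl_eq (hv : Orthonormal ℝ v) (x : Eucl N) :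
    frameCompl v x = x - (Submodule.span ℝ (Set.range v)).starProjection x := by
  have h : (Submodule.span ℝ (Set.range v)).starProjection x = ∑ i, inner ℝ (v i) x • v i := by
    refine Submodule.eq_starProjection_of_mem_of_inner_eq_zero ?_ ?_
    · exact Submodule.sum_mem _ fun i _ => Submodule.smul_mem _ _ (Submodule.subset_span ⟨i, rfl⟩)
    · intro w hw
      exact (Submodule.mem_orthogonal' _ _).1 (frameCompl_mem hv x) w hw
  rw [h, frameCompl]

lemma inner_frameCompl_symm (x y : Eucl N) :
    inner ℝ x (frameCompl v y) = inner ℝ (frameCompl v x) y := by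
  simp only [frameCompl, inner_sub_right, inner_sub_left, inner_sum, sum_inner, inner_smul_right,
    inner_smul_left, conj_trivial]
  congr 1
  refine Finset.sum_congr rfl fun i _ => ?_
  rw [real_inner_comm x (v i)]
  ring

/-- Points in the span are images of their coordinates, so kernels between such jets can be computed
in the fixed dimension `p`. -/
lemma frameJet_eq_map (hv : Orthonormal ℝ v) {x : Eucl N}
    (hx : x ∈ Submodule.span ℝ (Set.range v)) (o : Option (Fin p)) :
    frameJet v x o = (coordJet (frameCoord v x) o).map (isometryOfSystem hv) := by
  cases o
  · simp [frameJet, coordJet, Jet.map, isometryOfSystem_frameCoord_of_mem hv hx]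
  · simp [frameJet, coordJet, Jet.map, isometryOfSystem_frameCoord_of_mem hv hx,
      isometryOfSystem_single]

variable {κ : ℝ → ℝ → ℝ → ℝ}

lemma inner_eq_zero_of_mem {w x : Eucl N} (hw : w ∈ (Submodule.span ℝ (Set.range v))ᗮ)
    (hx : x ∈ Submodule.span ℝ (Set.range v)) : inner ℝ w x = 0 :=
  (Submodule.mem_orthogonal' _ _).1 hw x hx

lemma frameJet_dir_mem (x : Eucl N) (o : Option (Fin p)) :
    (frameJet v x o).dir ∈ Submodule.span ℝ (Set.range v) := by
  cases o
  · exact Submodule.zero_mem _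
  · exact Submodule.subset_span ⟨_, rfl⟩

/-- The covariances with arbitrary jets reduce to those with the coordinate jets. -/
lemma jetKernel_frameJet (hall : ∀ M, IsSmoothKernel κ M) (hv : Orthonormal ℝ v) {x y : Eucl N}
    (hx : x ∈ Submodule.span ℝ (Set.range v)) (hy : y ∈ Submodule.span ℝ (Set.range v))
    (o : Option (Fin p)) (a : ℝ) (u : Eucl N) :
    jetKernel κ (frameJet v x o) ⟨y, a, u⟩ =
      ∑ o', Option.elim o' a (fun i => inner ℝ (v i) u) *
        jetKernel κ (coordJet (frameCoord v x) o) (coordJet (frameCoord v y) o') := by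
  -- The part of `u` normal to the system contributes nothing by the reflection argument; the
  -- tangential part comes from a jet in dimension `p`.
  have h0 : jetKernel κ (frameJet v x o) ⟨y, 0, frameCompl v u⟩ = 0 := by
    have hp : (frameJet v x o).point = x := by cases o <;> rfl
    have := (hall N).orthogonal (x := (frameJet v x o).point) (v := (frameJet v x o).dir)
      (y := y) (w := frameCompl v u) (frameJet v x o).value
      (by rw [hp]; exact inner_eq_zero_of_mem (frameCompl_mem hv u) hx)
      (inner_eq_zero_of_mem (frameCompl_mem hv u) hy)
      (inner_eq_zero_of_mem (frameCompl_mem hv u) (frameJet_dir_mem x o))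
    exact this
  have h1 : (⟨y, a, ∑ i, inner ℝ (v i) u • v i⟩ : Jet (Eucl N)) =
      (jetComb (frameCoord v y) fun o' => Option.elim o' a (fun i => inner ℝ (v i) u)).map
        (isometryOfSystem hv) := by
    rw [Jet.map, jetComb]
    simp only [Option.elim_none, Option.elim_some]
    rw [isometryOfSystem_frameCoord_of_mem hv hy, isometryOfSystem_apply]
  conv_lhs => rw [frameCompl_add_sum (v := v) u, ← add_zero a]
  rw [(hall N).add_right, h0, add_zero, h1, frameJet_eq_map hv hx, jetKernel_map, (hall p).comm,
    (hall p).comb_left]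
  refine Finset.sum_congr rfl fun o' _ => ?_
  rw [(hall p).comm]

lemma isometryOfSystem_snoc (hv : Orthonormal ℝ v) {w : Eucl N} (hw : ‖w‖ = 1)
    (h : ∀ i, inner ℝ (v i) w = 0) (x : Eucl p) :
    isometryOfSystem (orthonormal_snoc hv hw h) (hyperplaneEmbedding p x) =
      isometryOfSystem hv x := by
  rw [isometryOfSystem_apply hv, hyperplaneEmbedding,
    isometryOfSystem_apply (w := fun i : Fin p => EuclideanSpace.single i.castSucc 1), map_sum]
  refine Finset.sum_congr rfl fun i _ => ?_
  rw [map_smul, isometryOfSystem_single, Fin.snoc_castSucc]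

/-- The covariances of derivatives in directions normal to the system. -/
lemma jetKernel_normal (hall : ∀ M, IsSmoothKernel κ M) (hv : Orthonormal ℝ v) {x y w w' : Eucl N}
    (hx : x ∈ Submodule.span ℝ (Set.range v)) (hy : y ∈ Submodule.span ℝ (Set.range v))
    (hw : w ∈ (Submodule.span ℝ (Set.range v))ᗮ) (hw' : w' ∈ (Submodule.span ℝ (Set.range v))ᗮ) :
    jetKernel κ (⟨x, 0, w⟩ : Jet (Eucl N)) ⟨y, 0, w'⟩ = inner ℝ w w' *
      jetKernel κ (normalJet (frameCoord v x)) (normalJet (frameCoord v y)) := by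
  -- For a unit normal, append it to the system; the isometry from dimension `p + 1` carries the
  -- model normal derivatives to the given ones.
  have hunit : ∀ u ∈ (Submodule.span ℝ (Set.range v))ᗮ, ‖u‖ = 1 →
      jetKernel κ (⟨x, 0, u⟩ : Jet (Eucl N)) ⟨y, 0, u⟩ =
        jetKernel κ (normalJet (frameCoord v x)) (normalJet (frameCoord v y)) := by
    intro u hu hn
    have h0 : ∀ i, inner ℝ (v i) u = 0 := fun i =>
      (Submodule.mem_orthogonal _ _).1 hu _ (Submodule.subset_span ⟨i, rfl⟩)
    have hm : ∀ z ∈ Submodule.span ℝ (Set.range v), (⟨z, 0, u⟩ : Jet (Eucl N)) =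
        (normalJet (frameCoord v z)).map (isometryOfSystem (orthonormal_snoc hv hn h0)) := by
      intro z hz
      rw [Jet.map, normalJet]
      simp only
      rw [isometryOfSystem_snoc hv hn h0, isometryOfSystem_frameCoord_of_mem hv hz, isometryOfSystem_single,
        Fin.snoc_last]
    rw [hm x hx, hm y hy, jetKernel_map]
  by_cases h0 : w = 0
  · have h := (hall N).dir_smul_left x 0 0 ⟨y, 0, w'⟩
    rw [zero_smul, zero_mul] at h
    rw [h0, h, inner_zero_left, zero_mul]
  · have hn : ‖w‖ ≠ 0 := norm_ne_zero_iff.2 h0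
    set u := ‖w‖⁻¹ • w with hu
    have hu1 : ‖u‖ = 1 := by rw [hu, norm_smul, norm_inv, norm_norm, inv_mul_cancel₀ hn]
    have huV : u ∈ (Submodule.span ℝ (Set.range v))ᗮ := Submodule.smul_mem _ _ hw
    have hwu : w = ‖w‖ • u := by rw [hu, smul_smul, mul_inv_cancel₀ hn, one_smul]
    -- The remainder of `w'` is orthogonal to `x`, `y` and `u`, so its derivative is uncorrelated,
    -- and only the component along `u` counts.
    set z := w' - inner ℝ u w' • u with hz
    have hzV : z ∈ (Submodule.span ℝ (Set.range v))ᗮ :=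
      Submodule.sub_mem _ hw' (Submodule.smul_mem _ _ huV)
    have hzu : inner ℝ z u = 0 := by
      rw [hz, inner_sub_left, inner_smul_left, real_inner_self_eq_norm_sq, hu1,
        real_inner_comm u w']
      simp
    have hw'z : w' = inner ℝ u w' • u + z := by rw [hz]; abel
    have h1 : jetKernel κ (⟨x, 0, u⟩ : Jet (Eucl N)) ⟨y, 0, z⟩ = 0 :=
      (hall N).orthogonal 0 (inner_eq_zero_of_mem hzV hx) (inner_eq_zero_of_mem hzV hy) hzu
    have h2 := (hall N).add_right y 0 0 (inner ℝ u w' • u) z ⟨x, 0, u⟩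
    rw [add_zero, ← hw'z, h1, add_zero, (hall N).dir_smul_right, hunit u huV hu1] at h2
    conv_lhs => rw [hwu]
    have h3 : inner ℝ w w' = ‖w‖ * inner ℝ u w' := by
      conv_lhs => rw [hwu, inner_smul_left]
      rfl
    rw [(hall N).dir_smul_left, h2, h3, mul_assoc]

end Frame

/-! ### Innovations and normal residuals at fixed points -/

section Residual

variable {Ω : Type*} [MeasurableSpace Ω] {P : Measure Ω} [IsProbabilityMeasure P]
  {μ : ℝ → ℝ} {κ : ℝ → ℝ → ℝ → ℝ} {N p n : ℕ} {f : Ω → Eucl N → ℝ}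

lemma IsSmoothGRF.cov_sum_left (hf : IsSmoothGRF μ κ P f) {ι : Type*} [Fintype ι] (A : ι → ℝ)
    (J : ι → Jet (Eucl N)) (J' : Jet (Eucl N)) :
    cov[fun ω => ∑ i, A i * (J i).eval (f ω), fun ω => J'.eval (f ω); P] =
      1 / (N : ℝ) * ∑ i, A i * jetKernel κ (J i) J' := by
  rw [covariance_fun_sum_left (fun i => (hf.memLp_eval (J i)).const_mul _) (hf.memLp_eval J'),
    Finset.mul_sum]
  refine Finset.sum_congr rfl fun i _ => ?_
  rw [covariance_const_mul_left, hf.cov_eval]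
  ring

/-- The coefficients of the residual of the prediction of the observation `o` at the last point. -/
noncomputable def innovationCoef (κ : ℝ → ℝ → ℝ → ℝ) (c : Fin (n + 1) → Eucl p)
    (o : Option (Fin p)) : Fin (n + 1) → Option (Fin p) → ℝ :=
  Fin.snoc (fun k o' =>
    - jetCoef κ (coordJets fun k : Fin n => c k.castSucc) (coordJet (c (Fin.last n)) o) (k, o'))
    (Pi.single o 1)

lemma sum_innovationCoef (hκ : IsSmoothKernel κ p) {c : Fin (n + 1) → Eucl p}
    (hc : Function.Injective c) (o : Option (Fin p)) (l : Fin n) (o' : Option (Fin p)) :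
    ∑ q : Fin (n + 1) × Option (Fin p), innovationCoef κ c o q.1 q.2 *
      jetKernel κ (coordJet (c q.1) q.2) (coordJet (c l.castSucc) o') = 0 := by
  have h := sum_jetCoef (J := coordJets fun k : Fin n => c k.castSucc)
    (hκ.det_coordJets_ne_zero (hc.comp (Fin.castSucc_injective n)))
    (coordJet (c (Fin.last n)) o) (l, o')
  rw [Fintype.sum_prod_type, Fin.sum_univ_castSucc]
  have hq : ∀ q, coordJets (fun k : Fin n => c k.castSucc) q = coordJet (c q.1.castSucc) q.2 :=
    fun _ => rfl
  rw [Fintype.sum_prod_type] at h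
  simp only [hq] at h
  simp only [innovationCoef, Fin.snoc_castSucc, Fin.snoc_last, Pi.single_apply, ite_mul, one_mul,
    zero_mul, Finset.sum_ite_eq', Finset.mem_univ, if_true]
  rw [hκ.comm (coordJet (c (Fin.last n)) o)]
  rw [← h, ← Finset.sum_add_distrib]
  refine Finset.sum_eq_zero fun k _ => ?_
  rw [← Finset.sum_add_distrib]
  refine Finset.sum_eq_zero fun o'' _ => ?_
  rw [hκ.comm (coordJet (c k.castSucc) o'')]
  ring

variable {v : Fin p → Eucl N} {x : Fin (n + 1) → Eucl N}

/-- The residual of the prediction of an observation is uncorrelated with the earlier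
observations. -/
lemma IsSmoothGRF.cov_innovation (hf : IsSmoothGRF μ κ P f) (hall : ∀ M, IsSmoothKernel κ M)
    (hv : Orthonormal ℝ v) (hx : ∀ k, x k ∈ Submodule.span ℝ (Set.range v))
    (hc : Function.Injective fun k => frameCoord v (x k)) (o : Option (Fin p)) (l : Fin n)
    (a : ℝ) (u : Eucl N) :
    cov[fun ω => ∑ q : Fin (n + 1) × Option (Fin p),
        innovationCoef κ (fun k => frameCoord v (x k)) o q.1 q.2 *
          (frameJet v (x q.1) q.2).eval (f ω),
      fun ω => (⟨x l.castSucc, a, u⟩ : Jet (Eucl N)).eval (f ω); P] = 0 := by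
  rw [hf.cov_sum_left, mul_eq_zero]
  right
  -- An earlier observation in an arbitrary direction of the full space enters only through its
  -- coordinates in the system, where the normal equations apply.
  simp_rw [jetKernel_frameJet hall hv (hx _) (hx _), Finset.mul_sum]
  rw [Finset.sum_comm]
  refine Finset.sum_eq_zero fun o' _ => ?_
  have h := sum_innovationCoef (hall p) hc o l o'
  rw [← mul_zero (Option.elim o' a (fun i => inner ℝ (v i) u)), ← h, Finset.mul_sum]
  refine Finset.sum_congr rfl fun q _ => ?_
  ring

lemma IsSmoothGRF.integral_sum_eval (hf : IsSmoothGRF μ κ P f) {ι : Type*} [Fintype ι] (A : ι → ℝ)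
    (J : ι → Jet (Eucl N)) :
    ∫ ω, ∑ i, A i * (J i).eval (f ω) ∂P = ∑ i, A i * jetMean μ (J i) := by
  rw [integral_finsetSum _ fun i _ =>
    ((hf.memLp_eval (J i)).integrable (by norm_num)).const_mul _]
  refine Finset.sum_congr rfl fun i _ => ?_
  rw [integral_const_mul, hf.integral_eval]

lemma IsSmoothGRF.memLp_sum_eval (hf : IsSmoothGRF μ κ P f) {ι : Type*} [Fintype ι] (A : ι → ℝ)
    (J : ι → Jet (Eucl N)) : MemLp (fun ω => ∑ i, A i * (J i).eval (f ω)) 2 P :=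
  memLp_finsetSum _ fun i _ => (hf.memLp_eval (J i)).const_mul _

/-- The variance of the residual is at most that of the observation. -/
lemma IsSmoothGRF.variance_innovation_le (hf : IsSmoothGRF μ κ P f)
    (hall : ∀ M, IsSmoothKernel κ M)
    (hv : Orthonormal ℝ v) (hx : ∀ k, x k ∈ Submodule.span ℝ (Set.range v))
    (hc : Function.Injective fun k => frameCoord v (x k)) (o : Option (Fin p)) :
    Var[fun ω => ∑ q : Fin (n + 1) × Option (Fin p),
        innovationCoef κ (fun k => frameCoord v (x k)) o q.1 q.2 *
          (frameJet v (x q.1) q.2).eval (f ω); P] ≤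
      1 / (N : ℝ) * jetKernel κ (coordJet (frameCoord v (x (Fin.last n))) o)
        (coordJet (frameCoord v (x (Fin.last n))) o) := by
  set A := innovationCoef κ (fun k => frameCoord v (x k)) o with hA
  set L := fun ω => ∑ q : Fin (n + 1) × Option (Fin p), A q.1 q.2 *
          (frameJet v (x q.1) q.2).eval (f ω) with hL
  set W := fun ω => ∑ q : Fin n × Option (Fin p), (- A q.1.castSucc q.2) *
          (frameJet v (x q.1.castSucc) q.2).eval (f ω) with hW
  have hLm : MemLp L 2 P := hf.memLp_sum_eval _ _
  have hWm : MemLp W 2 P := hf.memLp_sum_eval _ _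
  -- The observation is the innovation `L` plus a combination `W` of earlier observations; these are
  -- uncorrelated, so the variances add up.
  have hT : (fun ω => (frameJet v (x (Fin.last n)) o).eval (f ω)) = L + W := by
    ext ω
    simp only [hL, hW, Pi.add_apply, Fintype.sum_prod_type, Fin.sum_univ_castSucc, neg_mul,
      Finset.sum_neg_distrib]
    simp only [hA, innovationCoef, Fin.snoc_last, Pi.single_apply, ite_mul, one_mul, zero_mul,
      Finset.sum_ite_eq', Finset.mem_univ, if_true]
    ring
  have hcov : cov[L, W; P] = 0 := by
    rw [hW, covariance_fun_sum_right (fun i => (hf.memLp_eval _).const_mul _) hLm]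
    refine Finset.sum_eq_zero fun q _ => ?_
    rw [covariance_const_mul_right]
    have h : (frameJet v (x q.1.castSucc) q.2) = ⟨x q.1.castSucc,
        (frameJet v (x q.1.castSucc) q.2).value, (frameJet v (x q.1.castSucc) q.2).dir⟩ := by
      cases q.2 <;> rfl
    rw [h, hf.cov_innovation hall hv hx hc, mul_zero]
  have hvar : Var[fun ω => (frameJet v (x (Fin.last n)) o).eval (f ω); P] = Var[L; P] + Var[W; P] := by
    rw [hT, variance_add hLm hWm, hcov]
    ring
  have h1 : Var[fun ω => (frameJet v (x (Fin.last n)) o).eval (f ω); P] =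
      1 / (N : ℝ) * jetKernel κ (coordJet (frameCoord v (x (Fin.last n))) o)
        (coordJet (frameCoord v (x (Fin.last n))) o) := by
    rw [← covariance_self (hf.memLp_eval _).aemeasurable, hf.cov_eval,
      frameJet_eq_map hv (hx _), jetKernel_map]
  rw [← h1, hvar]
  exact le_add_of_nonneg_right (variance_nonneg _ _)

lemma jetMean_frameJet (hv : Orthonormal ℝ v) {y : Eucl N}
    (hy : y ∈ Submodule.span ℝ (Set.range v)) (o : Option (Fin p)) :
    jetMean μ (frameJet v y o) = jetMean μ (coordJet (frameCoord v y) o) := by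
  rw [frameJet_eq_map hv hy, jetMean_map]

/-- The residuals of the normal derivatives are uncorrelated with the earlier observations. -/
lemma IsSmoothGRF.cov_normalResidual (hf : IsSmoothGRF μ κ P f) (hall : ∀ M, IsSmoothKernel κ M)
    (hv : Orthonormal ℝ v) (hx : ∀ k, x k ∈ Submodule.span ℝ (Set.range v))
    (hc : Function.Injective fun k => frameCoord v (x k)) {w : Eucl N}
    (hw : w ∈ (Submodule.span ℝ (Set.range v))ᗮ) (l : Fin n) (a : ℝ) (u : Eucl N) :
    cov[fun ω => ∑ k, residualCoef (normalCoef κ fun k => frameCoord v (x k)) k *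
          (⟨x k, 0, w⟩ : Jet (Eucl N)).eval (f ω),
      fun ω => (⟨x l.castSucc, a, u⟩ : Jet (Eucl N)).eval (f ω); P] = 0 := by
  rw [hf.cov_sum_left, mul_eq_zero]
  right
  -- The value and the tangential part of `u` are uncorrelated with the normal derivative, which
  -- leaves a multiple of the model kernel with a factor independent of `k`.
  have h : ∀ k, jetKernel κ (⟨x k, 0, w⟩ : Jet (Eucl N)) ⟨x l.castSucc, a, u⟩ =
      inner ℝ w (frameCompl v u) * jetKernel κ (normalJet (frameCoord v (x k)))
        (normalJet (frameCoord v (x l.castSucc))) := by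
    intro k
    have h0 : jetKernel κ (⟨x k, 0, w⟩ : Jet (Eucl N))
        ⟨x l.castSucc, a, ∑ i, inner ℝ (v i) u • v i⟩ = 0 := by
      rw [(hall N).comm]
      exact (hall N).orthogonal a (inner_eq_zero_of_mem hw (hx _)) (inner_eq_zero_of_mem hw (hx _))
        (inner_eq_zero_of_mem hw (Submodule.sum_mem _ fun i _ =>
          Submodule.smul_mem _ _ (Submodule.subset_span ⟨i, rfl⟩)))
    conv_lhs => rw [frameCompl_add_sum (v := v) u, ← add_zero a]
    rw [(hall N).add_right, h0, zero_add, jetKernel_normal hall hv (hx _) (hx _) hw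
      (frameCompl_mem hv u)]
  simp_rw [h]
  rw [← mul_zero (inner ℝ w (frameCompl v u)),
    ← (hall (p + 1)).sum_residualCoef_normalJet hc l, Finset.mul_sum]
  refine Finset.sum_congr rfl fun k _ => ?_
  ring

/-- In the second residual only the last term survives, since the first is uncorrelated with the
earlier observations. The result says that the normal residual is isotropic on the orthogonal
complement. -/
lemma IsSmoothGRF.cov_normalResidual_normalResidual (hf : IsSmoothGRF μ κ P f)
    (hall : ∀ M, IsSmoothKernel κ M)
    (hv : Orthonormal ℝ v) (hx : ∀ k, x k ∈ Submodule.span ℝ (Set.range v))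
    (hc : Function.Injective fun k => frameCoord v (x k)) {w w' : Eucl N}
    (hw : w ∈ (Submodule.span ℝ (Set.range v))ᗮ) (hw' : w' ∈ (Submodule.span ℝ (Set.range v))ᗮ) :
    cov[fun ω => ∑ k, residualCoef (normalCoef κ fun k => frameCoord v (x k)) k *
          (⟨x k, 0, w⟩ : Jet (Eucl N)).eval (f ω),
      fun ω => ∑ k, residualCoef (normalCoef κ fun k => frameCoord v (x k)) k *
          (⟨x k, 0, w'⟩ : Jet (Eucl N)).eval (f ω); P] =
      inner ℝ w w' * (1 / (N : ℝ) * normalVar κ fun k => frameCoord v (x k)) := by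
  rw [covariance_fun_sum_right (fun i => (hf.memLp_eval _).const_mul _)
    (hf.memLp_sum_eval _ _), Fin.sum_univ_castSucc, Finset.sum_eq_zero, zero_add,
    covariance_const_mul_right]
  · simp only [residualCoef, Fin.snoc_last, one_mul]
    have h := hf.cov_sum_left (residualCoef (normalCoef κ fun k => frameCoord v (x k)))
      (fun k => ⟨x k, 0, w⟩) ⟨x (Fin.last n), 0, w'⟩
    simp_rw [jetKernel_normal hall hv (hx _) (hx _) hw hw'] at h
    rw [← IsSmoothKernel.sum_residualCoef_last (κ := κ)]
    simp only [residualCoef] at h ⊢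
    rw [h, mul_left_comm, Finset.mul_sum (a := inner ℝ w w')]
    congr 1
    refine Finset.sum_congr rfl fun k _ => ?_
    ring
  · intro k _
    rw [covariance_const_mul_right, hf.cov_normalResidual hall hv hx hc hw, mul_zero]

/-- The gradient of the mean is radial, hence lies in the span of the system and is orthogonal to
`w`. -/
lemma IsSmoothGRF.integral_normalResidual (hf : IsSmoothGRF μ κ P f)
    (hx : ∀ k, x k ∈ Submodule.span ℝ (Set.range v)) {w : Eucl N}
    (hw : w ∈ (Submodule.span ℝ (Set.range v))ᗮ) (β : Fin (n + 1) → ℝ) :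
    ∫ ω, ∑ k, β k * (⟨x k, 0, w⟩ : Jet (Eucl N)).eval (f ω) ∂P = 0 := by
  rw [hf.integral_sum_eval]
  refine Finset.sum_eq_zero fun k _ => ?_
  rw [jetMean, real_inner_comm, inner_eq_zero_of_mem hw (hx k)]
  simp

end Residual

/-! ### Sums of squares of Gaussian variables -/

section SumSq

variable {Ω : Type*} [MeasurableSpace Ω] {P : Measure Ω} [IsProbabilityMeasure P]

/-- The variance of the square of a standard Gaussian variable. -/
noncomputable def squareVar : ℝ := Var[fun x : ℝ => x ^ 2; gaussianReal 0 1]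

lemma squareVar_nonneg : 0 ≤ squareVar := variance_nonneg _ _

/-- Scaling reduces moments to the standard Gaussian law; the form with `√t` includes the degenerate
case `t = 0`. -/
lemma map_eq_of_centered {Z : Ω → ℝ} (hZ : HasGaussianLaw Z P) (h0 : ∫ ω, Z ω ∂P = 0) {t : ℝ}
    (ht : 0 ≤ t) (hv : Var[Z; P] = t) :
    P.map Z = (gaussianReal 0 1).map fun x => √t * x := by
  rw [hZ.map_eq_gaussianReal, h0, hv, gaussianReal_map_const_mul]
  congr 1
  · simp
  · ext
    simp [Real.sq_sqrt ht, ht]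

/-- Hölder's inequality with `1/4 + 1/4 = 1/2`, since the Gaussian law has a fourth moment. -/
lemma memLp_sq_gaussian : MemLp (fun x : ℝ => x ^ 2) 2 (gaussianReal 0 1) := by
  have h := memLp_id_gaussianReal (μ := 0) (v := 1) 4
  have h2 := h.mul (q := 4) (r := 2) h (hpqr := ⟨by
    have : ((4 : NNReal) : ENNReal) = 4 := rfl
    rw [this, ← two_mul, show (4 : ENNReal) = 2 * 2 by norm_num, ENNReal.mul_inv (by simp) (by simp),
      ← mul_assoc, ENNReal.mul_inv_cancel (by simp) (by simp), one_mul]⟩)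
  convert h2 using 1
  ext x
  simp [pow_two]

lemma memLp_sq_of_centered {Z : Ω → ℝ} (hZ : HasGaussianLaw Z P) (h0 : ∫ ω, Z ω ∂P = 0) {t : ℝ}
    (ht : 0 ≤ t) (hv : Var[Z; P] = t) : MemLp (fun ω => Z ω ^ 2) 2 P := by
  have h1 : MemLp (fun x : ℝ => x ^ 2) 2 (P.map Z) := by
    rw [map_eq_of_centered hZ h0 ht hv, memLp_map_measure_iff (by fun_prop) (by fun_prop)]
    have h2 := memLp_sq_gaussian.const_mul t
    convert h2 using 1
    ext x
    simp [mul_pow, Real.sq_sqrt ht]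
  exact (memLp_map_measure_iff (by fun_prop) hZ.aemeasurable).1 h1

lemma variance_sq_of_centered {Z : Ω → ℝ} (hZ : HasGaussianLaw Z P) (h0 : ∫ ω, Z ω ∂P = 0) {t : ℝ}
    (ht : 0 ≤ t) (hv : Var[Z; P] = t) : Var[fun ω => Z ω ^ 2; P] = t ^ 2 * squareVar := by
  have h1 : Var[fun ω => Z ω ^ 2; P] = Var[fun x : ℝ => x ^ 2; P.map Z] := by
    rw [variance_map (by fun_prop) hZ.aemeasurable]; rfl
  rw [h1, map_eq_of_centered hZ h0 ht hv, variance_map (by fun_prop) (by fun_prop), squareVar,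
    ← variance_const_mul]
  congr 1
  ext x
  simp [mul_pow, Real.sq_sqrt ht]

/-- The second moment of the deviation of a sum of squares of independent Gaussian variables. -/
lemma integral_sum_sq_sub_sq {m : ℕ} {Z : Fin m → Ω → ℝ}
    (hZ : HasGaussianLaw (fun ω i => Z i ω) P) (h0 : ∀ i, ∫ ω, Z i ω ∂P = 0) {t : ℝ} (ht : 0 ≤ t)
    (hcov : ∀ i j, cov[Z i, Z j; P] = if i = j then t else 0) (s : ℝ) :
    ∫⁻ ω, ENNReal.ofReal ((∑ i, Z i ω ^ 2 - s) ^ 2) ∂P =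
      ENNReal.ofReal (m * (t ^ 2 * squareVar) + (m * t - s) ^ 2) := by
  have hZi : ∀ i, HasGaussianLaw (Z i) P := fun i => hZ.eval i
  have hv : ∀ i, Var[Z i; P] = t := fun i => by
    rw [← covariance_self (hZi i).aemeasurable, hcov, if_pos rfl]
  have hm : ∀ i, MemLp (fun ω => Z i ω ^ 2) 2 P := fun i =>
    memLp_sq_of_centered (hZi i) (h0 i) ht (hv i)
  have hE : ∀ i, ∫ ω, Z i ω ^ 2 ∂P = t := fun i => by
    have h := variance_eq_sub (hZi i).memLp_two
    rw [hv i, h0 i] at h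
    simpa using h.symm
  -- Jointly Gaussian and uncorrelated, hence independent; so the variances of the squares can be
  -- added.
  have hind : iIndepFun Z P := hZ.iIndepFun_of_covariance_eq_zero fun i j hij => by
    rw [hcov, if_neg hij]
  have hsum : Var[fun ω => ∑ i, Z i ω ^ 2; P] = m * (t ^ 2 * squareVar) := by
    have h := IndepFun.variance_sum (s := Finset.univ) (X := fun i ω => Z i ω ^ 2)
      (fun i _ => hm i) (fun i _ j _ hij =>
        (hind.indepFun hij).comp (φ := fun x : ℝ => x ^ 2) (ψ := fun x : ℝ => x ^ 2)
          (by fun_prop) (by fun_prop))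
    have h2 : (∑ i, fun ω => Z i ω ^ 2) = fun ω => ∑ i, Z i ω ^ 2 := by
      ext ω; simp
    rw [h2] at h
    rw [h]
    simp [variance_sq_of_centered (hZi _) (h0 _) ht (hv _)]
  have hS : MemLp (fun ω => ∑ i, Z i ω ^ 2) 2 P := memLp_finsetSum _ fun i _ => hm i
  have hS2 : MemLp (fun ω => ∑ i, Z i ω ^ 2 - s) 2 P := hS.sub (memLp_const s)
  rw [← ofReal_integral_eq_lintegral_ofReal hS2.integrable_sq (ae_of_all _ fun ω => sq_nonneg _)]
  congr 1
  -- The second moment about `s` is the variance of the sum plus the square of its bias `m t - s`.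
  have h1 := variance_eq_sub hS2
  rw [variance_sub_const hS.aestronglyMeasurable, hsum] at h1
  have h2 : ∫ ω, (∑ i, Z i ω ^ 2 - s) ∂P = m * t - s := by
    rw [integral_sub (hS.integrable (by norm_num)) (integrable_const _),
      integral_finsetSum _ fun i _ => (hm i).integrable (by norm_num)]
    simp [hE]
  rw [h2] at h1
  rw [h1]
  simp

lemma measure_eq_zero_of_gaussian {Z : Ω → ℝ} (hZ : HasGaussianLaw Z P) (hv : Var[Z; P] ≠ 0) :
    P {ω | Z ω = 0} = 0 := by
  have h : P {ω | Z ω = 0} = P.map Z {0} := by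
    rw [Measure.map_apply_of_aemeasurable hZ.aemeasurable (measurableSet_singleton 0)]
    rfl
  rw [h, hZ.map_eq_gaussianReal]
  have := nullSingletonClass_gaussianReal (μ := ∫ ω, Z ω ∂P) (v := Var[Z; P].toNNReal)
    (by simpa using lt_of_le_of_ne (variance_nonneg Z P) hv.symm)
  exact measure_singleton 0

end SumSq

/-! ### Length of the normal residual at fixed points -/

section Residual

variable {Ω : Type*} [MeasurableSpace Ω] {P : Measure Ω} [IsProbabilityMeasure P]
  {μ : ℝ → ℝ} {κ : ℝ → ℝ → ℝ → ℝ} {N p n : ℕ} {f : Ω → Eucl N → ℝ}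
  {v : Fin p → Eucl N} {x : Fin (n + 1) → Eucl N}

/-- The residual of the regression of the last gradient, projected to the orthogonal complement. -/
noncomputable def normalResidual (κ : ℝ → ℝ → ℝ → ℝ) (v : Fin p → Eucl N)
    (x : Fin (n + 1) → Eucl N) (g : Eucl N → ℝ) : Eucl N :=
  frameCompl v (∑ k, residualCoef (normalCoef κ fun k => frameCoord v (x k)) k • gradient g (x k))

/-- The projection is self-adjoint and fixes normal directions, so testing with `w` turns the vector
residual into the scalar one. -/
lemma inner_normalResidual {w : Eucl N}
    (hw : w ∈ (Submodule.span ℝ (Set.range v))ᗮ) (g : Eucl N → ℝ) :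
    inner ℝ (normalResidual κ v x g) w =
      ∑ k, residualCoef (normalCoef κ fun k => frameCoord v (x k)) k *
        (⟨x k, 0, w⟩ : Jet (Eucl N)).eval g := by
  have h : frameCompl v w = w := by
    rw [frameCompl, Finset.sum_eq_zero, sub_zero]
    intro i _
    rw [(Submodule.mem_orthogonal _ _).1 hw _ (Submodule.subset_span ⟨i, rfl⟩), zero_smul]
  rw [normalResidual, ← inner_frameCompl_symm, h, sum_inner]
  refine Finset.sum_congr rfl fun k _ => ?_
  simp [Jet.eval, inner_smul_left]

lemma IsSmoothGRF.hasGaussianLaw_normalResidual (hf : IsSmoothGRF μ κ P f)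
    {ι : Type*} [Fintype ι] {b : ι → Eucl N}
    (hb : ∀ i, b i ∈ (Submodule.span ℝ (Set.range v))ᗮ) :
    HasGaussianLaw (fun ω i => inner ℝ (normalResidual κ v x (f ω)) (b i)) P := by
  have h := isGaussianProcess_of_mem_span (Y := fun i ω =>
    inner ℝ (normalResidual κ v x (f ω)) (b i)) hf.isGaussianProcess fun i => by
      have h1 : (fun ω => inner ℝ (normalResidual κ v x (f ω)) (b i)) = fun ω =>
          ∑ k, residualCoef (normalCoef κ fun k => frameCoord v (x k)) k *
            (⟨x k, 0, b i⟩ : Jet (Eucl N)).eval (f ω) := by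
        ext ω
        exact inner_normalResidual (hb i) _
      rw [h1]
      exact sum_mem_fun _ fun k _ => mul_mem_fun _ (Submodule.subset_span ⟨_, rfl⟩)
  let L : (↥(Finset.univ : Finset ι) → ℝ) →L[ℝ] (ι → ℝ) := ContinuousLinearMap.pi fun i =>
    ContinuousLinearMap.proj (R := ℝ) (φ := fun _ : ↥(Finset.univ : Finset ι) => ℝ)
      ⟨i, Finset.mem_univ i⟩
  exact (h.hasGaussianLaw Finset.univ).map L

lemma IsSmoothGRF.integral_inner_normalResidual (hf : IsSmoothGRF μ κ P f)
    (hx : ∀ k, x k ∈ Submodule.span ℝ (Set.range v)) {w : Eucl N}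
    (hw : w ∈ (Submodule.span ℝ (Set.range v))ᗮ) :
    ∫ ω, inner ℝ (normalResidual κ v x (f ω)) w ∂P = 0 := by
  simp_rw [inner_normalResidual hw]
  exact hf.integral_normalResidual hx hw _

lemma IsSmoothGRF.cov_inner_normalResidual (hf : IsSmoothGRF μ κ P f)
    (hall : ∀ M, IsSmoothKernel κ M)
    (hv : Orthonormal ℝ v) (hx : ∀ k, x k ∈ Submodule.span ℝ (Set.range v))
    (hc : Function.Injective fun k => frameCoord v (x k)) {w w' : Eucl N}
    (hw : w ∈ (Submodule.span ℝ (Set.range v))ᗮ) (hw' : w' ∈ (Submodule.span ℝ (Set.range v))ᗮ) :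
    cov[fun ω => inner ℝ (normalResidual κ v x (f ω)) w,
      fun ω => inner ℝ (normalResidual κ v x (f ω)) w'; P] =
      inner ℝ w w' * (1 / (N : ℝ) * normalVar κ fun k => frameCoord v (x k)) := by
  simp_rw [inner_normalResidual hw, inner_normalResidual hw']
  exact hf.cov_normalResidual_normalResidual hall hv hx hc hw hw'

lemma finrank_orthogonal_span (hv : Orthonormal ℝ v) :
    p + Module.finrank ℝ (Submodule.span ℝ (Set.range v))ᗮ = N := by
  have h := Submodule.finrank_add_finrank_orthogonal (Submodule.span ℝ (Set.range v))
  rw [finrank_span_eq_card hv.linearIndependent, Fintype.card_fin, finrank_euclideanSpace_fin] at h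
  exact h

/-- The length of the residual concentrates. -/
lemma IsSmoothGRF.lintegral_normalResidual_le (hf : IsSmoothGRF μ κ P f)
    (hall : ∀ M, IsSmoothKernel κ M)
    (hv : Orthonormal ℝ v) (hx : ∀ k, x k ∈ Submodule.span ℝ (Set.range v))
    (hc : Function.Injective fun k => frameCoord v (x k)) :
    ∫⁻ ω, ENNReal.ofReal ((‖normalResidual κ v x (f ω)‖ ^ 2 -
        normalVar κ fun k => frameCoord v (x k)) ^ 2) ∂P ≤
      ENNReal.ofReal ((normalVar κ fun k => frameCoord v (x k)) ^ 2 * (squareVar + p ^ 2) / N) := by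
  set s := normalVar κ fun k => frameCoord v (x k) with hs
  have hspos : 0 < s := (hall (p + 1)).normalVar_pos hc
  set W := (Submodule.span ℝ (Set.range v))ᗮ with hW
  have hdim := finrank_orthogonal_span hv
  set m := Module.finrank ℝ W with hm
  let b := stdOrthonormalBasis ℝ W
  have hb : ∀ i, (b i : Eucl N) ∈ W := fun i => (b i).2
  have hbo : ∀ i j, inner ℝ (b i : Eucl N) (b j : Eucl N) = if i = j then 1 else 0 := fun i j =>
    (orthonormal_iff_ite.1 b.orthonormal) i j
  -- Parseval in the orthogonal complement, of dimension `m = N - p`, writes the squared length as a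
  -- sum of squares of independent variables of variance `s / N`.
  have hnorm : ∀ ω, ‖normalResidual κ v x (f ω)‖ ^ 2 =
      ∑ i, inner ℝ (normalResidual κ v x (f ω)) (b i : Eucl N) ^ 2 := fun ω => by
    have hmem : normalResidual κ v x (f ω) ∈ W := frameCompl_mem hv _
    have h := b.sum_sq_norm_inner_right ⟨_, hmem⟩
    have h2 : ‖(⟨_, hmem⟩ : W)‖ = ‖normalResidual κ v x (f ω)‖ := rfl
    rw [← h2, ← h]
    refine Finset.sum_congr rfl fun i _ => ?_
    rw [Real.norm_eq_abs, sq_abs, Submodule.coe_inner, real_inner_comm]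
  simp_rw [hnorm]
  have hN0 : (0 : ℝ) < N := Nat.cast_pos.2 hf.pos
  rw [integral_sum_sq_sub_sq (t := 1 / (N : ℝ) * s) (hf.hasGaussianLaw_normalResidual hb)
    (fun i => hf.integral_inner_normalResidual hx (hb i)) (by positivity) (fun i j => by
      rw [hf.cov_inner_normalResidual hall hv hx hc (hb i) (hb j), hbo]
      split_ifs <;> simp [hs])]
  refine ENNReal.ofReal_le_ofReal ?_
  have hmN : (p : ℝ) + m = N := by exact_mod_cast hdim
  -- The bias comes from the `p` missing directions and is of order `1/N`, so its square is
  -- dominated by the variance rate.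
  have h1 : (m : ℝ) * (1 / (N : ℝ) * s) - s = - (p * s / N) := by
    rw [← hmN] at hN0 ⊢
    field_simp
    ring
  rw [h1]
  have hm1 : (m : ℝ) / N ≤ 1 := by
    rw [div_le_one hN0, ← hmN]
    linarith [(Nat.cast_nonneg p : (0 : ℝ) ≤ p)]
  have hN1 : (1 : ℝ) / N ≤ 1 := by
    rw [div_le_one hN0]
    exact_mod_cast hf.pos
  have e1 : (m : ℝ) * ((1 / (N : ℝ) * s) ^ 2 * squareVar) =
      (m / N) * (s ^ 2 * squareVar / N) := by
    field_simp
  have e2 : (- (p * s / N) : ℝ) ^ 2 = (1 / N) * (s ^ 2 * p ^ 2 / N) := by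
    field_simp
  have e3 : s ^ 2 * (squareVar + p ^ 2) / N = s ^ 2 * squareVar / N + s ^ 2 * p ^ 2 / N := by
    ring
  rw [e1, e2, e3]
  have := squareVar_nonneg
  exact add_le_add (mul_le_of_le_one_left (by positivity) hm1)
    (mul_le_of_le_one_left (by positivity) hN1)

/-- The residual does not vanish if the dimension is large enough. -/
lemma IsSmoothGRF.measure_normalResidual_eq_zero (hf : IsSmoothGRF μ κ P f)
    (hall : ∀ M, IsSmoothKernel κ M)
    (hv : Orthonormal ℝ v) (hx : ∀ k, x k ∈ Submodule.span ℝ (Set.range v))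
    (hc : Function.Injective fun k => frameCoord v (x k)) (hp : p < N) :
    P {ω | normalResidual κ v x (f ω) = 0} = 0 := by
  have hs := (hall (p + 1)).normalVar_pos hc
  have hdim := finrank_orthogonal_span hv
  have hpos : 0 < Module.finrank ℝ (Submodule.span ℝ (Set.range v))ᗮ := by omega
  -- A single normal direction suffices: the residual has a nondegenerate Gaussian component there,
  -- which vanishes with probability zero.
  obtain ⟨w, hw⟩ := Module.finrank_pos_iff_exists_ne_zero.1 hpos
  have hwn : (w : Eucl N) ≠ 0 := fun h => hw (Subtype.ext h)
  have hN0 : (0 : ℝ) < N := Nat.cast_pos.2 hf.pos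
  have hZ : HasGaussianLaw (fun ω => inner ℝ (normalResidual κ v x (f ω)) (w : Eucl N)) P :=
    (hf.hasGaussianLaw_normalResidual (ι := Unit) (b := fun _ => w) fun _ => w.2).eval ()
  refine measure_mono_null (fun ω hω => ?_) (measure_eq_zero_of_gaussian hZ ?_)
  · simp only [Set.mem_ofPred_eq] at hω ⊢
    rw [hω, inner_zero_left]
  · rw [← covariance_self hZ.aemeasurable, hf.cov_inner_normalResidual hall hv hx hc w.2 w.2,
      real_inner_self_eq_norm_sq]
    have := norm_pos_iff.2 hwn
    positivity

end Residual

/-! ### Regression at adaptively selected points -/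

section Algebra

variable {N p n : ℕ} {μ : ℝ → ℝ} {κ : ℝ → ℝ → ℝ → ℝ}

/-- The coefficients with respect to the standard basis. -/
noncomputable def frameCoef (v : Fin p → Eucl N) (A : Option (Fin p) → ℝ) : Option (Fin N) → ℝ
  | none => A none
  | some j => ∑ i, A (some i) * v i j

/-- Functionals in a history dependent basis become functionals of the standard coordinates with
history dependent coefficients, as the freezing theorem requires. -/
lemma sum_frameCoef (v : Fin p → Eucl N) (A : Option (Fin p) → ℝ) (g : Eucl N → ℝ) (x : Eucl N) :
    ∑ j, frameCoef v A j * gradObs g x j = ∑ o, A o * (frameJet v x o).eval g := by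
  simp_rw [frameJet_eval]
  simp only [Fintype.sum_option, frameCoef, gradObs, frameObs, Finset.sum_mul, PiLp.inner_apply,
    RCLike.inner_apply, conj_trivial, Finset.mul_sum]
  congr 1
  rw [Finset.sum_comm]
  refine Finset.sum_congr rfl fun i _ => Finset.sum_congr rfl fun j _ => ?_
  ring

/-- The prediction error is one linear functional of all observations minus the same functional of
the means. -/
lemma frameObs_sub_prediction (v : Fin p → Eucl N) (x : Fin (n + 1) → Eucl N) (g : Eucl N → ℝ)
    (c : Fin (n + 1) → Eucl p) (o : Option (Fin p)) :
    frameObs g v (x (Fin.last n)) o -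
        prediction μ κ c (fun k o => frameObs g v (x k.castSucc) o) o =
      ∑ q : Fin (n + 1) × Option (Fin p), innovationCoef κ c o q.1 q.2 *
          (frameJet v (x q.1) q.2).eval g -
        ∑ q : Fin (n + 1) × Option (Fin p), innovationCoef κ c o q.1 q.2 *
          jetMean μ (coordJet (c q.1) q.2) := by
  simp_rw [frameJet_eval]
  rw [prediction, ← Finset.sum_sub_distrib]
  simp_rw [← mul_sub]
  rw [Fintype.sum_prod_type, Fintype.sum_prod_type, Fin.sum_univ_castSucc]
  simp only [innovationCoef, Fin.snoc_castSucc, Fin.snoc_last, Pi.single_apply, ite_mul, one_mul,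
    zero_mul, Finset.sum_ite_eq', Finset.mem_univ, if_true, neg_mul, Finset.sum_neg_distrib]
  ring

/-- The coefficients of the components of the normal residual. -/
noncomputable def residualCoefs (β : Fin (n + 1) → ℝ) (v : Fin p → Eucl N) (t : Fin N)
    (k : Fin (n + 1)) : Option (Fin N) → ℝ
  | none => 0
  | some j => β k * frameCompl v (EuclideanSpace.single t 1) j

lemma sum_residualCoefs_eval (β : Fin (n + 1) → ℝ) (v : Fin p → Eucl N) (t : Fin N)
    (x : Fin (n + 1) → Eucl N) (g : Eucl N → ℝ) :
    ∑ k, ∑ j, residualCoefs β v t k j * gradObs g (x k) j =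
      ∑ k, β k * (⟨x k, 0, frameCompl v (EuclideanSpace.single t 1)⟩ : Jet (Eucl N)).eval g := by
  refine Finset.sum_congr rfl fun k _ => ?_
  simp only [Fintype.sum_option, residualCoefs, gradObs, Jet.eval, zero_mul, zero_add,
    PiLp.inner_apply, RCLike.inner_apply, conj_trivial, Finset.mul_sum, mul_assoc]

lemma sum_residualCoefs (v : Fin p → Eucl N) (t : Fin N)
    (x : Fin (n + 1) → Eucl N) (g : Eucl N → ℝ) :
    ∑ k, ∑ j, residualCoefs (residualCoef (normalCoef κ fun k => frameCoord v (x k))) v t k j *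
      gradObs g (x k) j = normalResidual κ v x g t := by
  have h : normalResidual κ v x g t =
      inner ℝ (normalResidual κ v x g) (EuclideanSpace.single t 1) := by
    rw [EuclideanSpace.inner_single_right]; simp
  rw [sum_residualCoefs_eval, h, normalResidual, ← inner_frameCompl_symm, sum_inner]
  refine Finset.sum_congr rfl fun k _ => ?_
  simp [Jet.eval, inner_smul_left]

lemma continuous_jetMean_coordJet (hμ : ContDiff ℝ 1 μ) (o : Option (Fin p)) :
    Continuous fun x : Eucl p => jetMean μ (coordJet x o) := by
  refine continuous_iff_continuousAt.2 fun x => ?_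
  cases o
  · exact tendsto_jetMean hμ (J := fun x : Eucl p => coordJet x none) tendsto_id tendsto_const_nhds
      tendsto_const_nhds
  · exact tendsto_jetMean hμ (J := fun x : Eucl p => coordJet x (some _)) tendsto_id
      tendsto_const_nhds tendsto_const_nhds

lemma measurable_innovationCoef (hκ : IsSmoothKernel κ p) (o : Option (Fin p)) (k : Fin (n + 1))
    (o' : Option (Fin p)) :
    Measurable fun c : Fin (n + 1) → Eucl p => innovationCoef κ c o k o' := by
  refine Fin.lastCases ?_ (fun k => ?_) k
  · simp only [innovationCoef, Fin.snoc_last]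
    exact measurable_const
  · simp only [innovationCoef, Fin.snoc_castSucc]
    exact (measurable_jetCoef (fun i j => (hκ.continuous_coordJets _ _ _ _).measurable)
      (fun i => (hκ.continuous_coordJets _ _ _ _).measurable) _).neg

end Algebra

/-! ### Innovations and normal residuals along an adaptive run -/

section Adaptive

variable {Ω : Type*} [MeasurableSpace Ω] {P : Measure Ω} [IsProbabilityMeasure P]
  {μ : ℝ → ℝ} {κ : ℝ → ℝ → ℝ → ℝ} {N p n : ℕ} {f : Ω → Eucl N → ℝ}

/-- The start and the observations. -/
abbrev History (N n : ℕ) : Type := Eucl N × (Fin n → Option (Fin N) → ℝ)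

/-- A selection rule with an orthonormal system that contains the queries, on a measurable set of
histories. -/
structure IsAdaptiveFrame
    (ξ : Eucl N → (k : ℕ) → (Fin k → Option (Fin N) → ℝ) → Eucl N)
    (v : History N n → Fin p → Eucl N) (B : Set (History N n)) : Prop where
  measurable_rule : ∀ k, Measurable fun q : Eucl N × (Fin k → Option (Fin N) → ℝ) => ξ q.1 k q.2
  measurable_frame : ∀ i, Measurable fun q => v q i
  measurableSet : MeasurableSet B
  orthonormal : ∀ q ∈ B, Orthonormal ℝ (v q)
  mem_span : ∀ q ∈ B, ∀ k : Fin (n + 1),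
    queryAt (ξ q.1) q.2 k ∈ Submodule.span ℝ (Set.range (v q))
  injective : ∀ q ∈ B,
    Function.Injective fun k : Fin (n + 1) => frameCoord (v q) (queryAt (ξ q.1) q.2 k)

/-- The history of a run on `f` from `X`. -/
noncomputable def runHistory (ξ : Eucl N → (k : ℕ) → (Fin k → Option (Fin N) → ℝ) → Eucl N) (n : ℕ)
    (x : Eucl N) (g : Eucl N → ℝ) : History N n :=
  (x, fun i : Fin n => adaptiveObs (ξ x) (gradObs g) i)

variable {ξ : Eucl N → (k : ℕ) → (Fin k → Option (Fin N) → ℝ) → Eucl N}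
  {v : History N n → Fin p → Eucl N} {B : Set (History N n)}

lemma IsAdaptiveFrame.mono (hA : IsAdaptiveFrame ξ v B) {B' : Set (History N n)}
    (hB' : MeasurableSet B') : IsAdaptiveFrame ξ v (B ∩ B') where
  measurable_rule := hA.measurable_rule
  measurable_frame := hA.measurable_frame
  measurableSet := hA.measurableSet.inter hB'
  orthonormal q hq := hA.orthonormal q hq.1
  mem_span q hq := hA.mem_span q hq.1
  injective q hq := hA.injective q hq.1

/-- The coordinates of the queries. -/
noncomputable def queryCoords (ξ : Eucl N → (k : ℕ) → (Fin k → Option (Fin N) → ℝ) → Eucl N)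
    (v : History N n → Fin p → Eucl N) (q : History N n) (k : Fin (n + 1)) : Eucl p :=
  frameCoord (v q) (queryAt (ξ q.1) q.2 k)

lemma IsAdaptiveFrame.measurable_queryAt (hA : IsAdaptiveFrame ξ v B) (k : Fin (n + 1)) :
    Measurable fun q : History N n => queryAt (ξ q.1) q.2 k :=
  _root_.measurable_queryAt (ξ := fun q : History N n => ξ q.1) measurable_snd
    (fun k => (hA.measurable_rule k).comp ((measurable_fst.comp measurable_fst).prodMk
      measurable_snd)) k

lemma measurable_eucl {A : Type*} [MeasurableSpace A] {g : A → Eucl p}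
    (h : ∀ i, Measurable fun a => g a i) : Measurable g := by
  have h1 : Measurable fun a => (fun i => g a i : Fin p → ℝ) := measurable_pi_lambda _ h
  exact (WithLp.measurable_toLp 2 (Fin p → ℝ)).comp h1

lemma measurable_eucl_apply (i : Fin p) : Measurable fun x : Eucl p => x i :=
  (EuclideanSpace.proj i : Eucl p →L[ℝ] ℝ).continuous.measurable

lemma IsAdaptiveFrame.measurable_queryCoords (hA : IsAdaptiveFrame ξ v B) :
    Measurable (queryCoords ξ v) :=
  measurable_pi_lambda _ fun k => measurable_eucl fun i =>
    (hA.measurable_frame i).inner (hA.measurable_queryAt k)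

lemma IsAdaptiveFrame.measurable_functional (hA : IsAdaptiveFrame ξ v B)
    (hf : IsSmoothGRF μ κ P f) {X : Ω → Eucl N} (hX : Measurable X) {τ : Type*} [Fintype τ]
    {a : Eucl N → (Fin n → Option (Fin N) → ℝ) → τ → Fin (n + 1) → Option (Fin N) → ℝ}
    (ha : Measurable fun q : History N n => a q.1 q.2)
    {Φ : Eucl N → (Fin n → Option (Fin N) → ℝ) → (τ → ℝ) → ENNReal}
    (hΦ : Measurable fun p : History N n × (τ → ℝ) => Φ p.1.1 p.1.2 p.2) :
    Measurable fun ω => Φ (X ω) (fun i => adaptiveObs (ξ (X ω)) (hf.path ω).1 i)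
      (queryFunctional (ξ (X ω)) (a (X ω))
        (fun i => adaptiveObs (ξ (X ω)) (hf.path ω).1 i) (hf.path ω).1) := by
  have hξ : ∀ k, Measurable fun p : Ω × (Fin k → Option (Fin N) → ℝ) => ξ (X p.1) k p.2 := fun k =>
    (hA.measurable_rule k).comp ((hX.comp measurable_fst).prodMk measurable_snd)
  have hD : Measurable fun ω => fun i : Fin n => adaptiveObs (ξ (X ω)) (hf.path ω).1 i :=
    measurable_pi_lambda _ fun i => measurable_adaptiveObs (ξ := fun ω => ξ (X ω))
      hf.isGaussianPath.measurable hξ i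
  refine hΦ.comp ((hX.prodMk hD).prodMk ?_)
  exact measurable_queryFunctional (ξ := fun ω => ξ (X ω)) (a := fun ω => a (X ω)) hξ
    (ha.comp ((hX.comp measurable_fst).prodMk measurable_snd)) hD hf.isGaussianPath.measurable

open Classical in
lemma measure_le_of_lintegral_sq {Z : Ω → ℝ} {S : Set Ω}
    (hm : Measurable fun ω => if ω ∈ S then ENNReal.ofReal (Z ω ^ 2) else 0) {c : ENNReal}
    (h : ∫⁻ ω, (if ω ∈ S then ENNReal.ofReal (Z ω ^ 2) else 0) ∂P ≤ c) {ε : ℝ} (hε : 0 < ε) :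
    P {ω | ω ∈ S ∧ ε ≤ |Z ω|} ≤ c / ENNReal.ofReal (ε ^ 2) := by
  have h1 := meas_ge_le_lintegral_div (μ := P) hm.aemeasurable (ε := ENNReal.ofReal (ε ^ 2))
    (by simpa using by positivity) ENNReal.ofReal_ne_top
  refine (measure_mono fun ω hω => ?_).trans (h1.trans (ENNReal.div_le_div_right h _))
  simp only [Set.mem_ofPred_eq] at hω ⊢
  rw [if_pos hω.1]
  refine ENNReal.ofReal_le_ofReal ?_
  rw [← sq_abs (Z ω)]
  exact pow_le_pow_left₀ hε.le hω.2 2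

/-- The prediction of the observations with respect to the system. -/
lemma IsAdaptiveFrame.measure_innovation_le (hA : IsAdaptiveFrame ξ v B)
    (hf : IsSmoothGRF μ κ P f) (hall : ∀ M, IsSmoothKernel κ M) {X : Ω → Eucl N}
    (hX : Measurable X) (hXf : IndepFun X f P) (o : Option (Fin p)) {C : ℝ} (hC : ∀ q ∈ B,
      jetKernel κ (coordJet (queryCoords ξ v q (Fin.last n)) o)
        (coordJet (queryCoords ξ v q (Fin.last n)) o) ≤ C) {ε : ℝ} (hε : 0 < ε) :
    P {ω | runHistory ξ n (X ω) (f ω) ∈ B ∧ ε ≤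
      |frameObs (f ω) (v (runHistory ξ n (X ω) (f ω)))
          (queryAt (ξ (X ω)) (runHistory ξ n (X ω) (f ω)).2 (Fin.last n)) o -
        prediction μ κ (queryCoords ξ v (runHistory ξ n (X ω) (f ω)))
          (fun k o => frameObs (f ω) (v (runHistory ξ n (X ω) (f ω)))
            (queryAt (ξ (X ω)) (runHistory ξ n (X ω) (f ω)).2 k.castSucc) o) o|} ≤
      ENNReal.ofReal (C / N) / ENNReal.ofReal (ε ^ 2) := by
  classical
  have hN0 : (0 : ℝ) < N := Nat.cast_pos.2 hf.pos
  let A : History N n → Fin (n + 1) → Option (Fin p) → ℝ := fun q =>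
    innovationCoef κ (queryCoords ξ v q) o
  let m : History N n → ℝ := fun q => ∑ i : Fin (n + 1) × Option (Fin p),
    A q i.1 i.2 * jetMean μ (coordJet (queryCoords ξ v q i.1) i.2)
  let a : Eucl N → (Fin n → Option (Fin N) → ℝ) → Unit → Fin (n + 1) → Option (Fin N) → ℝ :=
    fun x d _ k => frameCoef (v (x, d)) (A (x, d) k)
  have hAm : ∀ k o', Measurable fun q => A q k o' := fun k o' =>
    (measurable_innovationCoef (hall p) o k o').comp hA.measurable_queryCoords
  have hm : Measurable m := Finset.measurable_sum _ fun i _ => (hAm _ _).mul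
    ((continuous_jetMean_coordJet hf.mean i.2).measurable.comp
      ((measurable_pi_apply i.1).comp hA.measurable_queryCoords))
  have ha : Measurable fun q : History N n => a q.1 q.2 := by
    refine measurable_pi_lambda _ fun _ => measurable_pi_lambda _ fun k =>
      measurable_pi_lambda _ fun j => ?_
    cases j with
    | none => exact hAm k none
    | some j =>
      refine Finset.measurable_sum _ fun i _ => ?_
      have h1 := hAm k (some i)
      have h2 := (measurable_eucl_apply j).comp (hA.measurable_frame i)
      exact h1.mul h2
  have hL : ∀ (q : History N n) (g : Eucl N → ℝ),
      queryFunctional (ξ q.1) (a q.1) q.2 (gradObs g) () =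
        ∑ i : Fin (n + 1) × Option (Fin p), A q i.1 i.2 *
          (frameJet (v q) (queryAt (ξ q.1) q.2 i.1) i.2).eval g := by
    intro q g
    rw [queryFunctional, Fintype.sum_prod_type]
    refine Finset.sum_congr rfl fun k _ => ?_
    exact sum_frameCoef _ _ _ _
  -- The cut-off to `B` restricts the integral to histories for which the system is orthonormal,
  -- contains the queries and separates them.
  let Φ : Eucl N → (Fin n → Option (Fin N) → ℝ) → (Unit → ℝ) → ENNReal := fun x d l =>
    if (x, d) ∈ B then ENNReal.ofReal ((l () - m (x, d)) ^ 2) else 0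
  have hΦ : Measurable fun p : History N n × (Unit → ℝ) => Φ p.1.1 p.1.2 p.2 := by
    refine Measurable.ite (measurable_fst hA.measurableSet) ?_ measurable_const
    exact ((((measurable_pi_apply ()).comp measurable_snd).sub (hm.comp measurable_fst)).pow_const
      2).ennreal_ofReal
  have hfreeze := lintegral_queryFunctional_of_indepFun hf.isGaussianPath hX (hf.indepFun_path hXf)
    hA.measurable_rule ha (B := fun x => {d | (x, d) ∈ B}) (fun x d hd _ l j => ?_) hΦ
    (fun x d hd l => if_neg hd)
  · have hlhs : ∀ ω, (if runHistory ξ n (X ω) (f ω) ∈ B then ENNReal.ofReal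
      ((frameObs (f ω) (v (runHistory ξ n (X ω) (f ω)))
          (queryAt (ξ (X ω)) (runHistory ξ n (X ω) (f ω)).2 (Fin.last n)) o -
        prediction μ κ (queryCoords ξ v (runHistory ξ n (X ω) (f ω)))
          (fun k o => frameObs (f ω) (v (runHistory ξ n (X ω) (f ω)))
            (queryAt (ξ (X ω)) (runHistory ξ n (X ω) (f ω)).2 k.castSucc) o) o) ^ 2) else 0) =
        Φ (X ω) (fun i => adaptiveObs (ξ (X ω)) (hf.path ω).1 i)
          (queryFunctional (ξ (X ω)) (a (X ω))
            (fun i => adaptiveObs (ξ (X ω)) (hf.path ω).1 i) (hf.path ω).1) := by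
      intro ω
      have h1 := hL (runHistory ξ n (X ω) (f ω)) (f ω)
      change _ = if runHistory ξ n (X ω) (f ω) ∈ B then ENNReal.ofReal
        ((queryFunctional (ξ (X ω)) (a (X ω)) (runHistory ξ n (X ω) (f ω)).2 (gradObs (f ω)) () -
          m (runHistory ξ n (X ω) (f ω))) ^ 2) else 0
      split_ifs
      · rw [frameObs_sub_prediction (x := queryAt (ξ (X ω)) (runHistory ξ n (X ω) (f ω)).2)]
        rw [show queryFunctional (ξ (X ω)) (a (X ω)) (runHistory ξ n (X ω) (f ω)).2
          (gradObs (f ω)) () = _ from h1]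
        rfl
      · rfl
    refine measure_le_of_lintegral_sq (S := {ω | runHistory ξ n (X ω) (f ω) ∈ B}) ?_ ?_ hε
    · exact (funext hlhs).symm ▸ hA.measurable_functional hf hX ha hΦ
    refine (lintegral_congr hlhs).trans_le ?_
    -- With the history frozen, the inner integral is a variance at fixed points, at most `C / N` on
    -- `B`.
    rw [hfreeze]
    refine (lintegral_mono fun ω => ?_).trans_eq ((lintegral_const (ENNReal.ofReal (C / N))).trans
      (by rw [measure_univ, mul_one]))
    set q := runHistory ξ n (X ω) (f ω) with hq
    change ∫⁻ ω', (if q ∈ B then ENNReal.ofReal ((queryFunctional (ξ q.1) (a q.1) q.2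
      (gradObs (f ω')) () - m q) ^ 2) else 0) ∂P ≤ _
    split_ifs with hB
    · simp_rw [hL]
      have hLm : MemLp (fun ω' => ∑ i : Fin (n + 1) × Option (Fin p), A q i.1 i.2 *
          (frameJet (v q) (queryAt (ξ q.1) q.2 i.1) i.2).eval (f ω')) 2 P := hf.memLp_sum_eval _ _
      have hmean : m q = ∫ ω', ∑ i : Fin (n + 1) × Option (Fin p), A q i.1 i.2 *
          (frameJet (v q) (queryAt (ξ q.1) q.2 i.1) i.2).eval (f ω') ∂P := by
        rw [hf.integral_sum_eval]
        refine Finset.sum_congr rfl fun i _ => ?_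
        rw [jetMean_frameJet (hA.orthonormal q hB) (hA.mem_span q hB i.1)]
        rfl
      have hint := (hLm.sub (memLp_const (m q))).integrable_sq
      simp only [Pi.sub_apply] at hint
      rw [← ofReal_integral_eq_lintegral_ofReal hint (ae_of_all _ fun ω => sq_nonneg _)]
      refine ENNReal.ofReal_le_ofReal ?_
      have h2 := hf.variance_innovation_le hall (hA.orthonormal q hB) (hA.mem_span q hB)
        (hA.injective q hB) o
      rw [hmean]
      refine ((variance_eq_integral hLm.aemeasurable).symm.trans_le h2).trans ?_
      rw [one_div, div_eq_inv_mul]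
      exact mul_le_mul_of_nonneg_left (hC q hB) (by positivity)
    · simp
  · change cov[fun ω => queryFunctional (ξ x) (a x) d (gradObs (f ω)) (),
      fun ω => gradObs (f ω) (queryAt (ξ x) d l.castSucc) j; P] = 0
    simp_rw [hL (x, d), ← coordJet_eval]
    have h := hf.cov_innovation hall (hA.orthonormal (x, d) hd) (hA.mem_span (x, d) hd)
        (hA.injective (x, d) hd) o l
    cases j
    · exact h _ _
    · exact h _ _

open Classical in
/-- The normal residual can be computed with frozen queries. -/
lemma IsAdaptiveFrame.lintegral_normalResidual (hA : IsAdaptiveFrame ξ v B)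
    (hf : IsSmoothGRF μ κ P f) (hall : ∀ M, IsSmoothKernel κ M) {X : Ω → Eucl N}
    (hX : Measurable X) (hXf : IndepFun X f P) {φ : Eucl N × ℝ → ENNReal} (hφ : Measurable φ) :
    Measurable (fun ω => if runHistory ξ n (X ω) (f ω) ∈ B then
      φ (normalResidual κ (v (runHistory ξ n (X ω) (f ω)))
          (queryAt (ξ (X ω)) (runHistory ξ n (X ω) (f ω)).2) (f ω),
        normalVar κ (queryCoords ξ v (runHistory ξ n (X ω) (f ω)))) else 0) ∧
    ∫⁻ ω, (if runHistory ξ n (X ω) (f ω) ∈ B then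
      φ (normalResidual κ (v (runHistory ξ n (X ω) (f ω)))
          (queryAt (ξ (X ω)) (runHistory ξ n (X ω) (f ω)).2) (f ω),
        normalVar κ (queryCoords ξ v (runHistory ξ n (X ω) (f ω)))) else 0) ∂P =
    ∫⁻ ω, ∫⁻ ω', (if runHistory ξ n (X ω) (f ω) ∈ B then
      φ (normalResidual κ (v (runHistory ξ n (X ω) (f ω)))
          (queryAt (ξ (X ω)) (runHistory ξ n (X ω) (f ω)).2) (f ω'),
        normalVar κ (queryCoords ξ v (runHistory ξ n (X ω) (f ω)))) else 0) ∂P ∂P := by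
  let β : History N n → Fin (n + 1) → ℝ := fun q => residualCoef (normalCoef κ (queryCoords ξ v q))
  let a : Eucl N → (Fin n → Option (Fin N) → ℝ) → Fin N → Fin (n + 1) → Option (Fin N) → ℝ :=
    fun x d t => residualCoefs (β (x, d)) (v (x, d)) t
  have hβ : ∀ k, Measurable fun q => β q k := by
    intro k
    refine Fin.lastCases ?_ (fun k => ?_) k
    · simp only [β, residualCoef, Fin.snoc_last]
      exact measurable_const
    · simp only [β, residualCoef, Fin.snoc_castSucc]
      exact (((hall (p + 1)).measurable_normalCoef k).comp hA.measurable_queryCoords).neg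
  have ha : Measurable fun q : History N n => a q.1 q.2 := by
    refine measurable_pi_lambda _ fun t => measurable_pi_lambda _ fun k =>
      measurable_pi_lambda _ fun j => ?_
    cases j with
    | none => exact measurable_const
    | some j =>
      refine (hβ k).mul ((measurable_eucl_apply j).comp (measurable_const.sub
        (Finset.measurable_sum _ fun i _ => ?_)))
      have h1 : Measurable fun q => inner ℝ (v q i) (EuclideanSpace.single t 1) :=
        (hA.measurable_frame i).inner measurable_const
      exact h1.smul (hA.measurable_frame i)
  have hL : ∀ (q : History N n) (g : Eucl N → ℝ),
      queryFunctional (ξ q.1) (a q.1) q.2 (gradObs g) =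
        normalResidual κ (v q) (queryAt (ξ q.1) q.2) g := by
    intro q g
    ext t
    exact sum_residualCoefs (v q) t (queryAt (ξ q.1) q.2) g
  have hs : Measurable fun q => normalVar κ (queryCoords ξ v q) :=
    (hall (p + 1)).measurable_normalVar.comp hA.measurable_queryCoords
  let Φ : Eucl N → (Fin n → Option (Fin N) → ℝ) → (Fin N → ℝ) → ENNReal := fun x d l =>
    if (x, d) ∈ B then φ (WithLp.toLp 2 l, normalVar κ (queryCoords ξ v (x, d))) else 0
  have hΦ : Measurable fun p : History N n × (Fin N → ℝ) => Φ p.1.1 p.1.2 p.2 := by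
    refine Measurable.ite (measurable_fst hA.measurableSet) ?_ measurable_const
    exact hφ.comp (((WithLp.measurable_toLp 2 (Fin N → ℝ)).comp measurable_snd).prodMk
      (hs.comp measurable_fst))
  have hfreeze := lintegral_queryFunctional_of_indepFun hf.isGaussianPath hX (hf.indepFun_path hXf)
    hA.measurable_rule ha (B := fun x => {d | (x, d) ∈ B}) (fun x d hd t l j => ?_) hΦ
    (fun x d hd l => if_neg hd)
  · have hΦL : ∀ ω ω', (if runHistory ξ n (X ω) (f ω) ∈ B then
      φ (normalResidual κ (v (runHistory ξ n (X ω) (f ω)))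
          (queryAt (ξ (X ω)) (runHistory ξ n (X ω) (f ω)).2) (f ω'),
        normalVar κ (queryCoords ξ v (runHistory ξ n (X ω) (f ω)))) else 0) =
        Φ (X ω) (fun i => adaptiveObs (ξ (X ω)) (hf.path ω).1 i)
          (queryFunctional (ξ (X ω)) (a (X ω))
            (fun i => adaptiveObs (ξ (X ω)) (hf.path ω).1 i) (hf.path ω').1) := by
      intro ω ω'
      change _ = if runHistory ξ n (X ω) (f ω) ∈ B then φ (WithLp.toLp 2
        (queryFunctional (ξ (runHistory ξ n (X ω) (f ω)).1) (a (runHistory ξ n (X ω) (f ω)).1)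
          (runHistory ξ n (X ω) (f ω)).2 (gradObs (f ω'))),
          normalVar κ (queryCoords ξ v (runHistory ξ n (X ω) (f ω)))) else 0
      rw [hL]
      rfl
    refine ⟨(funext fun ω => hΦL ω ω).symm ▸ hA.measurable_functional hf hX ha hΦ, ?_⟩
    rw [lintegral_congr fun ω => hΦL ω ω, hfreeze]
    exact lintegral_congr fun ω => lintegral_congr fun ω' => (hΦL ω ω').symm
  · change cov[fun ω => queryFunctional (ξ x) (a x) d (gradObs (f ω)) t,
      fun ω => gradObs (f ω) (queryAt (ξ x) d l.castSucc) j; P] = 0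
    have hB := hA.orthonormal (x, d) hd
    have h1 : ∀ ω, queryFunctional (ξ x) (a x) d (gradObs (f ω)) t =
        ∑ k, β (x, d) k * (⟨queryAt (ξ x) d k, 0,
          frameCompl (v (x, d)) (EuclideanSpace.single t 1)⟩ : Jet (Eucl N)).eval (f ω) := fun ω =>
      sum_residualCoefs_eval (β (x, d)) (v (x, d)) t (queryAt (ξ x) d) (f ω)
    simp_rw [h1, ← coordJet_eval]
    have h := hf.cov_normalResidual hall hB (hA.mem_span (x, d) hd)
        (hA.injective (x, d) hd) (frameCompl_mem hB (EuclideanSpace.single t 1)) l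
    cases j
    · exact h _ _
    · exact h _ _

/-- Freezing reduces the second moment to the bound at fixed points, and Chebyshev's inequality
finishes. The constant `C` makes the bound uniform over the admissible histories. -/
lemma IsAdaptiveFrame.measure_norm_sq_le (hA : IsAdaptiveFrame ξ v B)
    (hf : IsSmoothGRF μ κ P f) (hall : ∀ M, IsSmoothKernel κ M) {X : Ω → Eucl N}
    (hX : Measurable X) (hXf : IndepFun X f P) {C : ℝ}
    (hC : ∀ q ∈ B, normalVar κ (queryCoords ξ v q) ≤ C) {ε : ℝ} (hε : 0 < ε) :
    P {ω | runHistory ξ n (X ω) (f ω) ∈ B ∧ ε ≤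
      |‖normalResidual κ (v (runHistory ξ n (X ω) (f ω)))
          (queryAt (ξ (X ω)) (runHistory ξ n (X ω) (f ω)).2) (f ω)‖ ^ 2 -
        normalVar κ (queryCoords ξ v (runHistory ξ n (X ω) (f ω)))|} ≤
      ENNReal.ofReal (C ^ 2 * (squareVar + p ^ 2) / N) / ENNReal.ofReal (ε ^ 2) := by
  classical
  have hφ : Measurable fun z : Eucl N × ℝ => ENNReal.ofReal ((‖z.1‖ ^ 2 - z.2) ^ 2) := by fun_prop
  have hres := hA.lintegral_normalResidual hf hall hX hXf hφ
  refine measure_le_of_lintegral_sq (S := {ω | runHistory ξ n (X ω) (f ω) ∈ B}) hres.1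
    (hres.2.trans_le ?_) hε
  refine (lintegral_mono fun ω => ?_).trans_eq ((lintegral_const _).trans
      (by rw [measure_univ, mul_one]))
  split_ifs with hB
  · refine (hf.lintegral_normalResidual_le hall (hA.orthonormal _ hB) (hA.mem_span _ hB)
      (hA.injective _ hB)).trans (ENNReal.ofReal_le_ofReal ?_)
    have h1 := (hall (p + 1)).normalVar_pos (hA.injective _ hB)
    have := squareVar_nonneg
    have h2 := pow_le_pow_left₀ h1.le (hC _ hB) 2
    gcongr
  · simp

/-- The normal residual does not vanish. -/
lemma IsAdaptiveFrame.measure_normalResidual_eq_zero (hA : IsAdaptiveFrame ξ v B)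
    (hf : IsSmoothGRF μ κ P f) (hall : ∀ M, IsSmoothKernel κ M) {X : Ω → Eucl N}
    (hX : Measurable X) (hXf : IndepFun X f P) (hp : p < N) :
    P {ω | runHistory ξ n (X ω) (f ω) ∈ B ∧ normalResidual κ (v (runHistory ξ n (X ω) (f ω)))
          (queryAt (ξ (X ω)) (runHistory ξ n (X ω) (f ω)).2) (f ω) = 0} = 0 := by
  classical
  -- With the indicator of a vanishing residual the frozen integral is a probability, and this is
  -- zero for each fixed admissible history.
  have hφ : Measurable fun z : Eucl N × ℝ => if z.1 = 0 then (1 : ENNReal) else 0 :=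
    Measurable.ite (measurable_fst (measurableSet_singleton 0)) measurable_const measurable_const
  obtain ⟨hm, h⟩ := hA.lintegral_normalResidual hf hall hX hXf hφ
  have h0 : ∀ ω, ∫⁻ ω', (if runHistory ξ n (X ω) (f ω) ∈ B then
      (if normalResidual κ (v (runHistory ξ n (X ω) (f ω)))
          (queryAt (ξ (X ω)) (runHistory ξ n (X ω) (f ω)).2) (f ω') = 0 then (1 : ENNReal) else 0)
        else 0) ∂P = 0 := by
    intro ω
    by_cases hB : runHistory ξ n (X ω) (f ω) ∈ B
    · have h1 := hf.measure_normalResidual_eq_zero hall (hA.orthonormal _ hB) (hA.mem_span _ hB)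
        (hA.injective _ hB) hp
      refine (lintegral_congr_ae ?_).trans lintegral_zero
      filter_upwards [measure_eq_zero_iff_ae_notMem.1 h1] with ω' h'
      rw [if_pos hB]
      exact if_neg h'
    · simp [hB]
  have h2 := (h.trans (lintegral_congr h0)).trans lintegral_zero
  rw [lintegral_eq_zero_iff hm] at h2
  rw [measure_eq_zero_iff_ae_notMem]
  filter_upwards [h2] with ω hω hc
  rw [if_pos hc.1] at hω
  exact one_ne_zero ((if_pos hc.2).symm.trans hω)

end Adaptive

/-! ### The algorithm as a selection rule -/

section Rule

variable {N : ℕ}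

/-- The function values of a history. -/
def histVal {n : ℕ} (d : Fin n → Option (Fin N) → ℝ) (k : ℕ) : ℝ :=
  if h : k < n then d ⟨k, h⟩ none else 0

/-- The gradients of a history. -/
noncomputable def histGrad {n : ℕ} (d : Fin n → Option (Fin N) → ℝ) (k : ℕ) : Eucl N :=
  if h : k < n then WithLp.toLp 2 fun i => d ⟨k, h⟩ (some i) else 0

/-- The information computed from function values and gradients. -/
noncomputable def dataInfo (x₀ : Eucl N) (fv : ℕ → ℝ) (gv : ℕ → Eucl N) (n : ℕ) : Info n :=
  (fun k => fv k, fun i j => inner ℝ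
    ((Fin.cons x₀ fun k : Fin (n + 1) => gv k : Fin (n + 2) → Eucl N) i)
    ((Fin.cons x₀ fun k : Fin (n + 1) => gv k : Fin (n + 2) → Eucl N) j))

/-- The points computed from function values and gradients. -/
noncomputable def GSA.dataPoint (G : GSA) (x₀ : Eucl N) (fv : ℕ → ℝ) (gv : ℕ → Eucl N) :
    ℕ → Eucl N
  | 0 => x₀
  | n + 1 => G.hx n (dataInfo x₀ fv gv n) • x₀ +
      ∑ k : Fin (n + 1), G.hg n (dataInfo x₀ fv gv n) k • gv k

/-- The selection rule of the algorithm. -/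
noncomputable def GSA.rule (G : GSA) (x₀ : Eucl N) (k : ℕ) (d : Fin k → Option (Fin N) → ℝ) :
    Eucl N := G.dataPoint x₀ (histVal d) (histGrad d) k

variable (G : GSA)

lemma dataInfo_congr {x₀ : Eucl N} {fv fv' : ℕ → ℝ} {gv gv' : ℕ → Eucl N} {n : ℕ}
    (hf : ∀ k ≤ n, fv k = fv' k) (hg : ∀ k ≤ n, gv k = gv' k) :
    dataInfo x₀ fv gv n = dataInfo x₀ fv' gv' n := by
  have h1 : (fun k : Fin (n + 1) => fv k) = fun k : Fin (n + 1) => fv' k :=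
    funext fun k => hf k (Nat.lt_succ_iff.1 k.isLt)
  have h2 : (fun k : Fin (n + 1) => gv k) = fun k : Fin (n + 1) => gv' k :=
    funext fun k => hg k (Nat.lt_succ_iff.1 k.isLt)
  rw [dataInfo, dataInfo, h1, h2]

lemma GSA.dataPoint_congr {x₀ : Eucl N} {fv fv' : ℕ → ℝ} {gv gv' : ℕ → Eucl N} {k : ℕ}
    (hf : ∀ j < k, fv j = fv' j) (hg : ∀ j < k, gv j = gv' j) :
    G.dataPoint x₀ fv gv k = G.dataPoint x₀ fv' gv' k := by
  cases k with
  | zero => rfl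
  | succ n =>
    have h : dataInfo x₀ fv gv n = dataInfo x₀ fv' gv' n :=
      dataInfo_congr (fun j hj => hf j (by omega)) (fun j hj => hg j (by omega))
    have h2 : ∀ j : Fin (n + 1), gv j = gv' j := fun j => hg j j.isLt
    simp only [GSA.dataPoint, h, h2]

lemma GSA.point_eq_dataPoint (f : Eucl N → ℝ) (x₀ : Eucl N) (k : ℕ) :
    G.point f x₀ k = G.dataPoint x₀ (fun j => f (G.point f x₀ j)) (G.grads f x₀) k := by
  cases k with
  | zero => exact G.point_zero f x₀
  | succ n => rw [G.point_succ]; rfl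

lemma GSA.rule_eq_point (f : Eucl N → ℝ) (x₀ : Eucl N) (k : ℕ) :
    G.rule x₀ k (fun i => gradObs f (G.point f x₀ i)) = G.point f x₀ k := by
  rw [G.point_eq_dataPoint f x₀ k, GSA.rule]
  refine G.dataPoint_congr (fun j hj => ?_) (fun j hj => ?_)
  · simp [histVal, hj, gradObs]
  · simp only [histGrad, hj, dif_pos, gradObs]
    rfl

/-- This identifies the run of the algorithm with an abstract adaptive observation scheme, to which
the freezing theorem applies. -/
lemma GSA.adaptiveObs_rule (f : Eucl N → ℝ) (x₀ : Eucl N) (k : ℕ) :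
    adaptiveObs (G.rule x₀) (gradObs f) k = gradObs f (G.point f x₀ k) := by
  induction k using Nat.strong_induction_on with
  | _ k ih =>
    rw [adaptiveObs_eq]
    have h : (fun i : Fin k => adaptiveObs (G.rule x₀) (gradObs f) i) =
        fun i : Fin k => gradObs f (G.point f x₀ i) := funext fun i => ih i i.isLt
    rw [h, G.rule_eq_point]

lemma GSA.runHistory_rule (f : Eucl N → ℝ) (x₀ : Eucl N) (n : ℕ) :
    runHistory G.rule n x₀ f = (x₀, fun i : Fin n => gradObs f (G.point f x₀ i)) := by
  unfold runHistory
  simp_rw [G.adaptiveObs_rule]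

lemma GSA.queryAt_rule (f : Eucl N → ℝ) (x₀ : Eucl N) {n : ℕ} (k : Fin (n + 1)) :
    queryAt (G.rule x₀) (runHistory G.rule n x₀ f).2 k = G.point f x₀ k := by
  rw [G.runHistory_rule]
  exact G.rule_eq_point f x₀ k

/-- The Gram-Schmidt vectors of a history. -/
noncomputable def histFrame (δ n : ℕ) (q : History N n) (i : Fin (n + δ)) : Eucl N :=
  gsVec δ q.1 (histGrad q.2) i

lemma GSA.histFrame_rule (f : Eucl N → ℝ) (x₀ : Eucl N) (δ n : ℕ) :
    histFrame δ n (runHistory G.rule n x₀ f) =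
      fun i : Fin (n + δ) => gsVec δ x₀ (G.grads f x₀) i := by
  ext1 i
  rw [G.runHistory_rule]
  refine gsVec_congr _ (m := n) (fun k hk => ?_) i.isLt
  simp only [histGrad, hk, dif_pos, gradObs]
  rfl

/-- The histories with linearly independent gradients and different points. -/
def GSA.goodHistories (G : GSA) (N δ n : ℕ) : Set (History N n) :=
  {q | (δ = 0 → q.1 = 0) ∧ (∀ i j, inner ℝ (histFrame δ n q i) (histFrame δ n q j) =
    if i = j then (1 : ℝ) else 0) ∧
    ∀ k l, k ≠ l → queryCoords G.rule (histFrame δ n) q k ≠ queryCoords G.rule (histFrame δ n) q l}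

/-- Gram-Schmidt preserves spans even if some vectors are dependent and produce zeros, so no rank
condition on the history is needed. -/
lemma gradSeq_mem_span {δ p : ℕ} {x₀ : Eucl N} {g : ℕ → Eucl N} {i : ℕ} (hi : i < p) :
    gradSeq δ x₀ g i ∈ Submodule.span ℝ (Set.range fun i : Fin p => gsVec δ x₀ g i) := by
  have h : Submodule.span ℝ (Set.range fun i : Fin p => gsVec δ x₀ g i) =
      Submodule.span ℝ (gradSeq δ x₀ g '' Set.Iio p) := by
    rw [← InnerProductSpace.span_gramSchmidt_Iio, ← InnerProductSpace.span_gramSchmidtNormed]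
    congr 1
    ext x
    constructor
    · rintro ⟨i, rfl⟩
      exact ⟨i, i.isLt, rfl⟩
    · rintro ⟨i, hi, rfl⟩
      exact ⟨⟨i, hi⟩, rfl⟩
  rw [h]
  exact Submodule.subset_span ⟨i, hi, rfl⟩

lemma GSA.dataPoint_mem {S : Submodule ℝ (Eucl N)} {x₀ : Eucl N} {fv : ℕ → ℝ} {gv : ℕ → Eucl N}
    {k : ℕ} (hx : x₀ ∈ S) (hg : ∀ j < k, gv j ∈ S) : G.dataPoint x₀ fv gv k ∈ S := by
  cases k with
  | zero => exact hx
  | succ n => exact S.add_mem (S.smul_mem _ hx) (S.sum_mem fun j _ => S.smul_mem _ (hg j j.isLt))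

/-! ### Measurable dependence on the history -/

section Measurability

variable {A : Type*} [MeasurableSpace A] {x₀ : A → Eucl N} {fv : A → ℕ → ℝ} {gv : A → ℕ → Eucl N}

lemma measurable_dataInfo (hx : Measurable x₀) (hf : ∀ k, Measurable fun a => fv a k)
    (hg : ∀ k, Measurable fun a => gv a k) (n : ℕ) :
    Measurable fun a => dataInfo (x₀ a) (fv a) (gv a) n := by
  have h : ∀ i, Measurable fun a =>
      (Fin.cons (x₀ a) fun k : Fin (n + 1) => gv a k : Fin (n + 2) → Eucl N) i := fun i => by
    refine Fin.cases ?_ (fun i => ?_) i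
    · exact hx
    · exact hg i
  refine Measurable.prodMk (measurable_pi_lambda _ fun k => hf k)
    (measurable_pi_lambda _ fun i => measurable_pi_lambda _ fun j => (h i).inner (h j))

variable {G} in
lemma GSA.MeasurablePrefactors.measurable_dataPoint (hG : G.MeasurablePrefactors)
    (hx : Measurable x₀) (hf : ∀ k, Measurable fun a => fv a k)
    (hg : ∀ k, Measurable fun a => gv a k) (k : ℕ) :
    Measurable fun a => G.dataPoint (x₀ a) (fv a) (gv a) k := by
  cases k with
  | zero => exact hx
  | succ n =>
    have hI := measurable_dataInfo hx hf hg n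
    have h1 : Measurable fun a => G.hx n (dataInfo (x₀ a) (fv a) (gv a) n) := (hG n).1.comp hI
    have h2 : ∀ j, Measurable fun a => G.hg n (dataInfo (x₀ a) (fv a) (gv a) n) j := fun j =>
      (measurable_pi_apply j).comp ((hG n).2.comp hI)
    have h3 : ∀ j : Fin (n + 1), Measurable fun a =>
        G.hg n (dataInfo (x₀ a) (fv a) (gv a) n) j • gv a j := fun j => (h2 j).smul (hg j)
    exact (h1.smul hx).add (Finset.measurable_sum _ fun j _ => h3 j)

lemma measurable_gramSchmidt {s : A → ℕ → Eucl N} (hs : ∀ i, Measurable fun a => s a i) (i : ℕ) :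
    Measurable fun a => InnerProductSpace.gramSchmidt ℝ (s a) i := by
  induction i using Nat.strong_induction_on with
  | _ i ih =>
    simp_rw [InnerProductSpace.gramSchmidt_def ℝ _ i, Submodule.starProjection_singleton]
    refine (hs i).sub (Finset.measurable_sum _ fun j hj => ?_)
    have h1 := ih j (Finset.mem_Iio.1 hj)
    have h2 : Measurable fun a => inner ℝ (InnerProductSpace.gramSchmidt ℝ (s a) j) (s a i) /
        ((‖InnerProductSpace.gramSchmidt ℝ (s a) j‖ ^ 2 : ℝ) : ℝ) :=
      (h1.inner (hs i)).div (h1.norm.pow_const 2)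
    exact h2.smul h1

lemma measurable_gsVec (δ : ℕ) (hx : Measurable x₀) (hg : ∀ k, Measurable fun a => gv a k) (i : ℕ) :
    Measurable fun a => gsVec δ (x₀ a) (gv a) i := by
  have h1 := measurable_gramSchmidt (s := fun a => gradSeq δ (x₀ a) (gv a)) (fun i => by
    unfold gradSeq
    split_ifs
    · exact hx
    · exact hg _) i
  have h2 : Measurable fun a =>
      (‖InnerProductSpace.gramSchmidt ℝ (gradSeq δ (x₀ a) (gv a)) i‖)⁻¹ := h1.norm.inv
  exact h2.smul h1

lemma measurable_histVal {n : ℕ} (k : ℕ) :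
    Measurable fun d : Fin n → Option (Fin N) → ℝ => histVal d k := by
  unfold histVal
  split_ifs
  · fun_prop
  · fun_prop

lemma measurable_histGrad {n : ℕ} (k : ℕ) :
    Measurable fun d : Fin n → Option (Fin N) → ℝ => histGrad d k := by
  unfold histGrad
  split_ifs
  · refine measurable_eucl fun i => ?_
    simp only
    fun_prop
  · fun_prop

end Measurability

variable {G} in
-- Orthonormality and separation are built into the set of good histories; membership in the span
-- holds because points are combinations of the start and of gradients, which are all in the span.
lemma GSA.MeasurablePrefactors.isAdaptiveFrame (hG : G.MeasurablePrefactors) (δ n : ℕ) :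
    IsAdaptiveFrame G.rule (histFrame δ n) (G.goodHistories N δ n) := by
  -- On the empty set only measurability is claimed; it is needed first, to show that the set of
  -- good histories is measurable.
  have hm0 : IsAdaptiveFrame G.rule (histFrame δ n) (∅ : Set (History N n)) := by
    refine ⟨fun k => ?_, fun i => ?_, MeasurableSet.empty, ?_, ?_, ?_⟩
    · exact hG.measurable_dataPoint measurable_fst (fun j => (measurable_histVal j).comp measurable_snd)
        (fun j => (measurable_histGrad j).comp measurable_snd) k
    · exact measurable_gsVec δ measurable_fst (fun j => (measurable_histGrad j).comp measurable_snd) i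
    all_goals exact fun q hq => hq.elim
  have hmem : ∀ q ∈ G.goodHistories N δ n, ∀ k : Fin (n + 1),
      queryAt (G.rule q.1) q.2 k ∈ Submodule.span ℝ (Set.range (histFrame δ n q)) := by
    intro q hq k
    refine G.dataPoint_mem ?_ fun j hj => ?_
    -- For `δ = 0` the start is not among the orthonormalized vectors and lies in their span only
    -- because it is zero.
    · by_cases hδ : δ = 0
      · rw [hq.1 hδ]
        exact Submodule.zero_mem _
      · have h := gradSeq_mem_span (δ := δ) (x₀ := q.1) (g := histGrad q.2) (p := n + δ) (i := 0)
          (by omega)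
        rwa [gradSeq, if_pos (by omega)] at h
    · have hk := k.isLt
      have h := gradSeq_mem_span (δ := δ) (x₀ := q.1) (g := histGrad q.2) (p := n + δ) (i := j + δ)
          (by omega)
      rw [gradSeq, if_neg (by omega), Nat.add_sub_cancel] at h
      convert h using 1
      · rfl
      · unfold histGrad
        rw [dif_pos hj, dif_pos (by omega)]
  refine ⟨hm0.measurable_rule, hm0.measurable_frame, ?_, fun q hq => ?_, hmem, fun q hq => ?_⟩
  · have h1 : MeasurableSet {q : History N n | δ = 0 → q.1 = 0} := by
      by_cases h : δ = 0
      · have h1 : MeasurableSet {q : History N n | q.1 = 0} :=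
          measurable_fst (measurableSet_singleton (0 : Eucl N))
        simpa [h] using h1
      · simp [h]
    have h2 : ∀ i j, MeasurableSet {q : History N n | inner ℝ (histFrame δ n q i)
        (histFrame δ n q j) = if i = j then (1 : ℝ) else 0} := fun i j =>
      measurableSet_eq_fun ((hm0.measurable_frame i).inner (hm0.measurable_frame j))
        measurable_const
    have hc := hm0.measurable_queryCoords
    have h3 : ∀ k l, MeasurableSet {q : History N n | queryCoords G.rule (histFrame δ n) q k =
        queryCoords G.rule (histFrame δ n) q l} := fun k l =>
      measurableSet_eq_fun ((measurable_pi_apply k).comp hc) ((measurable_pi_apply l).comp hc)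
    have h4 : G.goodHistories N δ n = {q : History N n | δ = 0 → q.1 = 0} ∩
        ((⋂ i, ⋂ j, {q : History N n | inner ℝ (histFrame δ n q i)
          (histFrame δ n q j) = if i = j then (1 : ℝ) else 0}) ∩
        ⋂ k, ⋂ l, ⋂ _ : k ≠ l, {q : History N n | queryCoords G.rule (histFrame δ n) q k =
          queryCoords G.rule (histFrame δ n) q l}ᶜ) := by
      ext q
      simp only [GSA.goodHistories, Set.mem_inter_iff, Set.mem_iInter, Set.mem_compl_iff,
        Set.mem_ofPred_eq]
    rw [h4]
    exact h1.inter ((MeasurableSet.iInter fun i => MeasurableSet.iInter fun j => h2 i j).inter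
      (MeasurableSet.iInter fun k => MeasurableSet.iInter fun l => MeasurableSet.iInter fun _ =>
        (h3 k l).compl))
  · exact orthonormal_iff_ite.2 hq.2.1
  · intro k l hkl
    by_contra h
    exact hq.2.2 k l h hkl

/-! ### Good histories and residuals of an actual run -/

section Run

variable {G} {f : Eucl N → ℝ} {x₀ : Eucl N} {δ n : ℕ} (hδ : δ = if x₀ = 0 then 0 else 1)

variable (G f x₀ δ n) in
/-- The coordinates of the points of a run with respect to the Gram-Schmidt vectors. -/
noncomputable def GSA.pointCoords (k : Fin (n + 1)) : Eucl (n + δ) :=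
  frameCoord (fun i : Fin (n + δ) => gsVec δ x₀ (G.grads f x₀) i) (G.point f x₀ k)

lemma GSA.queryCoords_rule : queryCoords G.rule (histFrame δ n) (runHistory G.rule n x₀ f) =
    G.pointCoords f x₀ δ n := by
  ext1 k
  rw [queryCoords, G.histFrame_rule]
  exact congrArg _ (G.queryAt_rule f x₀ k)

include hδ in
lemma GSA.FullRank.runHistory_mem (h : G.FullRank f x₀ n)
    (hinj : Function.Injective (G.pointCoords f x₀ δ n)) :
    runHistory G.rule n x₀ f ∈ G.goodHistories N δ n := by
  refine ⟨fun h0 => ?_, ?_, fun k l hkl => ?_⟩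
  · change x₀ = 0
    by_contra hx
    rw [if_neg hx] at hδ
    omega
  · rw [G.histFrame_rule]
    exact orthonormal_iff_ite.1 (h.orthonormal hδ)
  · rw [GSA.queryCoords_rule]
    exact fun hc => hkl (hinj hc)

include hδ in
-- Earlier gradients lie in `V_n` and are killed by the projection, and the newest one has
-- coefficient one. Hence the probabilistic residual is the Gram-Schmidt candidate, whatever the
-- regression coefficients are.
lemma GSA.FullRank.normalResidual_eq (κ : ℝ → ℝ → ℝ → ℝ) (h : G.FullRank f x₀ n) :
    normalResidual κ (histFrame δ n (runHistory G.rule n x₀ f))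
      (queryAt (G.rule x₀) (runHistory G.rule n x₀ f).2) f = G.candidate f x₀ n := by
  have hq : queryAt (G.rule x₀) (runHistory G.rule n x₀ f).2 = fun k : Fin (n + 1) =>
      G.point f x₀ k := funext fun k => G.queryAt_rule f x₀ k
  have ho := h.orthonormal hδ
  rw [hq, G.histFrame_rule, normalResidual, frameCompl_eq ho, h.span_eq hδ, Fin.sum_univ_castSucc]
  have hmem : ∑ k : Fin n, residualCoef (normalCoef κ fun k : Fin (n + 1) =>
      frameCoord (fun i : Fin (n + δ) => gsVec δ x₀ (G.grads f x₀) i) (G.point f x₀ k)) k.castSucc •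
      gradient f (G.point f x₀ k.castSucc) ∈ G.evalSpace f x₀ n :=
    Submodule.sum_mem _ fun k _ => Submodule.smul_mem _ _ (G.gradient_mem f x₀ k.isLt)
  rw [map_add, Submodule.starProjection_eq_self_iff.2 hmem, add_sub_add_left_eq_sub]
  simp only [residualCoef, Fin.snoc_last, one_smul]
  rfl

end Run

end Rule

/-! ### Evaluation points of a run with linearly independent gradients -/

section Run

variable {N : ℕ} {G : GSA} {f : Eucl N → ℝ} {x₀ : Eucl N} {δ n : ℕ}
  (hδ : δ = if x₀ = 0 then 0 else 1)

include hδ in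
-- The start and the earlier gradients lie in `V_k`, so only the newest gradient has a component in
-- the new direction.
lemma GSA.inner_point_gsVec (k : ℕ) :
    inner ℝ (G.point f x₀ (k + 1)) (gsVec δ x₀ (G.grads f x₀) (k + δ)) =
      G.hg k (G.info f x₀ k) (Fin.last k) * ‖G.candidate f x₀ k‖ := by
  rw [G.point_succ, inner_add_left, inner_smul_left,
    GSA.inner_gsVec_eq_zero hδ (G.start_mem f x₀ k) le_rfl, mul_zero, zero_add, sum_inner,
    Fin.sum_univ_castSucc, Finset.sum_eq_zero, zero_add, inner_smul_left, Fin.val_last]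
  · exact congrArg _ (GSA.inner_grads_gsVec hδ k)
  · intro i _
    have h := G.gradient_mem (k := (i.castSucc : ℕ)) (n := k) f x₀ i.isLt
    rw [inner_smul_left, GSA.inner_gsVec_eq_zero hδ h le_rfl, mul_zero]

include hδ in
-- The later of two points has a nonzero coordinate in the direction that its most recent gradient
-- contributes, and the earlier point has none.
lemma GSA.FullRank.injective_pointCoords (h : G.FullRank f x₀ n) (hG : G.UsesRecentGradient) :
    Function.Injective (G.pointCoords f x₀ δ n) := by
  have key : ∀ k l : Fin (n + 1), k < l →
      G.pointCoords f x₀ δ n k ≠ G.pointCoords f x₀ δ n l := by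
    intro k l hkl hc
    obtain ⟨j, hj⟩ : ∃ j, (l : ℕ) = j + 1 := ⟨l - 1, by have : (k : ℕ) < l := hkl; omega⟩
    have hl := l.isLt
    have hkl' : (k : ℕ) < l := hkl
    have h1 := congrArg (fun z : Eucl (n + δ) => z ⟨j + δ, by omega⟩) hc
    simp only [GSA.pointCoords, frameCoord] at h1
    rw [real_inner_comm, real_inner_comm (G.point f x₀ l), hj, GSA.inner_point_gsVec hδ,
      GSA.inner_gsVec_eq_zero hδ (G.point_mem f x₀ (le_refl (k : ℕ))) (by omega)] at h1
    exact mul_ne_zero (hG _ _) (norm_ne_zero_iff.2 (h j (by omega))) h1.symm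
  intro k l hkl
  rcases lt_trichotomy k l with hlt | heq | hgt
  · exact absurd hkl (key k l hlt)
  · exact heq
  · exact absurd hkl.symm (key l k hgt)

include hδ in
lemma GSA.inner_start_gsVec (i : ℕ) :
    inner ℝ x₀ (gsVec δ x₀ (G.grads f x₀) i) = if i < δ then ‖x₀‖ else 0 := by
  split_ifs with hi
  · have hx : x₀ ≠ 0 := fun hx => by
      rw [if_pos hx] at hδ; omega
    rw [if_neg hx] at hδ
    subst hδ
    obtain rfl : i = 0 := by omega
    have h0 : InnerProductSpace.gramSchmidt ℝ (gradSeq 1 x₀ (G.grads f x₀)) 0 = x₀ := by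
      rw [InnerProductSpace.gramSchmidt_def]
      simp [gradSeq]
    have hn : ‖x₀‖ ≠ 0 := norm_ne_zero_iff.2 hx
    rw [gsVec, InnerProductSpace.gramSchmidtNormed, h0, inner_smul_right,
      real_inner_self_eq_norm_sq]
    simp only [RCLike.ofReal_real_eq_id, id_eq]
    field_simp
  · exact GSA.inner_gsVec_eq_zero (k := 0) hδ (G.start_mem f x₀ 0) (by omega)

end Run

/-! ### The limits -/

section Limits

/-- The limit of the coordinates of the start. -/
noncomputable def startLimit (r : ℝ) (δ : ℕ) (i : ℕ) : ℝ := if i < δ then r else 0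

lemma startLimit_eq_zero {r : ℝ} {δ i : ℕ} (h : δ ≤ i) : startLimit r δ i = 0 :=
  if_neg (by omega)

/-- The limit of the information, if `fv` and `gv` are the limits of the function values and of the
coordinates of the gradients. -/
noncomputable def infoLimit (r : ℝ) (δ : ℕ) (fv : ℕ → ℝ) (gv : ℕ → ℕ → ℝ) (n : ℕ) : Info n :=
  (fun k => fv k, fun i j => ∑ l ∈ Finset.range (n + 1 + δ),
    (Fin.cons (startLimit r δ) fun k : Fin (n + 1) => gv k : Fin (n + 2) → ℕ → ℝ) i l *
    (Fin.cons (startLimit r δ) fun k : Fin (n + 1) => gv k : Fin (n + 2) → ℕ → ℝ) j l)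

/-- The limits of the coordinates of the evaluation points. -/
noncomputable def GSA.pointLimit (G : GSA) (r : ℝ) (δ : ℕ) (fv : ℕ → ℝ) (gv : ℕ → ℕ → ℝ) :
    ℕ → ℕ → ℝ
  | 0 => startLimit r δ
  | n + 1 => fun l => G.hx n (infoLimit r δ fv gv n) * startLimit r δ l +
      ∑ k : Fin (n + 1), G.hg n (infoLimit r δ fv gv n) k * gv k l

/-- The limits of the first points as vectors. -/
noncomputable def GSA.coordsLimit (G : GSA) (r : ℝ) (δ : ℕ) (fv : ℕ → ℝ) (gv : ℕ → ℕ → ℝ) (n : ℕ)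
    (k : Fin (n + 1)) : Eucl (n + δ) := WithLp.toLp 2 fun i => G.pointLimit r δ fv gv k i

/-- The limits of the observations at the earlier points. -/
def dataLimit (δ : ℕ) (fv : ℕ → ℝ) (gv : ℕ → ℕ → ℝ) (n : ℕ) (k : Fin n) :
    Option (Fin (n + δ)) → ℝ
  | none => fv k
  | some i => gv k i

/-- The limit of the observation at the next point. -/
noncomputable def GSA.obsLimit (G : GSA) (μ : ℝ → ℝ) (κ : ℝ → ℝ → ℝ → ℝ) (r : ℝ) (δ : ℕ)
    (fv : ℕ → ℝ) (gv : ℕ → ℕ → ℝ) (n : ℕ) : ℝ × (ℕ → ℝ) :=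
  (prediction μ κ (G.coordsLimit r δ fv gv n) (dataLimit δ fv gv n) none,
    fun i => if h : i < n + δ then
      prediction μ κ (G.coordsLimit r δ fv gv n) (dataLimit δ fv gv n) (some ⟨i, h⟩)
    else if i = n + δ then √(normalVar κ (G.coordsLimit r δ fv gv n)) else 0)

variable (G : GSA) {μ : ℝ → ℝ} {κ : ℝ → ℝ → ℝ → ℝ} {r : ℝ} {δ : ℕ} {fv fv' : ℕ → ℝ}
  {gv gv' : ℕ → ℕ → ℝ} {n : ℕ}

lemma infoLimit_congr (hf : ∀ k ≤ n, fv k = fv' k) (hg : ∀ k ≤ n, gv k = gv' k) :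
    infoLimit r δ fv gv n = infoLimit r δ fv' gv' n := by
  have h1 : (fun k : Fin (n + 1) => fv k) = fun k : Fin (n + 1) => fv' k :=
    funext fun k => hf k (Nat.lt_succ_iff.1 k.isLt)
  have h2 : (fun k : Fin (n + 1) => gv k) = fun k : Fin (n + 1) => gv' k :=
    funext fun k => hg k (Nat.lt_succ_iff.1 k.isLt)
  rw [infoLimit, infoLimit, h1, h2]

lemma GSA.pointLimit_congr (hf : ∀ k < n, fv k = fv' k) (hg : ∀ k < n, gv k = gv' k) :
    G.pointLimit r δ fv gv n = G.pointLimit r δ fv' gv' n := by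
  cases n with
  | zero => rfl
  | succ n =>
    have h : infoLimit r δ fv gv n = infoLimit r δ fv' gv' n :=
      infoLimit_congr (fun j hj => hf j (by omega)) (fun j hj => hg j (by omega))
    have h2 : ∀ j : Fin (n + 1), gv j = gv' j := fun j => hg j j.isLt
    simp only [GSA.pointLimit, h, h2]

lemma GSA.obsLimit_congr (hf : ∀ k < n, fv k = fv' k) (hg : ∀ k < n, gv k = gv' k) :
    G.obsLimit μ κ r δ fv gv n = G.obsLimit μ κ r δ fv' gv' n := by
  have h1 : G.coordsLimit r δ fv gv n = G.coordsLimit r δ fv' gv' n := by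
    ext1 k
    have hk := k.isLt
    rw [GSA.coordsLimit, GSA.coordsLimit, G.pointLimit_congr (fun j hj => hf j (by omega))
      (fun j hj => hg j (by omega))]
  have h2 : dataLimit δ fv gv n = dataLimit δ fv' gv' n := by
    ext k o
    cases o
    · exact hf k k.isLt
    · exact congrFun (hg k k.isLt) _
  rw [GSA.obsLimit, GSA.obsLimit, h1, h2]

variable (μ κ r δ) in
/-- The limits exist, by recursion. -/
lemma GSA.exists_limits : ∃ (fv : ℕ → ℝ) (gv : ℕ → ℕ → ℝ),
    ∀ n, (fv n, gv n) = G.obsLimit μ κ r δ fv gv n := by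
  -- Course-of-values recursion, obtained from `adaptiveObs` with the identity as observed function;
  -- the padding by zero is harmless because `obsLimit` looks only at earlier indices.
  let ξ : (k : ℕ) → (Fin k → ℝ × (ℕ → ℝ)) → ℝ × (ℕ → ℝ) := fun k d =>
    G.obsLimit μ κ r δ (fun j => if h : j < k then (d ⟨j, h⟩).1 else 0)
      (fun j => if h : j < k then (d ⟨j, h⟩).2 else 0) k
  refine ⟨fun n => (adaptiveObs ξ id n).1, fun n => (adaptiveObs ξ id n).2, fun n => ?_⟩
  conv_lhs => rw [Prod.mk.eta, adaptiveObs_eq]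
  exact G.obsLimit_congr (fun k hk => by simp [hk]) (fun k hk => by simp [hk])

variable {G} (hL : ∀ n, (fv n, gv n) = G.obsLimit μ κ r δ fv gv n)

include hL in
lemma gradLimit_eq_zero {k i : ℕ} (hi : k + δ < i) : gv k i = 0 := by
  have h := congrFun (congrArg Prod.snd (hL k)) i
  simp only [GSA.obsLimit] at h
  rw [h, dif_neg (by omega), if_neg (by omega)]

include hL in
lemma gradLimit_eq_sqrt (k : ℕ) : gv k (k + δ) = √(normalVar κ (G.coordsLimit r δ fv gv k)) := by
  have h := congrFun (congrArg Prod.snd (hL k)) (k + δ)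
  simp only [GSA.obsLimit] at h
  rw [h, dif_neg (by omega), if_pos trivial]

include hL in
lemma pointLimit_eq_zero {k i : ℕ} (hi : k + δ ≤ i) : G.pointLimit r δ fv gv k i = 0 := by
  cases k with
  | zero =>
    rw [GSA.pointLimit, startLimit_eq_zero (by omega)]
  | succ k =>
    simp only [GSA.pointLimit]
    rw [startLimit_eq_zero (by omega), mul_zero, zero_add]
    refine Finset.sum_eq_zero fun j _ => ?_
    have := j.isLt
    rw [gradLimit_eq_zero hL (by omega), mul_zero]

include hL in
lemma pointLimit_succ (k : ℕ) : G.pointLimit r δ fv gv (k + 1) (k + δ) =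
    G.hg k (infoLimit r δ fv gv k) (Fin.last k) * gv k (k + δ) := by
  simp only [GSA.pointLimit]
  rw [startLimit_eq_zero (by omega), mul_zero, zero_add, Fin.sum_univ_castSucc,
    Finset.sum_eq_zero, zero_add, Fin.val_last]
  intro j _
  have := j.isLt
  rw [gradLimit_eq_zero hL (by simp only [Fin.val_castSucc]; omega), mul_zero]

include hL in
/-- The limits of different points are different. -/
lemma exists_pointLimit_ne {k l : ℕ} (hkl : k < l)
    (hg : ∀ m < l, G.hg m (infoLimit r δ fv gv m) (Fin.last m) ≠ 0)
    (hγ : ∀ m < l, gv m (m + δ) ≠ 0) :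
    G.pointLimit r δ fv gv k (l - 1 + δ) ≠ G.pointLimit r δ fv gv l (l - 1 + δ) := by
  obtain ⟨j, rfl⟩ : ∃ j, l = j + 1 := ⟨l - 1, by omega⟩
  rw [Nat.add_sub_cancel, pointLimit_succ hL, pointLimit_eq_zero hL (by omega)]
  exact (mul_ne_zero (hg j (by omega)) (hγ j (by omega))).symm

include hL in
lemma injective_coordsLimit (hg : ∀ m < n, G.hg m (infoLimit r δ fv gv m) (Fin.last m) ≠ 0)
    (hγ : ∀ m < n, gv m (m + δ) ≠ 0) : Function.Injective (G.coordsLimit r δ fv gv n) := by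
  have key : ∀ k l : Fin (n + 1), k < l →
      G.coordsLimit r δ fv gv n k ≠ G.coordsLimit r δ fv gv n l := by
    intro k l hkl hc
    have hl := l.isLt
    have hkl' : (k : ℕ) < l := hkl
    have h1 := congrArg (fun z : Eucl (n + δ) => z ⟨l - 1 + δ, by omega⟩) hc
    exact exists_pointLimit_ne hL hkl' (fun m hm => hg m (by omega)) (fun m hm => hγ m (by omega)) h1
  intro k l hkl
  rcases lt_trichotomy k l with hlt | heq | hgt
  · exact absurd hkl (key k l hlt)
  · exact heq
  · exact absurd hkl.symm (key l k hgt)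

include hL in
lemma sum_pointLimit_pos {m k l : ℕ} (hk : k ≤ m) (hl : l ≤ m) (hkl : k ≠ l)
    (hg : ∀ j < m, G.hg j (infoLimit r δ fv gv j) (Fin.last j) ≠ 0)
    (hγ : ∀ j < m, gv j (j + δ) ≠ 0) :
    0 < ∑ i ∈ Finset.range (m + δ),
      (G.pointLimit r δ fv gv k i - G.pointLimit r δ fv gv l i) ^ 2 := by
  have key : ∃ i < m + δ, G.pointLimit r δ fv gv k i ≠ G.pointLimit r δ fv gv l i := by
    rcases lt_or_gt_of_ne hkl with h | h
    · exact ⟨l - 1 + δ, by omega, exists_pointLimit_ne hL h (fun m hm => hg m (by omega))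
        (fun m hm => hγ m (by omega))⟩
    · exact ⟨k - 1 + δ, by omega, (exists_pointLimit_ne hL h (fun m hm => hg m (by omega))
        (fun m hm => hγ m (by omega))).symm⟩
  obtain ⟨i, hi, hne⟩ := key
  exact Finset.sum_pos' (fun i _ => sq_nonneg _)
    ⟨i, Finset.mem_range.2 hi, sq_pos_of_ne_zero (sub_ne_zero.2 hne)⟩

end Limits

/-! ### Convergence of the observations -/

section Asymptotics

variable {Ω : ℕ → Type*} [∀ N, MeasurableSpace (Ω N)] {P : ∀ N, Measure (Ω N)}
  [∀ N, IsProbabilityMeasure (P N)] {μ : ℝ → ℝ} {κ : ℝ → ℝ → ℝ → ℝ} {r : ℝ} {δ : ℕ}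
  {f : ∀ N, Ω N → Eucl N → ℝ} {X : ∀ N, Ω N → Eucl N} {G : GSA}

/-- Smooth random functions in all dimensions, with independent starts of length `r`. -/
structure IsRunSetup (μ : ℝ → ℝ) (κ : ℝ → ℝ → ℝ → ℝ) (r : ℝ) (P : ∀ N, Measure (Ω N))
    (f : ∀ N, Ω N → Eucl N → ℝ) (X : ∀ N, Ω N → Eucl N) : Prop where
  smooth : ∀ N, 1 ≤ N → IsSmoothGRF μ κ (P N) (f N)
  kernel : ∀ M, IsSmoothKernel κ M
  measurable : ∀ N, 1 ≤ N → Measurable (X N)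
  indep : ∀ N, 1 ≤ N → IndepFun (X N) (f N) (P N)
  norm : ∀ N, 1 ≤ N → ∀ᵐ ω ∂P N, ‖X N ω‖ = r

lemma eq_ite_of_norm_eq (hδ : δ = if r = 0 then 0 else 1) {N : ℕ} {x : Eucl N} (h : ‖x‖ = r) :
    δ = if x = 0 then 0 else 1 := by
  rw [hδ, ← h]
  simp only [norm_eq_zero]

lemma IsRunSetup.eventually_norm (hS : IsRunSetup μ κ r P f X) :
    ∀ᶠ z in inProb P, ‖X z.1 z.2‖ = r := by
  refine eventually_inProb_of_ae ?_
  filter_upwards [eventually_ge_atTop 1] with N hN using hS.norm N hN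

lemma IsRunSetup.eventually_delta (hS : IsRunSetup μ κ r P f X)
    (hδ : δ = if r = 0 then 0 else 1) :
    ∀ᶠ z in inProb P, δ = if X z.1 z.2 = 0 then 0 else 1 := by
  filter_upwards [hS.eventually_norm] with z hz using eq_ite_of_norm_eq hδ hz

lemma tendsto_ofReal_div (C : ℝ) :
    Tendsto (fun N : ℕ => ENNReal.ofReal (C / N)) atTop (𝓝 0) := by
  have h := ENNReal.tendsto_ofReal (tendsto_const_div_atTop_nhds_zero_nat C)
  rwa [ENNReal.ofReal_zero] at h

variable {n : ℕ} {c₀ : Fin (n + 1) → Eucl (n + δ)}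

/-- The coordinates converge to distinct limits, so they are distinct with probability tending to
one. -/
lemma IsRunSetup.eventually_good (hS : IsRunSetup μ κ r P f X)
    (hδ : δ = if r = 0 then 0 else 1)
    (hrank : ∀ᶠ z in inProb P, G.FullRank (f z.1 z.2) (X z.1 z.2) n)
    (hc : Tendsto (fun z : Σ N, Ω N => G.pointCoords (f z.1 z.2) (X z.1 z.2) δ n) (inProb P) (𝓝 c₀))
    (hinj : Function.Injective c₀) : ∀ᶠ z in inProb P,
      runHistory G.rule n (X z.1 z.2) (f z.1 z.2) ∈ G.goodHistories z.1 δ n := by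
  have h1 : ∀ᶠ z in inProb P,
      Function.Injective (G.pointCoords (f z.1 z.2) (X z.1 z.2) δ n) := by
    have h2 : ∀ k l, k ≠ l → ∀ᶠ z in inProb P,
        G.pointCoords (f z.1 z.2) (X z.1 z.2) δ n k ≠
          G.pointCoords (f z.1 z.2) (X z.1 z.2) δ n l := fun k l hkl =>
      (((tendsto_pi_nhds.1 hc k).sub (tendsto_pi_nhds.1 hc l)).eventually_ne
        (sub_ne_zero.2 (hinj.ne hkl))).mono fun _ => sub_ne_zero.1
    have h3 : ∀ᶠ z in inProb P, ∀ k l, k ≠ l →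
        G.pointCoords (f z.1 z.2) (X z.1 z.2) δ n k ≠
          G.pointCoords (f z.1 z.2) (X z.1 z.2) δ n l := by
      simp only [eventually_all]
      exact fun k l hkl => h2 k l hkl
    filter_upwards [h3] with z hz k l hkl
    by_contra hne
    exact hz k l hne hkl
  filter_upwards [hrank, h1, hS.eventually_delta hδ] with z hz hz1 hz2
  exact hz.runHistory_mem hz2 hz1

/-- The observations are close to the predictions. -/
lemma IsRunSetup.tendsto_innovation (hS : IsRunSetup μ κ r P f X) (hG : G.MeasurablePrefactors)
    (hδ : δ = if r = 0 then 0 else 1)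
    (hrank : ∀ᶠ z in inProb P, G.FullRank (f z.1 z.2) (X z.1 z.2) n)
    (hc : Tendsto (fun z : Σ N, Ω N => G.pointCoords (f z.1 z.2) (X z.1 z.2) δ n) (inProb P) (𝓝 c₀))
    (hinj : Function.Injective c₀) (o : Option (Fin (n + δ))) :
    Tendsto (fun z : Σ N, Ω N =>
      frameObs (f z.1 z.2) (fun i : Fin (n + δ) => gsVec δ (X z.1 z.2)
          (G.grads (f z.1 z.2) (X z.1 z.2)) i) (G.point (f z.1 z.2) (X z.1 z.2) n) o -
        prediction μ κ (G.pointCoords (f z.1 z.2) (X z.1 z.2) δ n)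
          (fun k o => frameObs (f z.1 z.2) (fun i : Fin (n + δ) => gsVec δ (X z.1 z.2)
            (G.grads (f z.1 z.2) (X z.1 z.2)) i) (G.point (f z.1 z.2) (X z.1 z.2) k) o) o)
      (inProb P) (𝓝 0) := by
  -- `K / N` bounds the variance of the innovation. Histories with `K` above `K c₀ + 1` have
  -- vanishing probability, and on the others Chebyshev's inequality has the uniform constant `K c₀
  -- + 1`.
  set K : (Fin (n + 1) → Eucl (n + δ)) → ℝ := fun c =>
    jetKernel κ (coordJet (c (Fin.last n)) o) (coordJet (c (Fin.last n)) o) with hK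
  have hKc : Continuous K := (hS.kernel (n + δ)).continuous_coordJets _ _ _ _
  have hKm : ∀ᶠ z in inProb P, K (G.pointCoords (f z.1 z.2) (X z.1 z.2) δ n) < K c₀ + 1 :=
    ((hKc.tendsto c₀).comp hc).eventually_lt_const (by linarith)
  refine tendsto_inProb_zero_of_lintegral_le (Z := fun N ω =>
      frameObs (f N ω) (fun i : Fin (n + δ) => gsVec δ (X N ω)
          (G.grads (f N ω) (X N ω)) i) (G.point (f N ω) (X N ω) n) o -
        prediction μ κ (G.pointCoords (f N ω) (X N ω) δ n)
          (fun k o => frameObs (f N ω) (fun i : Fin (n + δ) => gsVec δ (X N ω)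
            (G.grads (f N ω) (X N ω)) i) (G.point (f N ω) (X N ω) k) o) o)
    ((hS.eventually_good hδ hrank hc hinj).and hKm) (tendsto_ofReal_div (K c₀ + 1)) ?_
  filter_upwards [eventually_ge_atTop 1] with N hN ε hε
  have hA := hG.isAdaptiveFrame (N := N) δ n
  have hB : MeasurableSet {q : History N n | K (queryCoords G.rule (histFrame δ n) q) ≤ K c₀ + 1} :=
    measurableSet_le (hKc.measurable.comp hA.measurable_queryCoords) measurable_const
  have h := (hA.mono hB).measure_innovation_le (hS.smooth N hN) hS.kernel (hS.measurable N hN)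
    (hS.indep N hN) o (C := K c₀ + 1) (fun q hq => hq.2) hε
  refine (measure_mono ?_).trans h
  rintro ω ⟨⟨h1, h2⟩, h3⟩
  refine ⟨⟨h1, ?_⟩, ?_⟩
  · change K (queryCoords G.rule (histFrame δ n) (runHistory G.rule n (X N ω) (f N ω))) ≤ K c₀ + 1
    rw [GSA.queryCoords_rule]
    exact h2.le
  · rw [GSA.queryCoords_rule, G.histFrame_rule, G.queryAt_rule]
    simp_rw [G.queryAt_rule]
    exact h3

/-- The length of the Gram-Schmidt candidate. -/
lemma IsRunSetup.tendsto_candidate (hS : IsRunSetup μ κ r P f X) (hG : G.MeasurablePrefactors)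
    (hδ : δ = if r = 0 then 0 else 1)
    (hrank : ∀ᶠ z in inProb P, G.FullRank (f z.1 z.2) (X z.1 z.2) n)
    (hc : Tendsto (fun z : Σ N, Ω N => G.pointCoords (f z.1 z.2) (X z.1 z.2) δ n) (inProb P) (𝓝 c₀))
    (hinj : Function.Injective c₀) :
    Tendsto (fun z : Σ N, Ω N => ‖G.candidate (f z.1 z.2) (X z.1 z.2) n‖) (inProb P)
      (𝓝 (√(normalVar κ c₀))) := by
  have hs := (hS.kernel (n + δ + 1)).tendsto_normalVar hc hinj
  have hsm : ∀ᶠ z in inProb P,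
      normalVar κ (G.pointCoords (f z.1 z.2) (X z.1 z.2) δ n) < normalVar κ c₀ + 1 :=
    hs.eventually_lt_const (by linarith)
  have h0 : Tendsto (fun z : Σ N, Ω N => ‖G.candidate (f z.1 z.2) (X z.1 z.2) n‖ ^ 2 -
      normalVar κ (G.pointCoords (f z.1 z.2) (X z.1 z.2) δ n)) (inProb P) (𝓝 0) := by
    refine tendsto_inProb_zero_of_lintegral_le (Z := fun N ω =>
      ‖G.candidate (f N ω) (X N ω) n‖ ^ 2 - normalVar κ (G.pointCoords (f N ω) (X N ω) δ n))
      (((hS.eventually_good hδ hrank hc hinj).and hsm).and (hrank.and (hS.eventually_delta hδ)))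
      (tendsto_ofReal_div ((normalVar κ c₀ + 1) ^ 2 * (squareVar + ((n + δ : ℕ) : ℝ) ^ 2))) ?_
    filter_upwards [eventually_ge_atTop 1] with N hN ε hε
    have hA := hG.isAdaptiveFrame (N := N) δ n
    have hB : MeasurableSet {q : History N n |
        normalVar κ (queryCoords G.rule (histFrame δ n) q) ≤ normalVar κ c₀ + 1} :=
      measurableSet_le ((hS.kernel (n + δ + 1)).measurable_normalVar.comp hA.measurable_queryCoords)
        measurable_const
    have h := (hA.mono hB).measure_norm_sq_le (hS.smooth N hN) hS.kernel (hS.measurable N hN)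
      (hS.indep N hN) (C := normalVar κ c₀ + 1) (fun q hq => hq.2) hε
    refine (measure_mono ?_).trans h
    rintro ω ⟨⟨⟨h1, h2⟩, h3, h4⟩, h5⟩
    refine ⟨⟨h1, ?_⟩, ?_⟩
    · change normalVar κ (queryCoords G.rule (histFrame δ n)
        (runHistory G.rule n (X N ω) (f N ω))) ≤ normalVar κ c₀ + 1
      rw [GSA.queryCoords_rule]
      exact h2.le
    · rw [GSA.queryCoords_rule, h3.normalResidual_eq h4]
      exact h5
  have h1 := (h0.add hs).sqrt
  simp only [sub_add_cancel, zero_add] at h1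
  simpa only [Real.sqrt_sq (norm_nonneg _)] using h1

/-- The gradients are almost surely linearly independent if the most recent gradient is used. -/
lemma IsRunSetup.ae_fullRank (hS : IsRunSetup μ κ r P f X) (hG : G.MeasurablePrefactors)
    (hG' : G.UsesRecentGradient) (hδ : δ = if r = 0 then 0 else 1) {N : ℕ} (hN : 1 ≤ N) (m : ℕ)
    (hm : m + δ ≤ N) : ∀ᵐ ω ∂P N, G.FullRank (f N ω) (X N ω) m := by
  induction m with
  | zero => exact ae_of_all _ fun ω k hk => absurd hk (by omega)
  | succ n ih =>
    have hA := hG.isAdaptiveFrame (N := N) δ n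
    -- The system consists of `n + δ < N` vectors, which leaves a normal direction in which the
    -- residual is almost surely nonzero.
    have h := hA.measure_normalResidual_eq_zero (hS.smooth N hN) hS.kernel (hS.measurable N hN)
      (hS.indep N hN) (by omega)
    filter_upwards [ih (by omega), hS.norm N hN, measure_eq_zero_iff_ae_notMem.1 h] with ω h1 h2 h3
    have hd := eq_ite_of_norm_eq hδ h2
    have hgood := h1.runHistory_mem hd (h1.injective_pointCoords hd hG')
    intro k hk
    rcases Nat.lt_succ_iff_lt_or_eq.1 hk with hlt | rfl
    · exact h1 k hlt
    · intro h0
      refine h3 ⟨hgood, ?_⟩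
      rw [h1.normalResidual_eq hd, h0]

end Asymptotics

/-! ### Convergence of the run -/

section RunLimit

variable {Ω : ℕ → Type*} [∀ N, MeasurableSpace (Ω N)] {P : ∀ N, Measure (Ω N)}
  [∀ N, IsProbabilityMeasure (P N)] {μ : ℝ → ℝ} {κ : ℝ → ℝ → ℝ → ℝ} {r : ℝ} {δ : ℕ}
  {f : ∀ N, Ω N → Eucl N → ℝ} {X : ∀ N, Ω N → Eucl N} {G : GSA} {fv : ℕ → ℝ} {gv : ℕ → ℕ → ℝ}
  {m n : ℕ}

/-- The observations at the first `m` points and the points up to the `n`-th one converge. -/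
structure IsRunLimit (P : ∀ N, Measure (Ω N)) (f : ∀ N, Ω N → Eucl N → ℝ) (X : ∀ N, Ω N → Eucl N)
    (G : GSA) (r : ℝ) (δ : ℕ) (fv : ℕ → ℝ) (gv : ℕ → ℕ → ℝ) (m n : ℕ) : Prop where
  rank : ∀ᶠ z in inProb P, G.FullRank (f z.1 z.2) (X z.1 z.2) m
  value : ∀ k < m, Tendsto (fun z : Σ N, Ω N => f z.1 z.2 (G.point (f z.1 z.2) (X z.1 z.2) k))
    (inProb P) (𝓝 (fv k))
  grad : ∀ k < m, ∀ i, Tendsto (fun z : Σ N, Ω N => (inner ℝ (G.grads (f z.1 z.2) (X z.1 z.2) k)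
    (gsVec δ (X z.1 z.2) (G.grads (f z.1 z.2) (X z.1 z.2)) i) : ℝ)) (inProb P) (𝓝 (gv k i))
  point : ∀ k ≤ n, ∀ i, Tendsto (fun z : Σ N, Ω N => (inner ℝ (G.point (f z.1 z.2) (X z.1 z.2) k)
    (gsVec δ (X z.1 z.2) (G.grads (f z.1 z.2) (X z.1 z.2)) i) : ℝ)) (inProb P)
    (𝓝 (G.pointLimit r δ fv gv k i))
  pos : ∀ k < m, 0 < gv k (k + δ)

/-- The length of the start determines whether it vanishes. -/
lemma eventually_delta_of_norm (hX : ∀ᶠ z in inProb P, ‖X z.1 z.2‖ = r)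
    (hδ : δ = if r = 0 then 0 else 1) : ∀ᶠ z in inProb P, δ = if X z.1 z.2 = 0 then 0 else 1 := by
  filter_upwards [hX] with z hz using eq_ite_of_norm_eq hδ hz

lemma tendsto_inner_start (hX : ∀ᶠ z in inProb P, ‖X z.1 z.2‖ = r)
    (hδ : δ = if r = 0 then 0 else 1) (i : ℕ) : Tendsto (fun z : Σ N, Ω N => (inner ℝ (X z.1 z.2)
      (gsVec δ (X z.1 z.2) (G.grads (f z.1 z.2) (X z.1 z.2)) i) : ℝ)) (inProb P)
      (𝓝 (startLimit r δ i)) := by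
  refine tendsto_const_nhds.congr' ?_
  filter_upwards [hX, eventually_delta_of_norm hX hδ] with z hz hz'
  rw [GSA.inner_start_gsVec hz', hz, startLimit]

lemma isRunLimit_zero (hX : ∀ᶠ z in inProb P, ‖X z.1 z.2‖ = r)
    (hδ : δ = if r = 0 then 0 else 1) : IsRunLimit P f X G r δ fv gv 0 0 where
  rank := Eventually.of_forall fun _ k hk => absurd hk (Nat.not_lt_zero k)
  value k hk := absurd hk (Nat.not_lt_zero k)
  grad k hk := absurd hk (Nat.not_lt_zero k)
  point k hk i := by
    obtain rfl := Nat.le_zero.1 hk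
    simp_rw [G.point_zero]
    exact tendsto_inner_start hX hδ i
  pos k hk := absurd hk (Nat.not_lt_zero k)

lemma IsRunLimit.congr {f' : ∀ N, Ω N → Eucl N → ℝ} (hR : IsRunLimit P f' X G r δ fv gv m n)
    (hf : ∀ᶠ z in inProb P, f z.1 z.2 = f' z.1 z.2) : IsRunLimit P f X G r δ fv gv m n where
  rank := by
    filter_upwards [hR.rank, hf] with z h1 h2
    rwa [h2]
  value k hk := (hR.value k hk).congr' (by filter_upwards [hf] with z h; rw [h])
  grad k hk i := (hR.grad k hk i).congr' (by filter_upwards [hf] with z h; rw [h])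
  point k hk i := (hR.point k hk i).congr' (by filter_upwards [hf] with z h; rw [h])
  pos := hR.pos

/-- The observations at the next point converge. -/
lemma IsRunLimit.observe
    (hR : IsRunLimit P f X G r δ fv gv n n) (hS : IsRunSetup μ κ r P f X)
    (hμ : ContDiff ℝ 1 μ) (hG : G.MeasurablePrefactors) (hδ : δ = if r = 0 then 0 else 1)
    (hL : ∀ n, (fv n, gv n) = G.obsLimit μ κ r δ fv gv n)
    (hg : ∀ m < n, G.hg m (infoLimit r δ fv gv m) (Fin.last m) ≠ 0) :
    IsRunLimit P f X G r δ fv gv (n + 1) n := by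
  have hinj : Function.Injective (G.coordsLimit r δ fv gv n) :=
    injective_coordsLimit hL hg fun m hm => (hR.pos m hm).ne'
  have hc : Tendsto (fun z : Σ N, Ω N => G.pointCoords (f z.1 z.2) (X z.1 z.2) δ n) (inProb P)
      (𝓝 (G.coordsLimit r δ fv gv n)) := by
    refine tendsto_pi_nhds.2 fun k => ?_
    refine ((PiLp.continuous_toLp 2 _).tendsto _).comp (tendsto_pi_nhds.2 fun i => ?_)
    exact (hR.point k (Nat.lt_succ_iff.1 k.isLt) i).congr fun _ => real_inner_comm _ _
  have hdata : ∀ (k : Fin n) (o : Option (Fin (n + δ))), Tendsto (fun z : Σ N, Ω N =>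
      frameObs (f z.1 z.2) (fun i : Fin (n + δ) => gsVec δ (X z.1 z.2)
        (G.grads (f z.1 z.2) (X z.1 z.2)) i) (G.point (f z.1 z.2) (X z.1 z.2) k) o) (inProb P)
      (𝓝 (dataLimit δ fv gv n k o)) := by
    rintro k (_ | i)
    · exact hR.value k k.isLt
    · exact hR.grad k k.isLt i
  -- The observation is its prediction from the random past plus an innovation that tends to zero,
  -- and the prediction is continuous at the limiting configuration.
  have hobs : ∀ o : Option (Fin (n + δ)), Tendsto (fun z : Σ N, Ω N =>
      frameObs (f z.1 z.2) (fun i : Fin (n + δ) => gsVec δ (X z.1 z.2)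
        (G.grads (f z.1 z.2) (X z.1 z.2)) i) (G.point (f z.1 z.2) (X z.1 z.2) n) o) (inProb P)
      (𝓝 (prediction μ κ (G.coordsLimit r δ fv gv n) (dataLimit δ fv gv n) o)) := fun o => by
    have h := (hS.tendsto_innovation hG hδ hR.rank hc hinj o).add
      ((hS.kernel (n + δ)).tendsto_prediction hμ hc hinj hdata o)
    simpa only [sub_add_cancel, zero_add] using h
  have hcand := hS.tendsto_candidate hG hδ hR.rank hc hinj
  have hpos : 0 < √(normalVar κ (G.coordsLimit r δ fv gv n)) :=
    Real.sqrt_pos.2 ((hS.kernel (n + δ + 1)).normalVar_pos hinj)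
  have hLn := hL n
  have hf := congrArg Prod.fst hLn
  have hgv := congrArg Prod.snd hLn
  simp only [GSA.obsLimit] at hf hgv
  refine ⟨?_, fun k hk => ?_, fun k hk i => ?_, hR.point, fun k hk => ?_⟩
  · filter_upwards [hR.rank, hcand.eventually_ne hpos.ne'] with z h1 h2 k hk
    rcases Nat.lt_succ_iff_lt_or_eq.1 hk with hk | rfl
    · exact h1 k hk
    · exact norm_ne_zero_iff.1 h2
  · rcases Nat.lt_succ_iff_lt_or_eq.1 hk with hk | rfl
    · exact hR.value k hk
    · rw [hf]
      exact hobs none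
  · rcases Nat.lt_succ_iff_lt_or_eq.1 hk with hk | rfl
    · exact hR.grad k hk i
    -- Coordinates in known directions are predicted, the coordinate in the new direction is the
    -- length of the candidate, and the gradient has no component in later directions.
    · rcases lt_trichotomy i (k + δ) with hi | rfl | hi
      · rw [congrFun hgv i, dif_pos hi]
        exact hobs (some ⟨i, hi⟩)
      · rw [gradLimit_eq_sqrt hL]
        refine hcand.congr' ?_
        filter_upwards [hS.eventually_delta hδ] with z hz
        exact (GSA.inner_grads_gsVec hz k).symm
      · rw [gradLimit_eq_zero hL hi]
        refine tendsto_const_nhds.congr' ?_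
        filter_upwards [hS.eventually_delta hδ] with z hz
        exact (GSA.inner_gsVec_eq_zero hz (G.gradient_mem _ _ (Nat.lt_succ_self k))
          (by omega)).symm
  · rcases Nat.lt_succ_iff_lt_or_eq.1 hk with hk | rfl
    · exact hR.pos k hk
    · rw [gradLimit_eq_sqrt hL]
      exact hpos

/-- The information converges. -/
lemma IsRunLimit.tendsto_info (hR : IsRunLimit P f X G r δ fv gv (n + 1) m)
    (hX : ∀ᶠ z in inProb P, ‖X z.1 z.2‖ = r) (hδ : δ = if r = 0 then 0 else 1) :
    Tendsto (fun z : Σ N, Ω N => G.info (f z.1 z.2) (X z.1 z.2) n) (inProb P)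
      (𝓝 (infoLimit r δ fv gv n)) := by
  have hv : ∀ (i : Fin (n + 2)) (l : ℕ), Tendsto (fun z : Σ N, Ω N => (inner ℝ
      (spanVectors (f z.1 z.2) (X z.1 z.2)
        (fun k : Fin (n + 1) => G.point (f z.1 z.2) (X z.1 z.2) k.val) i)
      (gsVec δ (X z.1 z.2) (G.grads (f z.1 z.2) (X z.1 z.2)) l) : ℝ)) (inProb P)
      (𝓝 ((Fin.cons (startLimit r δ) fun k : Fin (n + 1) => gv k : Fin (n + 2) → ℕ → ℝ) i l)) := by
    intro i l
    refine Fin.cases ?_ (fun k => ?_) i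
    · exact tendsto_inner_start hX hδ l
    · exact hR.grad k k.isLt l
  have hmem : ∀ (z : Σ N, Ω N) (i : Fin (n + 2)), spanVectors (f z.1 z.2) (X z.1 z.2)
      (fun k : Fin (n + 1) => G.point (f z.1 z.2) (X z.1 z.2) k.val) i ∈
      G.evalSpace (f z.1 z.2) (X z.1 z.2) (n + 1) := by
    intro z i
    refine Fin.cases ?_ (fun k => ?_) i
    · exact G.start_mem _ _ _
    · exact G.gradient_mem _ _ k.isLt
  refine Tendsto.prodMk_nhds (tendsto_pi_nhds.2 fun k => hR.value k k.isLt)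
    (tendsto_pi_nhds.2 fun i => tendsto_pi_nhds.2 fun j => ?_)
  -- All the vectors lie in `V_{n+1}`, so on the event of full rank their inner products are sums
  -- over `n + 1 + δ` coordinates.
  refine (tendsto_finsetSum (Finset.range (n + 1 + δ)) fun l _ => (hv i l).mul (hv j l)).congr' ?_
  filter_upwards [hR.rank, eventually_delta_of_norm hX hδ] with z h1 h2
  exact (h1.inner_eq_sum h2 (hmem z i) (hmem z j)).symm

/-- The next point converges. -/
lemma IsRunLimit.move (hR : IsRunLimit P f X G r δ fv gv (n + 1) n)
    (hX : ∀ᶠ z in inProb P, ‖X z.1 z.2‖ = r) (hδ : δ = if r = 0 then 0 else 1)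
    (hreg : G.RegularAt n (infoLimit r δ fv gv n)) :
    IsRunLimit P f X G r δ fv gv (n + 1) (n + 1) := by
  refine { hR with point := fun k hk i => ?_ }
  rcases Nat.lt_or_eq_of_le hk with hk | rfl
  · exact hR.point k (by omega) i
  have hI := hR.tendsto_info hX hδ
  -- Continuity of the prefactors is used at the limiting information only.
  have h1 := hreg.1.tendsto.comp hI
  have h2 := tendsto_pi_nhds.1 (hreg.2.1.tendsto.comp hI)
  simp_rw [G.point_succ, inner_add_left, sum_inner, real_inner_smul_left]
  exact (h1.mul (tendsto_inner_start hX hδ i)).add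
    (tendsto_finsetSum _ fun k _ => (h2 k).mul (hR.grad k k.isLt i))

/-- The run converges as long as the prefactors are regular at the limits. -/
lemma IsRunSetup.isRunLimit (hS : IsRunSetup μ κ r P f X)
    (hμ : ContDiff ℝ 1 μ) (hG : G.MeasurablePrefactors) (hδ : δ = if r = 0 then 0 else 1)
    (hL : ∀ n, (fv n, gv n) = G.obsLimit μ κ r δ fv gv n) (n : ℕ)
    (hreg : ∀ m < n, G.RegularAt m (infoLimit r δ fv gv m)) :
    IsRunLimit P f X G r δ fv gv n n := by
  induction n with
  | zero => exact isRunLimit_zero hS.eventually_norm hδ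
  | succ n ih =>
    exact ((ih fun m hm => hreg m (by omega)).observe hS hμ hG hδ hL
      fun m hm => (hreg m (by omega)).2.2).move hS.eventually_norm hδ (hreg n (by omega))

end RunLimit

/-! ### Consequences of the convergence -/

section Consequences

variable {Ω : ℕ → Type*} [∀ N, MeasurableSpace (Ω N)] {P : ∀ N, Measure (Ω N)}
  [∀ N, IsProbabilityMeasure (P N)] {μ : ℝ → ℝ} {κ : ℝ → ℝ → ℝ → ℝ} {r : ℝ} {δ : ℕ}
  {f : ∀ N, Ω N → Eucl N → ℝ} {X : ∀ N, Ω N → Eucl N} {G : GSA} {fv : ℕ → ℝ} {gv : ℕ → ℕ → ℝ}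
  {m n : ℕ}

/-- The kernel of random functions in all positive dimensions is smooth in all dimensions. -/
lemma isSmoothKernel_of_pos (h : ∀ N, 1 ≤ N → IsSmoothKernel κ N) (M : ℕ) :
    IsSmoothKernel κ M :=
  (h (M + 1) (by omega)).restrict (hyperplaneEmbedding M)

/-- Random functions with almost surely smooth paths agree almost surely with functions that satisfy
the assumptions of `IsRunSetup`. -/
lemma exists_isRunSetup (hμ : ContDiff ℝ 1 μ)
    (hf : ∀ N, 1 ≤ N → IsIsotropicGRF μ κ (P N) (f N))
    (hC : ∀ N, 1 ≤ N → ∀ᵐ ω ∂(P N), ContDiff ℝ 1 (f N ω))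
    (hpd : ∀ N, 1 ≤ N → IsStrictlyPosDef (P N) (fun ω => withGradient (f N ω)))
    (hX : ∀ N, 1 ≤ N → Measurable (X N)) (hind : ∀ N, 1 ≤ N → IndepFun (X N) (f N) (P N))
    (hr : ∀ N, 1 ≤ N → ∀ᵐ ω ∂(P N), ‖X N ω‖ = r) :
    ∃ f' : ∀ N, Ω N → Eucl N → ℝ, IsRunSetup μ κ r P f' X ∧
      ∀ N, 1 ≤ N → ∀ᵐ ω ∂(P N), f N ω = f' N ω := by
  choose! f' hf' hff using fun N hN => exists_smooth_modification (hf N hN) hμ hN (hC N hN)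
  exact ⟨f', ⟨hf', isSmoothKernel_of_pos fun N hN =>
    (hf' N hN).isSmoothKernel (isStrictlyPosDef_congr (hff N hN) (hpd N hN)), hX,
    fun N hN => (hind N hN).congr (ae_eq_refl _) (hff N hN), hr⟩, hff⟩

/-- With probability tending to one no vector is skipped, and then the basis of `V_{n+1}` consists
of the vectors for which the limits are known. -/
lemma IsRunLimit.tendsto_coordInfo (hR : IsRunLimit P f X G r δ fv gv (n + 1) m)
    (hX : ∀ᶠ z in inProb P, ‖X z.1 z.2‖ = r) (hδ : δ = if r = 0 then 0 else 1) :
    Tendsto (fun z : Σ N, Ω N => G.coordInfo (f z.1 z.2) (X z.1 z.2) n (n + 1 + δ)) (inProb P)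
      (𝓝 (fun k => fv k.val, fun k i => gv k.val i.val)) := by
  refine Tendsto.prodMk_nhds (tendsto_pi_nhds.2 fun k => hR.value k k.isLt)
    (tendsto_pi_nhds.2 fun k => tendsto_pi_nhds.2 fun i => ?_)
  refine (hR.grad k k.isLt i).congr' ?_
  filter_upwards [hR.rank, eventually_delta_of_norm hX hδ] with z h1 h2
  rw [h1.basisVec_eq h2 le_rfl i.isLt]
  rfl

lemma IsRunLimit.eventually_dim (hR : IsRunLimit P f X G r δ fv gv n m)
    (hX : ∀ᶠ z in inProb P, ‖X z.1 z.2‖ = r) (hδ : δ = if r = 0 then 0 else 1) {k : ℕ}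
    (hk : k ≤ n) : ∀ᶠ z in inProb P, G.dim (f z.1 z.2) (X z.1 z.2) k = k + δ := by
  filter_upwards [hR.rank, eventually_delta_of_norm hX hδ] with z h1 h2
  exact h1.dim_eq h2 hk

lemma IsRunLimit.tendsto_inner_gradient (hR : IsRunLimit P f X G r δ fv gv n m)
    (hX : ∀ᶠ z in inProb P, ‖X z.1 z.2‖ = r) (hδ : δ = if r = 0 then 0 else 1) {k : ℕ}
    (hk : k < n) : Tendsto (fun z : Σ N, Ω N => (inner ℝ
      (gradient (f z.1 z.2) (G.point (f z.1 z.2) (X z.1 z.2) k))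
      (G.basisVec (f z.1 z.2) (X z.1 z.2) (k + 1) (G.dim (f z.1 z.2) (X z.1 z.2) k)) : ℝ))
      (inProb P) (𝓝 (gv k (k + δ))) := by
  refine (hR.grad k hk (k + δ)).congr' ?_
  filter_upwards [hR.rank, eventually_delta_of_norm hX hδ] with z h1 h2
  rw [h1.dim_eq h2 hk.le, h1.basisVec_eq h2 hk (by omega)]
  rfl

lemma IsRunLimit.tendsto_norm_candidate (hR : IsRunLimit P f X G r δ fv gv n m)
    (hX : ∀ᶠ z in inProb P, ‖X z.1 z.2‖ = r) (hδ : δ = if r = 0 then 0 else 1) {k : ℕ}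
    (hk : k < n) : Tendsto (fun z : Σ N, Ω N => ‖G.candidate (f z.1 z.2) (X z.1 z.2) k‖)
      (inProb P) (𝓝 (gv k (k + δ))) := by
  refine (hR.grad k hk (k + δ)).congr' ?_
  filter_upwards [eventually_delta_of_norm hX hδ] with z h2
  exact GSA.inner_grads_gsVec h2 k

lemma IsRunLimit.tendsto_inner_point (hR : IsRunLimit P f X G r δ fv gv n n)
    (hX : ∀ᶠ z in inProb P, ‖X z.1 z.2‖ = r) (hδ : δ = if r = 0 then 0 else 1) {k i : ℕ}
    (hm : m ≤ n) (hk : k ≤ m) (hi : i < m + δ) : Tendsto (fun z : Σ N, Ω N => (inner ℝ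
      (G.point (f z.1 z.2) (X z.1 z.2) k) (G.basisVec (f z.1 z.2) (X z.1 z.2) m i) : ℝ))
      (inProb P) (𝓝 (G.pointLimit r δ fv gv k i)) := by
  refine (hR.point k (hk.trans hm) i).congr' ?_
  filter_upwards [hR.rank, eventually_delta_of_norm hX hδ] with z h1 h2
  rw [h1.basisVec_eq h2 hm hi]

/-- Squared lengths converge if the coordinates do. -/
lemma IsRunLimit.tendsto_norm_sq (hR : IsRunLimit P f X G r δ fv gv n n)
    (hX : ∀ᶠ z in inProb P, ‖X z.1 z.2‖ = r) (hδ : δ = if r = 0 then 0 else 1)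
    (hm : m ≤ n) {x : ∀ z : Σ N, Ω N, Eucl z.1} {y : ℕ → ℝ}
    (hx : ∀ z, x z ∈ G.evalSpace (f z.1 z.2) (X z.1 z.2) m)
    (hy : ∀ i < m + δ, Tendsto (fun z : Σ N, Ω N => (inner ℝ (x z)
      (G.basisVec (f z.1 z.2) (X z.1 z.2) m i) : ℝ)) (inProb P) (𝓝 (y i))) :
    Tendsto (fun z => ‖x z‖ ^ 2) (inProb P) (𝓝 (∑ i ∈ Finset.range (m + δ), y i ^ 2)) := by
  refine (tendsto_finsetSum (Finset.range (m + δ)) fun i hi =>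
    (hy i (Finset.mem_range.1 hi)).pow 2).congr' ?_
  filter_upwards [hR.eventually_dim hX hδ hm] with z hz
  rw [G.norm_sq_eq_sum _ _ (hx z), hz]

end Consequences

theorem mainTheorem1
    (μ : ℝ → ℝ) (κ : ℝ → ℝ → ℝ → ℝ)
    (hvalid : ValidInAllDimensions μ κ) (hsmooth : SufficientlySmooth μ κ)
    (G : GSA) (r : ℝ) (δ : ℕ) (hδ : δ = if r = 0 then 0 else 1) :
    -- the limits depend only on the algorithm, on `μ`, `κ` and on the length `r` of the start
    ∃ (limI : (n : ℕ) → Info n) (limf : ℕ → ℝ) (γ : ℕ → ℕ → ℝ) (y : ℕ → ℕ → ℝ),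
      ∀ (Ω : ℕ → Type*) [∀ N, MeasurableSpace (Ω N)] (P : ∀ N, Measure (Ω N))
        [∀ N, IsProbabilityMeasure (P N)]
        (f : ∀ N, Ω N → Eucl N → ℝ) (X₀ : ∀ N, Ω N → Eucl N),
        (∀ N, 1 ≤ N → IsIsotropicGRF μ κ (P N) (f N)) →
        (∀ N, 1 ≤ N → ∀ᵐ ω ∂(P N), ContDiff ℝ 1 (f N ω)) →
        (∀ N, 1 ≤ N → IsStrictlyPosDef (P N) (fun ω => withGradient (f N ω))) →
        (∀ N, 1 ≤ N → Measurable (X₀ N)) →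
        (∀ N, 1 ≤ N → IndepFun (X₀ N) (f N) (P N)) →
        (∀ N, 1 ≤ N → ∀ᵐ ω ∂(P N), ‖X₀ N ω‖ = r) →
        -- the main theorem
        (G.ContinuousPrefactors → G.UsesRecentGradient →
          ∀ n, TendstoInProb P (fun N ω => G.info (f N ω) (X₀ N ω) n) (limI n)) ∧
        -- the extension, for prefactors that are regular at the limiting information only
        (G.MeasurablePrefactors → ∀ n : ℕ,
          ((∀ m < n, G.RegularAt m (limI m)) →
            -- information convergence
            TendstoInProb P (fun N ω => G.info (f N ω) (X₀ N ω) n) (limI n) ∧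
            TendstoInProb P (fun N ω => G.coordInfo (f N ω) (X₀ N ω) n (n + 1 + δ))
              (fun k => limf k.val, fun k i => γ k.val i.val) ∧
            -- full rank
            (G.UsesRecentGradient → ∀ m ≤ n + 1, ∀ N, 1 ≤ N → m + δ ≤ N →
              ∀ᵐ ω ∂(P N), G.dim (f N ω) (X₀ N ω) m = m + δ) ∧
            -- asymptotic full rank
            (∀ m ≤ n + 1, Tendsto
              (fun N => P N {ω | G.dim (f N ω) (X₀ N ω) m = m + δ}) atTop (𝓝 1)) ∧
            (∀ k ≤ n,
              TendstoInProb P (fun N ω => inner ℝ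
                (gradient (f N ω) (G.point (f N ω) (X₀ N ω) k))
                (G.basisVec (f N ω) (X₀ N ω) (k + 1) (G.dim (f N ω) (X₀ N ω) k)))
                (γ k (k + δ)) ∧
              TendstoInProb P (fun N ω => ‖G.candidate (f N ω) (X₀ N ω) k‖) (γ k (k + δ)) ∧
              γ k (k + δ) ≠ 0)) ∧
          ((∀ m ≤ n, G.RegularAt m (limI m)) →
            -- representation of the evaluation points and of their distances
            (∀ m ≤ n + 1, ∀ k ≤ m,
              (∀ i < m + δ, TendstoInProb P (fun N ω => inner ℝ
                (G.point (f N ω) (X₀ N ω) k) (G.basisVec (f N ω) (X₀ N ω) m i)) (y k i)) ∧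
              (∀ N ω, ‖G.point (f N ω) (X₀ N ω) k‖ ^ 2 =
                ∑ i ∈ Finset.range (G.dim (f N ω) (X₀ N ω) m), (inner ℝ
                  (G.point (f N ω) (X₀ N ω) k) (G.basisVec (f N ω) (X₀ N ω) m i)) ^ 2) ∧
              TendstoInProb P (fun N ω => ‖G.point (f N ω) (X₀ N ω) k‖ ^ 2)
                (∑ i ∈ Finset.range (m + δ), (y k i) ^ 2) ∧
              ∀ l ≤ m,
                (∀ N ω, ‖G.point (f N ω) (X₀ N ω) k - G.point (f N ω) (X₀ N ω) l‖ ^ 2 =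
                  ∑ i ∈ Finset.range (G.dim (f N ω) (X₀ N ω) m), (inner ℝ
                    (G.point (f N ω) (X₀ N ω) k - G.point (f N ω) (X₀ N ω) l)
                    (G.basisVec (f N ω) (X₀ N ω) m i)) ^ 2) ∧
                TendstoInProb P
                  (fun N ω => ‖G.point (f N ω) (X₀ N ω) k - G.point (f N ω) (X₀ N ω) l‖ ^ 2)
                  (∑ i ∈ Finset.range (m + δ), (y k i - y l i) ^ 2)) ∧
            -- the evaluation points are asymptotically different
            (∀ k ≤ n + 1, ∀ l ≤ n + 1, k ≠ l →
              0 < ∑ i ∈ Finset.range (n + 1 + δ), (y k i - y l i) ^ 2))) := by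
  have hμ := hsmooth.mean
  obtain ⟨fv, gv, hL⟩ := G.exists_limits μ κ r δ
  -- The limits are fixed before any probability space is introduced, so they depend on `G`, `μ`,
  -- `κ` and `r` (which determines `δ`) only.
  refine ⟨infoLimit r δ fv gv, fv, gv, G.pointLimit r δ fv gv, ?_⟩
  intro Ω _ P _ f X₀ hf hC hpd hXm hind hr
  obtain ⟨f', hS, hff⟩ := exists_isRunSetup hμ hf hC hpd hXm hind hr
  have hX : ∀ᶠ z in inProb P, ‖X₀ z.1 z.2‖ = r := hS.eventually_norm
  have hfe : ∀ᶠ z in inProb P, f z.1 z.2 = f' z.1 z.2 := by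
    refine eventually_inProb_of_ae ?_
    filter_upwards [eventually_ge_atTop 1] with N hN using hff N hN
  -- Regularity of the first `n` prefactors controls the points up to index `n` and the observations
  -- at all of them. The result carries over from the smooth modification because it agrees with `f`
  -- almost surely.
  have hlim : G.MeasurablePrefactors → ∀ n, (∀ m < n, G.RegularAt m (infoLimit r δ fv gv m)) →
      IsRunLimit P f X₀ G r δ fv gv (n + 1) n := fun hG n hreg =>
    ((hS.isRunLimit hμ hG hδ hL n hreg).observe hS hμ hG hδ hL fun m hm => (hreg m hm).2.2).congr hfe
  refine ⟨fun hcont hlast n => ?_, fun hG n => ⟨fun hreg => ?_, fun hreg => ?_⟩⟩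
  · rw [tendstoInProb_iff]
    -- Continuous prefactors whose newest-gradient component vanishes nowhere are measurable and
    -- regular at every point, so the main theorem is a case of the extension.
    exact (hlim (fun n => ⟨(hcont n).1.measurable, (hcont n).2.measurable⟩) n fun m _ =>
      ⟨(hcont m).1.continuousAt, (hcont m).2.continuousAt, hlast m _⟩).tendsto_info hX hδ
  · have hR := hlim hG n hreg
    refine ⟨tendstoInProb_iff.2 (hR.tendsto_info hX hδ),
      tendstoInProb_iff.2 (hR.tendsto_coordInfo hX hδ), fun hlast m _ N hN hmN => ?_,
      fun m hm => tendsto_measure_one (hR.eventually_dim hX hδ hm), fun k hk =>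
      ⟨tendstoInProb_iff.2 (hR.tendsto_inner_gradient hX hδ (Nat.lt_succ_of_le hk)),
      tendstoInProb_iff.2 (hR.tendsto_norm_candidate hX hδ (Nat.lt_succ_of_le hk)),
      (hR.pos k (Nat.lt_succ_of_le hk)).ne'⟩⟩
    filter_upwards [hS.ae_fullRank hG hlast hδ hN m hmN, hff N hN, hr N hN] with ω h1 h2 h3
    rw [h2]
    exact h1.dim_eq (eq_ite_of_norm_eq hδ h3) le_rfl
  · have hR : IsRunLimit P f X₀ G r δ fv gv (n + 1) (n + 1) :=
      (hlim hG n fun m hm => hreg m hm.le).move hX hδ (hreg n le_rfl)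
    refine ⟨fun m hm k hk => ?_, fun k hk l hl hkl => sum_pointLimit_pos hL hk hl hkl
      (fun j hj => (hreg j (Nat.lt_succ_iff.1 hj)).2.2) fun j hj => (hR.pos j hj).ne'⟩
    have hpt : ∀ k ≤ m, ∀ i < m + δ, _ := fun k hk i hi =>
      hR.tendsto_inner_point hX hδ (k := k) (i := i) hm hk hi
    refine ⟨fun i hi => tendstoInProb_iff.2 (hpt k hk i hi),
      fun N ω => G.norm_sq_eq_sum _ _ (G.point_mem _ _ hk),
      tendstoInProb_iff.2 (hR.tendsto_norm_sq hX hδ hm (fun z => G.point_mem _ _ hk) (hpt k hk)),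
      fun l hl => ⟨fun N ω => G.norm_sq_eq_sum _ _
        (Submodule.sub_mem _ (G.point_mem _ _ hk) (G.point_mem _ _ hl)),
      tendstoInProb_iff.2 (hR.tendsto_norm_sq hX hδ hm
        (x := fun z => G.point (f z.1 z.2) (X₀ z.1 z.2) k - G.point (f z.1 z.2) (X₀ z.1 z.2) l)
        (fun z => Submodule.sub_mem _ (G.point_mem _ _ hk) (G.point_mem _ _ hl)) fun i hi => ?_)⟩⟩
    simp_rw [inner_sub_left]
    exact (hpt k hk i hi).sub (hpt l hl i hi)
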